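/- Let $\Omega\subset\mathbb R^3$ be a bounded open set with Lipschitz boundary, and let $\partial\Omega_D,\partial\Omega_N\subset\partial\Omega$ be disjoint measurable sets with $\overline{\partial\Omega_D}\cup\overline{\partial\Omega_N}=\partial\Omega$ that cover $\partial\Omega$ up to a set of zero area. For $t\in[0,T]$ let $\Omega_-(t)$ satisfy $\overline{\Omega_-(t)}\subset\Omega$, and put $\Gamma(t)=\partial\Omega_-(t)$, $\Omega_+(t)=\Omega\setminus\overline{\Omega_-(t)}$. For $t\in(0,T)$ the open set $\Omega_-(t)$ varies continuously in time, and its boundary $\Gamma(t)$ is a closed $C^2$ surface evolving smoothly: locally in space-time $\Omega_-(t)=\{\varphi(t,\cdot)<0\}$ with $\varphi\in C^2$, $\nabla\varphi\ne0$. Let $\mathbf n$ be the unit normal on $\Gamma(t)$ pointing from $\Omega_-$ to $\Omega_+$ and $\mathbf n^+$ the outward unit normal on $\partial\Omega$ (defined almost everywhere). Put $\mathbf P=\mathbf I-\mathbf n\mathbf n^T$, $\mathbf D(\mathbf u)=\frac12(\nabla\mathbf u+\nabla\mathbf u^T)$, $\boldsymbol\sigma^\pm=-p^\pm\mathbf I+2\mu^\pm\mathbf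 D(\mathbf u^\pm)$; on $\Gamma$, via extensions of fields to a neighbourhood, $\nabla_\Gamma\pi=\mathbf P\nabla\pi$, $\nabla_\Gamma\mathbf U=\mathbf P\nabla\mathbf U\,\mathbf P$, $\mathbf D_\Gamma(\mathbf U)=\frac12(\nabla_\Gamma\mathbf U+(\nabla_\Gamma\mathbf U)^T)$, $\operatorname{div}_\Gamma\mathbf U=\operatorname{tr}\nabla_\Gamma\mathbf U$ (row-wise for tensors), and let $\kappa=\operatorname{div}_\Gamma\mathbf n$ be the doubled mean curvature. Write $\mathbf U=\mathbf U_T+U_N\mathbf n$ with $U_N=\mathbf U\cdot\mathbf n$; $\dot\partial_t\mathbf w=\partial_t\mathbf w+(\mathbf w\cdot\nabla)\mathbf w$ is the material derivative of a velocity field $\mathbf w$, and $\|\cdot\|$ is the Euclidean norm of vectors and the Frobenius norm of tensors. Let $\rho^\pm,\mu^\pm,\rho_\Gamma,\mu_\Gamma$ be real constants and $f^\pm$ real friction coefficients on $\Gamma$ (possibly variable). Let $\mathbf u^\pm$ be $C^2$ in $(t,x)$ and $p^\pm$ be $C^1$ in $x$, up to the boundary of $\Omega_\pm(t)$, let $\mathbf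 U$ be $C^2$ in $(t,x)$ and $\pi$ be $C^1$ in $x$ on $\Gamma(t)$, and suppose that for $t\in(0,T)$ $$\begin{aligned} \rho^\pm\dot\partial_t\mathbf u^\pm&=\operatorname{div}\boldsymbol\sigma^\pm+\mathbf f^\pm,\qquad \operatorname{div}\mathbf u^\pm=0&&\text{in }\Omega_\pm(t),\\ \rho_\Gamma\dot\partial_t\mathbf U&=-\nabla_\Gamma\pi+2\mu_\Gamma\operatorname{div}_\Gamma\mathbf D_\Gamma(\mathbf U)+\boldsymbol\sigma^+\mathbf n-\boldsymbol\sigma^-\mathbf n+\mathbf b^e+\pi\kappa\mathbf n,\qquad\operatorname{div}_\Gamma\mathbf U=0&&\text{on }\Gamma(t),\\ \mathbf u^+\cdot\mathbf n&=U_N=\mathbf u^-\cdot\mathbf n,\qquad \mathbf P\boldsymbol\sigma^\pm\mathbf n=\pm f^\pm(\mathbf P\mathbf u^\pm-\mathbf U_T)&&\text{on }\Gamma(t),\\ \mathbf u^+&=\mathbf g\ \text{ on }\partial\Omega_D,\qquad\boldsymbol\sigma^+\mathbf n^+=\mathbf f_N\ \text{ on }\partial\Omega_N, \end{aligned}$$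 and that the interface moves with its normal velocity: there is a map $\Psi(t,\cdot)$, a bijection of $\Gamma(0)$ onto $\Gamma(t)$ for $t\in[0,T]$ and continuous in $t$, with $\Psi(0,x)=x$ and $\partial_t\Psi(t,x)=(U_N\mathbf n)(t,\Psi(t,x))$ for $t\in(0,T)$. Let $$E(t)=\tfrac12\int_{\Omega_-(t)}\rho^-|\mathbf u^-|^2dV+\tfrac12\int_{\Omega_+(t)}\rho^+|\mathbf u^+|^2dV,\qquad E_\Gamma(t)=\tfrac12\int_{\Gamma(t)}\rho_\Gamma|\mathbf U|^2dS,$$ $$B=\int_{\partial\Omega_D}\Big(\mathbf g\cdot\boldsymbol\sigma^+\mathbf n^+-\tfrac12\rho^+|\mathbf g|^2\,\mathbf g\cdot\mathbf n^+\Big)dS+\int_{\partial\Omega_N}\Big(\mathbf u^+\cdot\mathbf f_N-\tfrac12\rho^+|\mathbf u^+|^2\,\mathbf u^+\cdot\mathbf n^+\Big)dS .$$ Then for every $t\in(0,T)$ all integrals in $E$, $E_\Gamma$, $B$ and below exist, $E+E_\Gamma$ is differentiable at $t$, and $$\begin{aligned}\frac{d}{dt}(E+E_\Gamma)=&-2\mu^-\int_{\Omega_-}\|\mathbf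 D(\mathbf u^-)\|^2dV-2\mu^+\int_{\Omega_+}\|\mathbf D(\mathbf u^+)\|^2dV-2\mu_\Gamma\int_\Gamma\|\mathbf D_\Gamma(\mathbf U)\|^2dS\\ &-\int_\Gamma f^-\|\mathbf P\mathbf u^--\mathbf U_T\|^2dS-\int_\Gamma f^+\|\mathbf P\mathbf u^+-\mathbf U_T\|^2dS\\ &+\int_{\Omega_-}\mathbf u^-\cdot\mathbf f^-dV+\int_{\Omega_+}\mathbf u^+\cdot\mathbf f^+dV+\int_\Gamma\mathbf U\cdot\mathbf b^e\,dS+B.\end{aligned}$$ Consequently the system is dissipative: if $\mu^\pm,\mu_\Gamma,f^\pm\ge0$, then $\frac{d}{dt}(E+E_\Gamma)\le0$ at every $t\in(0,T)$ at which there are no external forces ($\mathbf f^\pm=0$, $\mathbf b^e=0$) and no energy inflow through the boundary ($B\le0$); if this is so for all $t\in(0,T)$, then $E+E_\Gamma$ is nonincreasing on $(0,T)$. -/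

import Mathlib

open MeasureTheory Set Filter Topology

noncomputable section

/-! ### Vector and tensor calculus in three-dimensional Euclidean space -/

abbrev E3 := EuclideanSpace ℝ (Fin 3)

/-- Second-order tensors. -/
abbrev Mat3 := Matrix (Fin 3) (Fin 3) ℝ

namespace TensorCalc

/-- The vector `A v`. -/
def app (A : Mat3) (v : E3) : E3 := WithLp.toLp 2 (A.mulVec (WithLp.ofLp v))

/-- `‖A‖² = A : A`, the squared Frobenius norm. -/
def normSq (A : Mat3) : ℝ := ∑ i, ∑ j, A i j ^ 2

/-- The gradient of a scalar field. -/
def gradS (f : E3 → ℝ) (x : E3) : E3 :=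
  WithLp.toLp 2 fun j => fderiv ℝ f x (EuclideanSpace.single j 1)

/-- The gradient of a vector field, `(∇w)ᵢⱼ = ∂ⱼ wᵢ`. -/
def grad (w : E3 → E3) (x : E3) : Mat3 :=
  Matrix.of fun i j => (fderiv ℝ w x (EuclideanSpace.single j 1)) i

/-- The divergence of a vector field. -/
def dvg (w : E3 → E3) (x : E3) : ℝ := (grad w x).trace

/-- The `i`-th row of a tensor field, as a vector field. -/
def row (A : E3 → Mat3) (i : Fin 3) : E3 → E3 := fun x => WithLp.toLp 2 (A x i)

/-- The row-wise divergence of a tensor field. -/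
def dvgT (A : E3 → Mat3) (x : E3) : E3 := WithLp.toLp 2 fun i => dvg (row A i) x

/-- The rate-of-strain tensor `D(w) = ½ (∇w + (∇w)ᵀ)`. -/
def strain (w : E3 → E3) (x : E3) : Mat3 :=
  (1 / 2 : ℝ) • (grad w x + (grad w x).transpose)

/-- The Newtonian Cauchy stress tensor `σ = -p I + 2 μ D(w)`. -/
def stress (mu : ℝ) (p : E3 → ℝ) (w : E3 → E3) (x : E3) : Mat3 :=
  -(p x) • (1 : Mat3) + (2 * mu) • strain w x

/-- The material derivative `∂w/∂t + (w·∇)w` of a time-dependent velocity field. -/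
def matDeriv (w : ℝ → E3 → E3) (t : ℝ) (x : E3) : E3 :=
  deriv (fun s => w s x) t + fderiv ℝ (w t) x (w t x)

/-! Tangential operators on a surface. Surface fields are given with an extension to a neighbourhood
of the surface; `n` is an extension of the unit normal field. On the surface, the operators do not
depend on the chosen extensions. -/

/-- `P = I - n nᵀ`. -/
def proj (n : E3 → E3) (x : E3) : Mat3 := 1 - Matrix.of fun i j => n x i * n x j

/-- `∇_Γ π = P ∇π`. -/
def surfGradS (n : E3 → E3) (f : E3 → ℝ) (x : E3) : E3 := app (proj n x) (gradS f x)

/-- `∇_Γ w = P ∇w P`. -/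
def surfGrad (n : E3 → E3) (w : E3 → E3) (x : E3) : Mat3 := proj n x * grad w x * proj n x

/-- `div_Γ w = tr ∇_Γ w`. -/
def surfDvg (n : E3 → E3) (w : E3 → E3) (x : E3) : ℝ := (surfGrad n w x).trace

/-- The row-wise surface divergence of a tensor field. -/
def surfDvgT (n : E3 → E3) (A : E3 → Mat3) (x : E3) : E3 :=
  WithLp.toLp 2 fun i => surfDvg n (row A i) x

/-- The surface rate-of-strain tensor `D_Γ(w) = ½ (∇_Γ w + (∇_Γ w)ᵀ)`. -/
def surfStrain (n : E3 → E3) (w : E3 → E3) (x : E3) : Mat3 :=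
  (1 / 2 : ℝ) • (surfGrad n w x + (surfGrad n w x).transpose)

/-- The doubled mean curvature `κ = div_Γ n` (equal to `2 / R` on a sphere of radius `R` with its
outer normal). -/
def curvature (n : E3 → E3) (x : E3) : ℝ := surfDvg n n x

end TensorCalc

/-! ### Geometry -/

/-- `ν` is the outward unit normal to `G` at `x`: rays from `x` in directions that make an obtuse
angle with `ν` start inside `G`, those that make an acute angle with `ν` start outside `closure G`.
There is at most one such `ν`. -/
def IsOutwardUnitNormal (G : Set E3) (x ν : E3) : Prop :=
  ‖ν‖ = 1 ∧
  (∀ v : E3, inner ℝ v ν < 0 → ∀ᶠ s in 𝓝[>] (0 : ℝ), x + s • v ∈ G) ∧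
  (∀ v : E3, 0 < inner ℝ v ν → ∀ᶠ s in 𝓝[>] (0 : ℝ), x + s • v ∉ closure G)

/-- Near each boundary point, and in suitable Cartesian coordinates, `G` is the set of points below
the graph of a Lipschitz function. -/
def HasLipschitzBoundary (G : Set E3) : Prop :=
  ∀ x ∈ frontier G, ∃ (L : E3 ≃ₗᵢ[ℝ] E3) (K : NNReal) (γ : EuclideanSpace ℝ (Fin 2) → ℝ),
    LipschitzWith K γ ∧ ∀ᶠ y in 𝓝 x, (y ∈ G ↔ L y 2 < γ !₂[L y 0, L y 1])

/-- The data of the coupled bulk-surface flow. Suffixes `m` and `p` stand for the inner (`-`) and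
the outer (`+`) phase. -/
structure TwoPhaseFlow where
  /-- final time -/
  T : ℝ
  /-- densities -/
  rhom : ℝ
  rhop : ℝ
  rhoS : ℝ
  /-- viscosities -/
  mum : ℝ
  mup : ℝ
  muS : ℝ
  /-- friction coefficients on the two sides of the interface -/
  frm : ℝ → E3 → ℝ
  frp : ℝ → E3 → ℝ
  /-- the fixed container -/
  Ω : Set E3
  /-- the parts of the boundary of the container that carry velocity and stress conditions -/
  bdD : Set E3
  bdN : Set E3
  /-- outward unit normal on the boundary of the container -/
  ν : E3 → E3
  /-- the domain of the inner phase -/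
  Ωm : ℝ → Set E3
  /-- unit normal on the interface, extended to a neighbourhood -/
  n : ℝ → E3 → E3
  /-- Lagrangian mapping of the interface -/
  Ψ : ℝ → E3 → E3
  /-- bulk velocities -/
  um : ℝ → E3 → E3
  up : ℝ → E3 → E3
  /-- bulk pressures -/
  pm : ℝ → E3 → ℝ
  pp : ℝ → E3 → ℝ
  /-- surface velocity and surface pressure, extended to a neighbourhood of the interface -/
  U : ℝ → E3 → E3
  π : ℝ → E3 → ℝ
  /-- body forces -/
  fm : ℝ → E3 → E3
  fp : ℝ → E3 → E3
  /-- area force -/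
  be : ℝ → E3 → E3
  /-- boundary velocity and boundary stress -/
  g : ℝ → E3 → E3
  fN : ℝ → E3 → E3

namespace TwoPhaseFlow

open TensorCalc

variable (S : TwoPhaseFlow)

/-- The interface, i.e. the boundary of the inner phase. -/
def Γ (t : ℝ) : Set E3 := frontier (S.Ωm t)

/-- The domain of the outer phase. -/
def Ωp (t : ℝ) : Set E3 := S.Ω \ closure (S.Ωm t)

/-- Stress tensors of the two phases. -/
def σm (t : ℝ) (x : E3) : Mat3 := stress S.mum (S.pm t) (S.um t) x

def σp (t : ℝ) (x : E3) : Mat3 := stress S.mup (S.pp t) (S.up t) x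

/-- Normal component of the surface velocity. -/
def UN (t : ℝ) (x : E3) : ℝ := inner ℝ (S.U t x) (S.n t x)

/-- Tangential component of the surface velocity. -/
def UT (t : ℝ) (x : E3) : E3 := S.U t x - S.UN t x • S.n t x

/-- Slip velocities `P u^± - U_T`. -/
def slipm (t : ℝ) (x : E3) : E3 := app (proj (S.n t) x) (S.um t x) - S.UT t x

def slipp (t : ℝ) (x : E3) : E3 := app (proj (S.n t) x) (S.up t x) - S.UT t x

/-- The container is a bounded Lipschitz domain whose boundary is split into `bdD` and `bdN`. -/
structure IsContainer : Prop where
  isOpen : IsOpen S.Ω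
  bounded : Bornology.IsBounded S.Ω
  lipschitz : HasLipschitzBoundary S.Ω
  normal : ∀ᵐ x ∂(μHE[2].restrict (frontier S.Ω)), IsOutwardUnitNormal S.Ω x (S.ν x)
  measD : MeasurableSet S.bdD
  measN : MeasurableSet S.bdN
  subset : S.bdD ∪ S.bdN ⊆ frontier S.Ω
  disjoint : Disjoint S.bdD S.bdN
  closure_union : closure S.bdD ∪ closure S.bdN = frontier S.Ω
  /-- `bdD` and `bdN` leave out only a set of zero area. -/
  null : μHE[2] (frontier S.Ω \ (S.bdD ∪ S.bdN)) = 0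

/-- The inner phase is an internal, smoothly evolving domain; its boundary, the interface, is a
closed `C²` surface transported by the Lagrangian mapping with velocity `U_N n`. -/
structure IsInterface : Prop where
  internal : ∀ t ∈ Icc 0 S.T, closure (S.Ωm t) ⊆ S.Ω
  /-- The domain varies continuously in time. -/
  cont_mem : ∀ t ∈ Ioo 0 S.T, ∀ x ∈ S.Ωm t, ∀ᶠ q : ℝ × E3 in 𝓝 (t, x), q.2 ∈ S.Ωm q.1
  cont_notMem : ∀ t ∈ Ioo 0 S.T, ∀ x ∉ closure (S.Ωm t),
    ∀ᶠ q : ℝ × E3 in 𝓝 (t, x), q.2 ∉ closure (S.Ωm q.1)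
  /-- Near each point of the moving interface, the inner phase is the negativity set of a `C²`
  function of time and space with nonzero spatial gradient. -/
  levelSet : ∀ t ∈ Ioo 0 S.T, ∀ x ∈ S.Γ t, ∃ φ : ℝ × E3 → ℝ, ContDiffAt ℝ 2 φ (t, x) ∧
    fderiv ℝ (fun y => φ (t, y)) x ≠ 0 ∧ ∀ᶠ q in 𝓝 (t, x), (q.2 ∈ S.Ωm q.1 ↔ φ q < 0)
  /-- `n` is the unit normal on the interface that points from the inner to the outer phase. -/
  normal : ∀ t ∈ Ioo 0 S.T, ∀ x ∈ S.Γ t, IsOutwardUnitNormal (S.Ωm t) x (S.n t x)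
  normal_C1 : ∀ t ∈ Ioo 0 S.T, ∀ x ∈ S.Γ t, ContDiffAt ℝ 1 (Function.uncurry S.n) (t, x)
  lagrange_init : ∀ x ∈ S.Γ 0, S.Ψ 0 x = x
  lagrange_bij : ∀ t ∈ Icc 0 S.T, BijOn (S.Ψ t) (S.Γ 0) (S.Γ t)
  lagrange_cont : ∀ x ∈ S.Γ 0, ContinuousOn (fun s => S.Ψ s x) (Icc 0 S.T)
  lagrange_ode : ∀ x ∈ S.Γ 0, ∀ t ∈ Ioo 0 S.T,
    HasDerivAt (fun s => S.Ψ s x) (S.UN t (S.Ψ t x) • S.n t (S.Ψ t x)) t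

/-- The velocities and pressures are smooth up to the boundary of the phase domains, respectively
on the interface. -/
structure IsRegular : Prop where
  um_C2 : ∀ t ∈ Ioo 0 S.T, ∀ x ∈ closure (S.Ωm t), ContDiffAt ℝ 2 (Function.uncurry S.um) (t, x)
  up_C2 : ∀ t ∈ Ioo 0 S.T, ∀ x ∈ closure (S.Ωp t), ContDiffAt ℝ 2 (Function.uncurry S.up) (t, x)
  pm_C1 : ∀ t ∈ Ioo 0 S.T, ∀ x ∈ closure (S.Ωm t), ContDiffAt ℝ 1 (S.pm t) x
  pp_C1 : ∀ t ∈ Ioo 0 S.T, ∀ x ∈ closure (S.Ωp t), ContDiffAt ℝ 1 (S.pp t) x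
  U_C2 : ∀ t ∈ Ioo 0 S.T, ∀ x ∈ S.Γ t, ContDiffAt ℝ 2 (Function.uncurry S.U) (t, x)
  π_C1 : ∀ t ∈ Ioo 0 S.T, ∀ x ∈ S.Γ t, ContDiffAt ℝ 1 (S.π t) x

/-- The coupled system of equations, interface conditions and boundary conditions. -/
structure SolvesSystem : Prop where
  momentum_m : ∀ t ∈ Ioo 0 S.T, ∀ x ∈ S.Ωm t,
    S.rhom • matDeriv S.um t x = dvgT (S.σm t) x + S.fm t x
  momentum_p : ∀ t ∈ Ioo 0 S.T, ∀ x ∈ S.Ωp t,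
    S.rhop • matDeriv S.up t x = dvgT (S.σp t) x + S.fp t x
  incompressible_m : ∀ t ∈ Ioo 0 S.T, ∀ x ∈ S.Ωm t, dvg (S.um t) x = 0
  incompressible_p : ∀ t ∈ Ioo 0 S.T, ∀ x ∈ S.Ωp t, dvg (S.up t) x = 0
  /-- The area force exerted by the bulk is the jump `σ⁺ n - σ⁻ n`. -/
  momentum_S : ∀ t ∈ Ioo 0 S.T, ∀ x ∈ S.Γ t,
    S.rhoS • matDeriv S.U t x =
      -surfGradS (S.n t) (S.π t) x + (2 * S.muS) • surfDvgT (S.n t) (surfStrain (S.n t) (S.U t)) x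
      + (app (S.σp t x) (S.n t x) - app (S.σm t x) (S.n t x)) + S.be t x
      + (S.π t x * curvature (S.n t) x) • S.n t x
  inextensible : ∀ t ∈ Ioo 0 S.T, ∀ x ∈ S.Γ t, surfDvg (S.n t) (S.U t) x = 0
  noPenetration_m : ∀ t ∈ Ioo 0 S.T, ∀ x ∈ S.Γ t, inner ℝ (S.um t x) (S.n t x) = S.UN t x
  noPenetration_p : ∀ t ∈ Ioo 0 S.T, ∀ x ∈ S.Γ t, inner ℝ (S.up t x) (S.n t x) = S.UN t x
  friction_m : ∀ t ∈ Ioo 0 S.T, ∀ x ∈ S.Γ t,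
    app (proj (S.n t) x) (app (S.σm t x) (S.n t x)) = -(S.frm t x) • S.slipm t x
  friction_p : ∀ t ∈ Ioo 0 S.T, ∀ x ∈ S.Γ t,
    app (proj (S.n t) x) (app (S.σp t x) (S.n t x)) = S.frp t x • S.slipp t x
  bc_D : ∀ t ∈ Ioo 0 S.T, ∀ x ∈ S.bdD, S.up t x = S.g t x
  bc_N : ∀ t ∈ Ioo 0 S.T, ∀ x ∈ S.bdN, IsOutwardUnitNormal S.Ω x (S.ν x) →
    app (S.σp t x) (S.ν x) = S.fN t x

/-- Smooth solutions of the coupled time-dependent problem. -/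
structure IsSmoothSolution : Prop where
  container : S.IsContainer
  interface : S.IsInterface
  regular : S.IsRegular
  solves : S.SolvesSystem

/-! ### Energies, dissipation and work -/

/-- Kinetic energy of the bulk, `E⁻ + E⁺`. -/
def bulkEnergy (t : ℝ) : ℝ :=
  (1 / 2) * (∫ x in S.Ωm t, S.rhom * ‖S.um t x‖ ^ 2)
    + (1 / 2) * (∫ x in S.Ωp t, S.rhop * ‖S.up t x‖ ^ 2)

/-- Kinetic energy of the surface. -/
def surfaceEnergy (t : ℝ) : ℝ :=
  (1 / 2) * (∫ x in S.Γ t, S.rhoS * ‖S.U t x‖ ^ 2 ∂μHE[2])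

/-- Total kinetic energy. -/
def totalEnergy (t : ℝ) : ℝ := S.bulkEnergy t + S.surfaceEnergy t

/-- Bulk viscous dissipation. -/
def bulkDissipation (t : ℝ) : ℝ :=
  2 * S.mum * (∫ x in S.Ωm t, normSq (strain (S.um t) x))
    + 2 * S.mup * (∫ x in S.Ωp t, normSq (strain (S.up t) x))

/-- Surface viscous dissipation. -/
def surfaceDissipation (t : ℝ) : ℝ :=
  2 * S.muS * (∫ x in S.Γ t, normSq (surfStrain (S.n t) (S.U t) x) ∂μHE[2])

/-- Frictional dissipation. -/
def frictionDissipation (t : ℝ) : ℝ :=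
  (∫ x in S.Γ t, S.frm t x * ‖S.slipm t x‖ ^ 2 ∂μHE[2])
    + (∫ x in S.Γ t, S.frp t x * ‖S.slipp t x‖ ^ 2 ∂μHE[2])

/-- Work of the external forces. -/
def forceWork (t : ℝ) : ℝ :=
  (∫ x in S.Ωm t, inner ℝ (S.um t x) (S.fm t x))
    + (∫ x in S.Ωp t, inner ℝ (S.up t x) (S.fp t x))
    + (∫ x in S.Γ t, inner ℝ (S.U t x) (S.be t x) ∂μHE[2])

/-- Density of the work of the boundary conditions on `bdD`. -/
def workD (t : ℝ) (x : E3) : ℝ :=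
  inner ℝ (S.g t x) (app (S.σp t x) (S.ν x))
    - (1 / 2) * S.rhop * ‖S.g t x‖ ^ 2 * inner ℝ (S.g t x) (S.ν x)

/-- Density of the work of the boundary conditions on `bdN`. -/
def workN (t : ℝ) (x : E3) : ℝ :=
  inner ℝ (S.up t x) (S.fN t x)
    - (1 / 2) * S.rhop * ‖S.up t x‖ ^ 2 * inner ℝ (S.up t x) (S.ν x)

/-- Work `B` of the boundary conditions. -/
def boundaryWork (t : ℝ) : ℝ :=
  (∫ x in S.bdD, S.workD t x ∂μHE[2]) + (∫ x in S.bdN, S.workN t x ∂μHE[2])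

/-- All integrals in the energies and in the energy balance exist. -/
structure IntegralsExist (t : ℝ) : Prop where
  energy_m : IntegrableOn (fun x => S.rhom * ‖S.um t x‖ ^ 2) (S.Ωm t)
  energy_p : IntegrableOn (fun x => S.rhop * ‖S.up t x‖ ^ 2) (S.Ωp t)
  energy_S : IntegrableOn (fun x => S.rhoS * ‖S.U t x‖ ^ 2) (S.Γ t) μHE[2]
  strain_m : IntegrableOn (fun x => normSq (strain (S.um t) x)) (S.Ωm t)
  strain_p : IntegrableOn (fun x => normSq (strain (S.up t) x)) (S.Ωp t)
  strain_S : IntegrableOn (fun x => normSq (surfStrain (S.n t) (S.U t) x)) (S.Γ t) μHE[2]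
  friction_m : IntegrableOn (fun x => S.frm t x * ‖S.slipm t x‖ ^ 2) (S.Γ t) μHE[2]
  friction_p : IntegrableOn (fun x => S.frp t x * ‖S.slipp t x‖ ^ 2) (S.Γ t) μHE[2]
  force_m : IntegrableOn (fun x => inner ℝ (S.um t x) (S.fm t x)) (S.Ωm t)
  force_p : IntegrableOn (fun x => inner ℝ (S.up t x) (S.fp t x)) (S.Ωp t)
  force_S : IntegrableOn (fun x => inner ℝ (S.U t x) (S.be t x)) (S.Γ t) μHE[2]
  work_D : IntegrableOn (S.workD t) S.bdD μHE[2]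
  work_N : IntegrableOn (S.workN t) S.bdN μHE[2]

/-- There are no external forces at time `t`. -/
def Unforced (t : ℝ) : Prop :=
  (∀ x ∈ S.Ωm t, S.fm t x = 0) ∧ (∀ x ∈ S.Ωp t, S.fp t x = 0) ∧ (∀ x ∈ S.Γ t, S.be t x = 0)

end TwoPhaseFlow

end

/-! The kinetic energy is differentiated phase by phase. In each bulk phase Reynolds' theorem, the
momentum equation and the divergence theorem leave viscous dissipation, force work and the power of
the stress at the boundary. The convective flux through the interface cancels, because the interface
moves with the normal velocity of the fluid. On the interface, the surface transport formula and the
surface divergence theorem leave surface dissipation, force work and the power of the stress jump;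
the surface pressure does no work, since `U` is surface-solenoidal and the normal force `πκn`
supplies the curvature term of that theorem. In the sum the interface terms combine to `(u - U)·σn`
on each side. By the no-penetration condition `u - U` is the tangential slip velocity, so the
friction law turns these terms into minus the frictional dissipation (`friction_balance`).

The analytic tools are built from a single transport theorem. The area formula for Lipschitz graphs
(`area_graphMap_image`) describes the surface measure `μHE[2]`. It yields
`IsMovingDomain.transport`: the integral of a fixed continuous function over a domain bounded by
moving Lipschitz graphs changes at the rate given by the boundary integral of the function times the
normal velocity. Applied to translations of a fixed domain, this gives Green's formula, and
differentiating Green's formula along a second translation gives `integral_tangential_deriv`, from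
which the surface divergence theorem follows by an algebraic identity for the fields `nᵢ wⱼ`.

For moving surfaces, `∫ g` is written as the flux of `g n`. The divergence theorem makes the flux of
a frozen field a volume integral, to which the transport theorem applies (`hasDerivAt_flux`). This
requires one derivative of the normal and no parametrisation of the surface.

Since the fields are smooth only near the closed phase domains or near the interface, they are
replaced at a fixed time by compactly supported global fields that agree with them in a space-time
neighbourhood of those sets. Integrability of the force and friction terms is not assumed: the
equations express these terms through continuous functions. -/

open scoped ContDiff

namespace BulkSurface

/-! ### Graph coordinates -/

abbrev E2 := EuclideanSpace ℝ (Fin 2)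

/-- The point of space with horizontal coordinates `y` and height `z`. -/
noncomputable def lift (y : E2) (z : ℝ) : E3 := !₂[y 0, y 1, z]

/-- The horizontal coordinates of a point. -/
noncomputable def base (x : E3) : E2 := !₂[x 0, x 1]

@[simp] lemma lift_apply_zero (y : E2) (z : ℝ) : lift y z 0 = y 0 := rfl
@[simp] lemma lift_apply_one (y : E2) (z : ℝ) : lift y z 1 = y 1 := rfl
@[simp] lemma lift_apply_two (y : E2) (z : ℝ) : lift y z 2 = z := rfl
@[simp] lemma base_apply_zero (x : E3) : base x 0 = x 0 := rfl
@[simp] lemma base_apply_one (x : E3) : base x 1 = x 1 := rfl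

@[simp] lemma base_lift (y : E2) (z : ℝ) : base (lift y z) = y := by
  ext i; fin_cases i <;> rfl

@[simp] lemma lift_base (x : E3) : lift (base x) (x 2) = x := by
  ext i; fin_cases i <;> rfl

/-- Graph coordinates as a linear isomorphism. -/
noncomputable def coordEquiv : (E2 × ℝ) ≃L[ℝ] E3 :=
  LinearEquiv.toContinuousLinearEquiv
    { toFun := fun p => lift p.1 p.2
      invFun := fun x => (base x, x 2)
      map_add' := fun p q => by ext i; fin_cases i <;> simp [lift]
      map_smul' := fun c p => by ext i; fin_cases i <;> simp [lift]
      left_inv := fun p => by simp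
      right_inv := fun x => by simp }

lemma coordEquiv_apply (p : E2 × ℝ) : coordEquiv p = lift p.1 p.2 := rfl

/-- `base` as a continuous linear map. -/
noncomputable def baseL : E3 →L[ℝ] E2 :=
  (ContinuousLinearMap.fst ℝ E2 ℝ).comp (coordEquiv.symm : E3 →L[ℝ] E2 × ℝ)

@[fun_prop] lemma continuous_base : Continuous base := baseL.continuous

lemma continuous_lift : Continuous fun p : E2 × ℝ => lift p.1 p.2 := coordEquiv.continuous

lemma lift_sub (y y' : E2) (z z' : ℝ) : lift (y - y') (z - z') = lift y z - lift y' z' :=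
  coordEquiv.map_sub (y, z) (y', z')

lemma base_add (x x' : E3) : base (x + x') = base x + base x' := baseL.map_add x x'
lemma base_sub (x x' : E3) : base (x - x') = base x - base x' := baseL.map_sub x x'
lemma base_smul (c : ℝ) (x : E3) : base (c • x) = c • base x := baseL.map_smul c x

lemma norm_lift_sq (y : E2) (z : ℝ) : ‖lift y z‖ ^ 2 = ‖y‖ ^ 2 + z ^ 2 := by
  simp [EuclideanSpace.norm_sq_eq, Fin.sum_univ_three, Fin.sum_univ_two]

lemma norm_le_norm_lift (y : E2) (z : ℝ) : ‖y‖ ≤ ‖lift y z‖ := by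
  have := norm_lift_sq y z
  exact abs_le_of_sq_le_sq' (by nlinarith [sq_nonneg z]) (norm_nonneg _) |>.2

lemma norm_base_le (x : E3) : ‖base x‖ ≤ ‖x‖ := by
  simpa using norm_le_norm_lift (base x) (x 2)

lemma norm_lift_zero (z : ℝ) : ‖lift 0 z‖ = |z| := by
  have := norm_lift_sq 0 z
  rw [norm_zero, zero_pow two_ne_zero, zero_add, sq_eq_sq_iff_abs_eq_abs] at this
  simpa using this

lemma measurePreserving_coordEquiv : MeasurePreserving coordEquiv volume volume := by
  -- `piFinSuccAbove` at the last index lists the height first, hence the swap.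
  have h1 : MeasurePreserving (fun p : E2 × ℝ => (p.2, WithLp.ofLp p.1)) volume volume :=
    Measure.measurePreserving_swap.comp
      ((PiLp.volume_preserving_ofLp (Fin 2)).prod (MeasurePreserving.id (volume : Measure ℝ)))
  have h2 := (volume_preserving_piFinSuccAbove (fun _ : Fin 3 => ℝ) (Fin.last 2)).symm
  have h3 := (PiLp.volume_preserving_toLp (Fin 3)).comp (h2.comp h1)
  have : (coordEquiv : E2 × ℝ → E3) = WithLp.toLp 2 ∘
      (MeasurableEquiv.piFinSuccAbove (fun _ : Fin 3 => ℝ) (Fin.last 2)).symm ∘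
        fun p => (p.2, WithLp.ofLp p.1) := by
    funext p
    rw [coordEquiv_apply]
    ext i
    fin_cases i
    exacts [rfl, rfl, rfl]
  rw [this]
  exact h3

/-- The graph of `γ` in the rotated coordinate system `L`, parametrised over the plane. -/
noncomputable def graphMap (L : E3 ≃ₗᵢ[ℝ] E3) (γ : E2 → ℝ) (y : E2) : E3 := L.symm (lift y (γ y))

/-- The upward normal vector `(-∇γ, 1)` of a graph with differential `A`. -/
noncomputable def slopeVec (A : E2 →L[ℝ] ℝ) : E3 :=
  !₂[-A (EuclideanSpace.single 0 1), -A (EuclideanSpace.single 1 1), 1]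

lemma clm_apply_eq (A : E2 →L[ℝ] ℝ) (y : E2) :
    A y = y 0 * A (EuclideanSpace.single 0 1) + y 1 * A (EuclideanSpace.single 1 1) := by
  have : y = y 0 • EuclideanSpace.single 0 (1 : ℝ) + y 1 • EuclideanSpace.single 1 (1 : ℝ) := by
    ext i; fin_cases i <;> simp
  conv_lhs => rw [this]
  simp

lemma inner_slopeVec (A : E2 →L[ℝ] ℝ) (x : E3) : inner ℝ x (slopeVec A) = x 2 - A (base x) := by
  rw [clm_apply_eq A]
  simp [slopeVec, PiLp.inner_apply, Fin.sum_univ_three]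
  ring

lemma one_le_norm_slopeVec (A : E2 →L[ℝ] ℝ) : 1 ≤ ‖slopeVec A‖ := by
  have : ‖slopeVec A‖ ^ 2 = _ := EuclideanSpace.norm_sq_eq _
  simp only [slopeVec, Fin.sum_univ_three] at this
  simp at this
  rw [← slopeVec] at this
  nlinarith [norm_nonneg (slopeVec A), sq_nonneg (A (EuclideanSpace.single 0 1)),
    sq_nonneg (A (EuclideanSpace.single 1 1))]

lemma norm_slopeVec_pos (A : E2 →L[ℝ] ℝ) : 0 < ‖slopeVec A‖ :=
  zero_lt_one.trans_le (one_le_norm_slopeVec A)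

lemma norm_slopeVec_sub_le (A B : E2 →L[ℝ] ℝ) : ‖slopeVec A - slopeVec B‖ ≤ 2 * ‖A - B‖ := by
  have h0 := (A - B).le_opNorm (EuclideanSpace.single 0 1)
  have h1 := (A - B).le_opNorm (EuclideanSpace.single 1 1)
  simp only [sub_apply, PiLp.norm_single, norm_one, mul_one,
    Real.norm_eq_abs] at h0 h1
  have h : ‖slopeVec A - slopeVec B‖ ^ 2 = _ := EuclideanSpace.norm_sq_eq _
  simp [slopeVec, Fin.sum_univ_three] at h
  rw [← slopeVec, ← slopeVec] at h
  refine abs_le_of_sq_le_sq' ?_ (by positivity) |>.2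
  rw [h]
  have a0 := sq_le_sq' (abs_le.1 h0).1 (abs_le.1 h0).2
  have a1 := sq_le_sq' (abs_le.1 h1).1 (abs_le.1 h1).2
  nlinarith [sq_nonneg ‖A - B‖]

lemma continuous_slopeVec : Continuous slopeVec := by
  unfold slopeVec
  refine (PiLp.continuous_toLp 2 _).comp (continuous_pi fun i => ?_)
  fin_cases i <;> simp <;> fun_prop

lemma norm_slopeVec_le_mul {A B : E2 →L[ℝ] ℝ} {ε : ℝ} (h : ‖A - B‖ ≤ ε) :
    ‖slopeVec A‖ ≤ (1 + 2 * ε) * ‖slopeVec B‖ := by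
  have h1 := norm_slopeVec_sub_le A B
  have h2 := norm_sub_norm_le (slopeVec A) (slopeVec B)
  have h3 := one_le_norm_slopeVec B
  have : 0 ≤ ε := (norm_nonneg _).trans h
  nlinarith

/-! ### The area formula for Lipschitz graphs -/

/-- The linear parametrisation of the graph of `A`. -/
noncomputable def linGraph (A : E2 →L[ℝ] ℝ) : E2 →ₗ[ℝ] E3 :=
  (coordEquiv : (E2 × ℝ) →ₗ[ℝ] E3) ∘ₗ (LinearMap.prod LinearMap.id (A : E2 →ₗ[ℝ] ℝ))

lemma linGraph_apply (A : E2 →L[ℝ] ℝ) (y : E2) : linGraph A y = lift y (A y) := rfl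

/-- With slopes `a` and `b`, the Gram determinant is `(1 + a²)(1 + b²) - (ab)² = 1 + a² + b²`. -/
lemma normDet_linGraph (A : E2 →L[ℝ] ℝ) : (linGraph A).normDet = ‖slopeVec A‖ := by
  have h := LinearMap.normDet_sq_eq_det_gram (linGraph A) (EuclideanSpace.basisFun (Fin 2) ℝ)
  have h2 : ‖slopeVec A‖ ^ 2 = _ := EuclideanSpace.norm_sq_eq _
  have : (linGraph A).normDet ^ 2 = ‖slopeVec A‖ ^ 2 := by
    rw [h2]
    rw [RCLike.ofReal_real_eq_id, id] at h
    rw [h, Matrix.det_fin_two]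
    simp [Matrix.gram, linGraph_apply, slopeVec, lift, PiLp.inner_apply, Fin.sum_univ_three]
    ring
  exact (sq_eq_sq₀ (LinearMap.normDet_nonneg _) (norm_nonneg _)).1 this

lemma area_linGraph_image (A : E2 →L[ℝ] ℝ) (s : Set E2) :
    μHE[2] (linGraph A '' s) = ENNReal.ofReal ‖slopeVec A‖ * volume s := by
  have h := (linGraph A).euclideanHausdorffMeasure_image_eq_normDet_mul_volume s
  rw [finrank_euclideanSpace_fin, normDet_linGraph] at h
  exact h

lemma euclideanHausdorffMeasure_image_le {X Y : Type*} [EMetricSpace X] [EMetricSpace Y]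
    [MeasurableSpace X] [BorelSpace X] [MeasurableSpace Y] [BorelSpace Y] {K : NNReal} {f : X → Y}
    {s : Set X} (hf : LipschitzOnWith K f s) (d : ℕ) :
    μHE[d] (f '' s) ≤ (K : ENNReal) ^ d * μHE[d] s := by
  simp only [Measure.euclideanHausdorffMeasure_def, Measure.smul_apply, ENNReal.smul_def,
    smul_eq_mul]
  have h := hf.hausdorffMeasure_image_le (d := d) (by positivity)
  rw [mul_left_comm]
  gcongr
  simpa using h

/-- Maps that differ from each other by a small Lipschitz perturbation have images of comparable
area. -/
lemma area_image_le_of_dist_le {f g : E2 → E3} {s : Set E2} {K : NNReal}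
    (h : ∀ y ∈ s, ∀ y' ∈ s, dist (f y) (f y') ≤ K * dist (g y) (g y')) :
    μHE[2] (f '' s) ≤ (K : ENNReal) ^ 2 * μHE[2] (g '' s) := by
  rcases s.eq_empty_or_nonempty with rfl | ⟨y0, -⟩
  · simp
  classical
  have key : ∀ x ∈ g '' s, f (Function.invFunOn g s x) ∈ f '' s := fun x hx =>
    mem_image_of_mem f (Function.invFunOn_mem hx)
  -- `F` is `f ∘ g⁻¹`. It does not depend on the chosen preimages, because the hypothesis forces `f
  -- y = f y'` whenever `g y = g y'`; the same hypothesis makes it `K`-Lipschitz on the image of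
  -- `g`.
  set F : E3 → E3 := fun x => f (Function.invFunOn g s x)
  have hF : ∀ y ∈ s, F (g y) = f y := fun y hy => by
    have h1 : Function.invFunOn g s (g y) ∈ s := Function.invFunOn_mem ⟨y, hy, rfl⟩
    have h2 : g (Function.invFunOn g s (g y)) = g y := Function.invFunOn_eq ⟨y, hy, rfl⟩
    have := h _ h1 y hy
    rw [h2, dist_self, mul_zero] at this
    exact dist_le_zero.1 this
  have him : f '' s = F '' (g '' s) := by
    rw [image_image]; exact image_congr fun y hy => (hF y hy).symm
  rw [him]
  refine euclideanHausdorffMeasure_image_le (LipschitzOnWith.of_dist_le_mul ?_) 2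
  rintro _ ⟨y, hy, rfl⟩ _ ⟨y', hy', rfl⟩
  rw [hF y hy, hF y' hy']
  exact h y hy y' hy'

section AreaFormula

variable {γ : E2 → ℝ} {K : NNReal} (L : E3 ≃ₗᵢ[ℝ] E3)

/-- Chords are at least as long as their horizontal projections, so an additive error `ε * dist y
y'` can be absorbed into a factor `1 + ε`. -/
lemma dist_le_dist_graphMap (γ : E2 → ℝ) (y y' : E2) :
    dist y y' ≤ dist (graphMap L γ y) (graphMap L γ y') := by
  simp only [graphMap, LinearIsometryEquiv.dist_map]
  rw [dist_eq_norm, dist_eq_norm, ← lift_sub]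
  exact norm_le_norm_lift _ _

lemma dist_le_dist_linGraph (A : E2 →L[ℝ] ℝ) (y y' : E2) :
    dist y y' ≤ dist (linGraph A y) (linGraph A y') := by
  rw [dist_eq_norm, dist_eq_norm, linGraph_apply, linGraph_apply, ← lift_sub]
  exact norm_le_norm_lift _ _

/-- Corresponding chords of the two graphs differ by a vertical vector, namely the linearisation
error of `γ`. -/
lemma abs_dist_graphMap_sub_le {A : E2 →L[ℝ] ℝ} {s : Set E2} {ε : NNReal}
    (h : ApproximatesLinearOn γ A s ε) {y y' : E2} (hy : y ∈ s) (hy' : y' ∈ s) :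
    |dist (graphMap L γ y) (graphMap L γ y') - dist (linGraph A y) (linGraph A y')|
      ≤ ε * dist y y' := by
  simp only [graphMap, LinearIsometryEquiv.dist_map, linGraph_apply]
  rw [dist_eq_norm, dist_eq_norm, dist_eq_norm]
  refine (abs_norm_sub_norm_le _ _).trans ?_
  have : lift y (γ y) - lift y' (γ y') - (lift y (A y) - lift y' (A y'))
      = lift 0 (γ y - γ y' - A (y - y')) := by
    rw [← lift_sub, ← lift_sub, ← lift_sub, map_sub, sub_self]
  rw [this, norm_lift_zero]
  simpa using h y hy y' hy'

lemma area_graph_le {A : E2 →L[ℝ] ℝ} {s : Set E2} {ε : NNReal}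
    (h : ApproximatesLinearOn γ A s ε) :
    μHE[2] (graphMap L γ '' s) ≤ (1 + ε : NNReal) ^ 2 * (ENNReal.ofReal ‖slopeVec A‖ * volume s) := by
  rw [← area_linGraph_image]
  refine area_image_le_of_dist_le fun y hy y' hy' => ?_
  have h1 := abs_le.1 (abs_dist_graphMap_sub_le L h hy hy')
  have h2 := mul_le_mul_of_nonneg_left (dist_le_dist_linGraph A y y') ε.coe_nonneg
  rw [NNReal.coe_add, NNReal.coe_one, add_mul, one_mul]
  linarith [h1.2, h2]

lemma le_area_graph {A : E2 →L[ℝ] ℝ} {s : Set E2} {ε : NNReal}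
    (h : ApproximatesLinearOn γ A s ε) :
    ENNReal.ofReal ‖slopeVec A‖ * volume s ≤ (1 + ε : NNReal) ^ 2 * μHE[2] (graphMap L γ '' s) := by
  rw [← area_linGraph_image]
  refine area_image_le_of_dist_le fun y hy y' hy' => ?_
  have h1 := abs_le.1 (abs_dist_graphMap_sub_le L h hy hy')
  have h2 := mul_le_mul_of_nonneg_left (dist_le_dist_graphMap L γ y y') ε.coe_nonneg
  rw [NNReal.coe_add, NNReal.coe_one, add_mul, one_mul]
  linarith [h1.1, h2]

lemma ae_norm_fderiv_sub_le_of_approximatesLinearOn {A : E2 →L[ℝ] ℝ} {s : Set E2} {ε : NNReal}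
    (h : ApproximatesLinearOn γ A s ε) (hs : MeasurableSet s)
    (hd : ∀ y ∈ s, DifferentiableAt ℝ γ y) :
    ∀ᵐ y ∂(volume.restrict s), ‖fderiv ℝ γ y - A‖ ≤ ε := by
  set e : E2 := EuclideanSpace.single 0 1
  have he : ‖e‖ = 1 := by simp [e]
  -- `ApproximatesLinearOn.norm_fderiv_sub_le` concerns maps of a space to itself, so the scalar
  -- function is multiplied by a fixed unit vector, which preserves the norms.
  have h' : ApproximatesLinearOn (fun y => γ y • e) (A.smulRight e) s ε := fun y hy y' hy' => by
    have := h y hy y' hy'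
    simp only [ContinuousLinearMap.smulRight_apply, ← sub_smul, norm_smul, he, mul_one]
    exact this
  have := h'.norm_fderiv_sub_le volume hs (fun y => (fderiv ℝ γ y).smulRight e)
    (fun y hy => ((hd y hy).hasFDerivAt.smul_const e).hasFDerivWithinAt)
  filter_upwards [this] with y hy
  have h3 : (fderiv ℝ γ y).smulRight e - A.smulRight e = (fderiv ℝ γ y - A).smulRight e := by
    ext1 v; simp [sub_smul]
  rw [h3, ← NNReal.coe_le_coe, coe_nnnorm, ContinuousLinearMap.norm_smulRight_apply, he,
    mul_one] at hy
  exact hy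

lemma measurable_slope (γ : E2 → ℝ) : Measurable fun y => slopeVec (fderiv ℝ γ y) :=
  continuous_slopeVec.measurable.comp (measurable_fderiv ℝ γ)

lemma continuous_graphMap (hγ : Continuous γ) : Continuous (graphMap L γ) :=
  L.symm.continuous.comp (continuous_lift.comp (continuous_id.prodMk hγ))

lemma injective_graphMap (γ : E2 → ℝ) : Function.Injective (graphMap L γ) := fun y y' h => by
  have := congrArg (fun x => base (L x)) h
  simpa [graphMap] using this

lemma measurableEmbedding_graphMap (hγ : Continuous γ) : MeasurableEmbedding (graphMap L γ) :=
  (continuous_graphMap L hγ).measurableEmbedding (injective_graphMap L γ)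

lemma area_graph_null (hγ : LipschitzWith K γ) {s : Set E2} (hs : volume s = 0) :
    μHE[2] (graphMap L γ '' s) = 0 := by
  -- The zero map approximates a `K`-Lipschitz function with error `K`; this crude bound suffices
  -- for null sets.
  have h : ApproximatesLinearOn γ (0 : E2 →L[ℝ] ℝ) s K := fun y _ y' _ => by
    simpa [dist_eq_norm] using hγ.dist_le_mul y y'
  have := area_graph_le L h
  simpa [hs] using this

lemma ennreal_slope_le {A B : E2 →L[ℝ] ℝ} {ε : NNReal} (h : ‖A - B‖ ≤ ε) :
    ENNReal.ofReal ‖slopeVec A‖ ≤ (1 + 2 * ε : NNReal) * ENNReal.ofReal ‖slopeVec B‖ := by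
  refine (ENNReal.ofReal_le_ofReal (norm_slopeVec_le_mul h)).trans ?_
  rw [ENNReal.ofReal_mul (by positivity)]
  gcongr
  rw [← ENNReal.ofReal_coe_nnreal]
  simp

/-- Up to a factor that is close to one, the area formula holds. -/
lemma area_graph_comparable (hγ : LipschitzWith K γ) {s : Set E2} (hs : MeasurableSet s)
    {ε : NNReal} (hε : 0 < ε) :
    μHE[2] (graphMap L γ '' s) ≤ ((1 + ε) ^ 2 * (1 + 2 * ε) : NNReal) *
        ∫⁻ y in s, ENNReal.ofReal ‖slopeVec (fderiv ℝ γ y)‖ ∧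
    ∫⁻ y in s, ENNReal.ofReal ‖slopeVec (fderiv ℝ γ y)‖ ≤
      ((1 + ε) ^ 2 * (1 + 2 * ε) : NNReal) * μHE[2] (graphMap L γ '' s) := by
  set D : Set E2 := {y | DifferentiableAt ℝ γ y}
  have hD : MeasurableSet D := measurableSet_of_differentiableAt ℝ γ
  have hDc : volume Dᶜ = 0 := hγ.ae_differentiableAt
  -- After Rademacher's theorem the set splits, up to a null set, into countably many pieces on
  -- which `γ` is `ε`-close to a linear map `A n`. The factor `(1 + ε)²` compares the areas of the
  -- two graphs, the factor `1 + 2ε` the slopes of `fderiv ℝ γ y` and `A n`.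
  obtain ⟨t, A, hdisj, htm, hcov, happ, -⟩ :=
    exists_partition_approximatesLinearOn_of_hasFDerivWithinAt γ (s ∩ D) (fderiv ℝ γ)
      (fun x hx => hx.2.hasFDerivAt.hasFDerivWithinAt) (fun _ => ε) (fun _ => hε.ne')
  set u : ℕ → Set E2 := fun n => (s ∩ D) ∩ t n
  have hum : ∀ n, MeasurableSet (u n) := fun n => (hs.inter hD).inter (htm n)
  have hud : Pairwise (Function.onFun Disjoint u) := fun i j hij =>
    (hdisj hij).mono inter_subset_right inter_subset_right
  have huU : ⋃ n, u n = s ∩ D := by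
    rw [← inter_iUnion]; exact inter_eq_left.2 hcov
  have hsD : (s ∩ D : Set E2) =ᵐ[volume] s := by
    have : D =ᵐ[volume] univ := by
      rw [ae_eq_univ]; exact hDc
    simpa using (ae_eq_refl s).inter this
  have hint : ∫⁻ y in s, ENNReal.ofReal ‖slopeVec (fderiv ℝ γ y)‖
      = ∑' n, ∫⁻ y in u n, ENNReal.ofReal ‖slopeVec (fderiv ℝ γ y)‖ := by
    rw [← setLIntegral_congr hsD, ← huU, lintegral_iUnion hum hud]
  have himg : μHE[2] (graphMap L γ '' s) = ∑' n, μHE[2] (graphMap L γ '' u n) := by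
    have h1 : μHE[2] (graphMap L γ '' s) = μHE[2] (graphMap L γ '' (s ∩ D)) := by
      refine le_antisymm ?_ (measure_mono (image_mono inter_subset_left))
      rw [← inter_union_sdiff s D, image_union]
      refine (measure_union_le _ _).trans ?_
      rw [area_graph_null L hγ (measure_mono_null (fun y hy => hy.2) hDc : volume (s \ D) = 0),
        add_zero]
      exact measure_mono (image_mono fun y hy => ⟨Or.inl hy, hy.2⟩)
    rw [h1, ← huU, image_iUnion]
    refine measure_iUnion (fun i j hij => ?_) fun n =>
      (measurableEmbedding_graphMap L hγ.continuous).measurableSet_image.2 (hum n)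
    exact (disjoint_image_iff (injective_graphMap L γ)).2 (hud hij)
  have hae : ∀ n, ∀ᵐ y ∂(volume.restrict (u n)), ‖fderiv ℝ γ y - A n‖ ≤ ε := fun n =>
    ae_norm_fderiv_sub_le_of_approximatesLinearOn (happ n) (hum n) fun y hy => hy.1.2
  rw [hint, himg, ← ENNReal.tsum_mul_left, ← ENNReal.tsum_mul_left]
  constructor
  · refine ENNReal.tsum_le_tsum fun n => (area_graph_le L (happ n)).trans ?_
    push_cast
    rw [mul_assoc]
    refine mul_le_mul_right ?_ _
    rw [← setLIntegral_const, ← lintegral_const_mul' _ _ (by finiteness)]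
    refine lintegral_mono_ae ?_
    filter_upwards [hae n] with y hy
    rw [norm_sub_rev] at hy
    exact_mod_cast ennreal_slope_le hy
  · refine ENNReal.tsum_le_tsum fun n => ?_
    calc ∫⁻ y in u n, ENNReal.ofReal ‖slopeVec (fderiv ℝ γ y)‖
        ≤ ∫⁻ _ in u n, (1 + 2 * ε : NNReal) * ENNReal.ofReal ‖slopeVec (A n)‖ := by
          refine lintegral_mono_ae ?_
          filter_upwards [hae n] with y hy using ennreal_slope_le hy
      _ = (1 + 2 * ε : NNReal) * (ENNReal.ofReal ‖slopeVec (A n)‖ * volume (u n)) := by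
          rw [setLIntegral_const, mul_assoc]
      _ ≤ (1 + 2 * ε : NNReal) * ((1 + ε : NNReal) ^ 2 * μHE[2] (graphMap L γ '' u n)) := by
          exact mul_le_mul_right (le_area_graph L (happ n)) _
      _ = _ := by push_cast; ring

/-- The **area formula** for graphs of Lipschitz functions. -/
theorem area_graphMap_image (hγ : LipschitzWith K γ) {s : Set E2} (hs : MeasurableSet s) :
    μHE[2] (graphMap L γ '' s) = ∫⁻ y in s, ENNReal.ofReal ‖slopeVec (fderiv ℝ γ y)‖ := by
  have htend : Tendsto (fun ε : NNReal => (((1 + ε) ^ 2 * (1 + 2 * ε) : NNReal) : ENNReal))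
      (𝓝[>] 0) (𝓝 1) := by
    rw [← ENNReal.coe_one, ENNReal.tendsto_coe]
    have : Continuous fun ε : NNReal => (1 + ε) ^ 2 * (1 + 2 * ε) := by fun_prop
    simpa using (this.tendsto 0).mono_left nhdsWithin_le_nhds
  have hmul : ∀ c : ENNReal, Tendsto
      (fun ε : NNReal => (((1 + ε) ^ 2 * (1 + 2 * ε) : NNReal) : ENNReal) * c) (𝓝[>] 0) (𝓝 c) :=
    fun c => by simpa using ENNReal.Tendsto.mul_const htend (Or.inl one_ne_zero)
  refine le_antisymm ?_ ?_
  · exact ge_of_tendsto (hmul _) (eventually_nhdsWithin_of_forall fun ε hε =>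
      (area_graph_comparable L hγ hs hε).1)
  · exact ge_of_tendsto (hmul _) (eventually_nhdsWithin_of_forall fun ε hε =>
      (area_graph_comparable L hγ hs hε).2)

/-- Surface measure on a Lipschitz graph. -/
theorem restrict_range_graphMap (hγ : LipschitzWith K γ) :
    (μHE[2] : Measure E3).restrict (range (graphMap L γ)) =
      Measure.map (graphMap L γ)
        (volume.withDensity fun y => ENNReal.ofReal ‖slopeVec (fderiv ℝ γ y)‖) := by
  have hemb := measurableEmbedding_graphMap L hγ.continuous
  ext s hs
  rw [Measure.restrict_apply hs, hemb.map_apply, withDensity_apply _ (hemb.measurable hs),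
    ← area_graphMap_image L hγ (hemb.measurable hs), image_preimage_eq_inter_range]

theorem setIntegral_range_graphMap (hγ : LipschitzWith K γ) (f : E3 → ℝ) :
    ∫ x in range (graphMap L γ), f x ∂μHE[2] =
      ∫ y, ‖slopeVec (fderiv ℝ γ y)‖ * f (graphMap L γ y) := by
  rw [restrict_range_graphMap L hγ, (measurableEmbedding_graphMap L hγ.continuous).integral_map,
    integral_withDensity_eq_integral_toReal_smul
      (measurable_slope γ).norm.ennreal_ofReal (by simp)]
  simp

theorem integrableOn_range_graphMap (hγ : LipschitzWith K γ) {f : E3 → ℝ} :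
    IntegrableOn f (range (graphMap L γ)) μHE[2] ↔
      Integrable fun y => ‖slopeVec (fderiv ℝ γ y)‖ * f (graphMap L γ y) := by
  rw [IntegrableOn, restrict_range_graphMap L hγ,
    (measurableEmbedding_graphMap L hγ.continuous).integrable_map_iff,
    integrable_withDensity_iff_integrable_smul₀'
      (measurable_slope γ).norm.ennreal_ofReal.aemeasurable (by simp)]
  simp

/-- Sets of zero area meet a graph over a set of zero measure. -/
theorem ae_graphMap_of_ae (γ : E2 → ℝ) {p : E3 → Prop}
    (hp : ∀ᵐ x ∂(μHE[2] : Measure E3), p x) : ∀ᵐ y : E2, p (graphMap L γ y) := by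
  have h : volume {y | ¬ p (graphMap L γ y)} ≤ 0 := by
    have h0 : μHE[2] {x : E3 | ¬ p x} = 0 := hp
    set F : E3 → E2 := fun x => base (L x)
    -- Projection along the height axis does not increase area, and it sends the graph point over
    -- `y` back to `y`.
    have hF : LipschitzWith 1 F := LipschitzWith.of_dist_le_mul fun x x' => by
      rw [dist_eq_norm, dist_eq_norm, ← base_sub, ← map_sub, NNReal.coe_one, one_mul]
      exact (norm_base_le _).trans_eq (L.norm_map _)
    have hsub : {y | ¬ p (graphMap L γ y)} ⊆ F '' {x : E3 | ¬ p x} := fun y hy =>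
      ⟨graphMap L γ y, hy, by simp [F, graphMap]⟩
    have := euclideanHausdorffMeasure_image_le (hF.lipschitzOnWith (s := {x : E3 | ¬ p x})) 2
    rw [EuclideanSpace.euclideanHausdorffMeasure_eq_volume, h0, mul_zero] at this
    exact (measure_mono hsub).trans this
  exact le_antisymm h bot_le

end AreaFormula

end BulkSurface

namespace BulkSurface

/-! ### Transport theorem for moving subgraphs -/

section Subgraph

variable {h : E3 → ℝ} (L : E3 ≃ₗᵢ[ℝ] E3)

/-- A scalar field in graph coordinates. -/
noncomputable def inCoord (h : E3 → ℝ) (y : E2) (z : ℝ) : ℝ := h (L.symm (lift y z))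

/-- The points below the graph of `γ`. -/
def subgraph (γ : E2 → ℝ) : Set E3 := {x | L x 2 < γ (base (L x))}

lemma measurableSet_subgraph {γ : E2 → ℝ} (hγ : Continuous γ) : MeasurableSet (subgraph L γ) := by
  have h1 : Continuous fun x : E3 => L x 2 := by fun_prop
  have h2 : Continuous fun x : E3 => γ (base (L x)) :=
    hγ.comp (continuous_base.comp L.continuous)
  exact (isOpen_lt h1 h2).measurableSet

lemma continuous_inCoord (hc : Continuous h) : Continuous fun p : E2 × ℝ => inCoord L h p.1 p.2 :=
  hc.comp (L.symm.continuous.comp continuous_lift)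

lemma continuous_inCoord_right (hc : Continuous h) (y : E2) : Continuous (inCoord L h y) :=
  (continuous_inCoord L hc).comp (by fun_prop : Continuous fun z : ℝ => (y, z))

lemma measurePreserving_coord : MeasurePreserving (fun p : E2 × ℝ => L.symm (coordEquiv p)) :=
  L.symm.measurePreserving.comp measurePreserving_coordEquiv

lemma measurableEmbedding_coord : MeasurableEmbedding (fun p : E2 × ℝ => L.symm (coordEquiv p)) :=
  (coordEquiv.toHomeomorph.trans L.symm.toHomeomorph).measurableEmbedding

lemma integrable_inCoord (hc : Continuous h) (hs : HasCompactSupport h) :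
    Integrable fun p : E2 × ℝ => inCoord L h p.1 p.2 :=
  ((measurePreserving_coord L).integrable_comp_emb (measurableEmbedding_coord L)).2
    (hc.integrable_of_hasCompactSupport hs)

lemma hasCompactSupport_inCoord_right (hs : HasCompactSupport h) (y : E2) :
    HasCompactSupport (inCoord L h y) := by
  refine hs.comp_isClosedEmbedding (g := fun z : ℝ => L.symm (lift y z)) ?_
  refine L.symm.toHomeomorph.isClosedEmbedding.comp (Isometry.isClosedEmbedding ?_)
  refine Isometry.of_dist_eq fun z z' => ?_
  rw [dist_eq_norm, ← lift_sub, sub_self, norm_lift_zero, Real.dist_eq]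

lemma integrable_inCoord_right (hc : Continuous h) (hs : HasCompactSupport h) (y : E2) :
    Integrable (inCoord L h y) :=
  (continuous_inCoord_right L hc y).integrable_of_hasCompactSupport
    (hasCompactSupport_inCoord_right L hs y)

lemma setIntegral_subgraph (hc : Continuous h) (hs : HasCompactSupport h) {γ : E2 → ℝ}
    (hγ : Continuous γ) :
    Integrable (fun y => ∫ z in Iio (γ y), inCoord L h y z) ∧
    ∫ x in subgraph L γ, h x = ∫ y, ∫ z in Iio (γ y), inCoord L h y z := by
  have hm : MeasurableSet {p : E2 × ℝ | p.2 < γ p.1} :=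
    (isOpen_lt continuous_snd (hγ.comp continuous_fst)).measurableSet
  have h1 := (measurePreserving_coord L).setIntegral_preimage_emb (measurableEmbedding_coord L) h
    (subgraph L γ)
  have h2 : (fun p : E2 × ℝ => L.symm (coordEquiv p)) ⁻¹' subgraph L γ
      = {p : E2 × ℝ | p.2 < γ p.1} := by
    ext p; simp [subgraph, coordEquiv_apply]
  have hint := (integrable_inCoord L hc hs).indicator hm
  have h3 : ∀ y : E2, ∫ z, {p : E2 × ℝ | p.2 < γ p.1}.indicator
      (fun p : E2 × ℝ => inCoord L h p.1 p.2) (y, z) = ∫ z in Iio (γ y), inCoord L h y z :=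
    fun y => by
      rw [← integral_indicator measurableSet_Iio]
      rfl
  constructor
  · have := hint.integral_prod_left
    simpa only [h3] using this
  · rw [← h1, h2, ← integral_indicator hm]
    exact (integral_prod _ hint).trans (integral_congr_ae (Eventually.of_forall h3))

lemma setIntegral_subgraph_sub (hc : Continuous h) (hs : HasCompactSupport h) {γ γ' : E2 → ℝ}
    (hγ : Continuous γ) (hγ' : Continuous γ') :
    ∫ x in subgraph L γ', h x = (∫ x in subgraph L γ, h x) +
      ∫ y, ∫ z in γ y..γ' y, inCoord L h y z := by
  obtain ⟨i1, e1⟩ := setIntegral_subgraph L hc hs hγ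
  obtain ⟨i2, e2⟩ := setIntegral_subgraph L hc hs hγ'
  rw [← sub_eq_iff_eq_add', e1, e2, ← integral_sub i2 i1]
  refine integral_congr_ae (Eventually.of_forall fun y => ?_)
  have hi := integrable_inCoord_right L hc hs y
  simp only [← integral_Iic_eq_integral_Iio]
  exact intervalIntegral.integral_Iic_sub_Iic hi.integrableOn hi.integrableOn

/-- The derivative of the integral of a fixed function over a moving subgraph. -/
theorem hasDerivAt_setIntegral_subgraph (hc : Continuous h) (hs : HasCompactSupport h)
    {γ : ℝ → E2 → ℝ} {K : NNReal} (hγ : LipschitzWith K fun q : ℝ × E2 => γ q.1 q.2) {t : ℝ}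
    {γ' : E2 → ℝ}
    (hd : ∀ᵐ y, h (graphMap L (γ t) y) ≠ 0 → HasDerivAt (fun s => γ s y) (γ' y) t) :
    Integrable (fun y => h (graphMap L (γ t) y) * γ' y) ∧
    HasDerivAt (fun s => ∫ x in subgraph L (γ s), h x)
      (∫ y, h (graphMap L (γ t) y) * γ' y) t := by
  have hγc : ∀ s, Continuous (γ s) := fun s =>
    hγ.continuous.comp (by fun_prop : Continuous fun y : E2 => (s, y))
  have hγs : ∀ y s s', |γ s y - γ s' y| ≤ K * |s - s'| := fun y s s' => by
    simpa [Prod.dist_eq, Real.dist_eq] using hγ.dist_le_mul (s, y) (s', y)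
  set F : ℝ → E2 → ℝ := fun s y => ∫ z in γ t y..γ s y, inCoord L h y z with hF
  have hii : ∀ y a b, IntervalIntegrable (inCoord L h y) volume a b := fun y a b =>
    (continuous_inCoord_right L hc y).intervalIntegrable a b
  have hFc : ∀ s, Continuous (F s) := fun s => by
    have : F s = fun y => (∫ z in (0:ℝ)..γ s y, inCoord L h y z)
        - ∫ z in (0:ℝ)..γ t y, inCoord L h y z := by
      funext y
      rw [intervalIntegral.integral_interval_sub_left (hii _ _ _) (hii _ _ _)]
    rw [this]
    exact (intervalIntegral.continuous_parametric_intervalIntegral_of_continuous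
      (continuous_inCoord L hc) (hγc s)).sub
      (intervalIntegral.continuous_parametric_intervalIntegral_of_continuous
      (continuous_inCoord L hc) (hγc t))
  obtain ⟨C, hC⟩ := hs.exists_bound_of_continuous hc
  have hC0 : 0 ≤ C := (norm_nonneg _).trans (hC 0)
  obtain ⟨R, hR⟩ := hs.isCompact.isBounded.subset_closedBall (0 : E3)
  have hzero : ∀ y ∉ Metric.closedBall (0 : E2) R, ∀ z, inCoord L h y z = 0 := fun y hy z => by
    refine image_eq_zero_of_notMem_tsupport (f := h) fun hmem => hy ?_
    have := hR hmem
    rw [mem_closedBall_zero_iff, LinearIsometryEquiv.norm_map] at this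
    exact mem_closedBall_zero_iff.2 ((norm_le_norm_lift y z).trans this)
  -- The strip between the graphs at two times has height at most `K * |s - s'|`, `|h|` is at most
  -- `C`, and no point over the complement of the ball lies in the support of `h`.
  set bd : E2 → ℝ := (Metric.closedBall (0 : E2) R).indicator fun _ => C * K
  have hbd : Integrable bd := by
    refine IntegrableOn.integrable_indicator ?_ measurableSet_closedBall
    exact integrableOn_const (by exact measure_closedBall_lt_top.ne)
  have hlip : ∀ y, LipschitzOnWith (Real.nnabs (bd y)) (F · y) univ := fun y => by
    refine LipschitzOnWith.of_dist_le_mul fun s _ s' _ => ?_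
    rw [dist_eq_norm, hF]
    simp only
    rw [intervalIntegral.integral_interval_sub_left (hii _ _ _) (hii _ _ _)]
    by_cases hy : y ∈ Metric.closedBall (0 : E2) R
    · refine (intervalIntegral.norm_integral_le_of_norm_le_const fun z _ => hC _).trans ?_
      simp only [bd, indicator_of_mem hy, Real.coe_nnabs, Real.dist_eq]
      change C * |γ s y - γ s' y| ≤ _
      rw [abs_of_nonneg (mul_nonneg hC0 K.coe_nonneg), mul_assoc]
      exact mul_le_mul_of_nonneg_left (hγs y s s') hC0
    · simp [hzero y hy, bd, indicator_of_notMem hy]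
  have hdiff : ∀ᵐ y, HasDerivAt (F · y) (h (graphMap L (γ t) y) * γ' y) t := by
    filter_upwards [hd] with y hy
    have hI : HasDerivAt (fun u => ∫ z in γ t y..u, inCoord L h y z)
        (h (graphMap L (γ t) y)) (γ t y) :=
      ((continuous_inCoord_right L hc y).integral_hasStrictDerivAt _ _).hasDerivAt
    -- Where `h` vanishes on the graph, `γ` need not be differentiable in time. The strip integral
    -- is then of smaller order than its height, and the height is `O(s - t)` by the Lipschitz
    -- bound, so the derivative is zero.
    by_cases h0 : h (graphMap L (γ t) y) = 0
    · rw [h0, zero_mul]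
      rw [h0, hasDerivAt_iff_isLittleO] at hI
      rw [hasDerivAt_iff_isLittleO]
      have hcont : Tendsto (fun s => γ s y) (𝓝 t) (𝓝 (γ t y)) :=
        (hγ.continuous.comp (by fun_prop : Continuous fun s : ℝ => (s, y))).tendsto t
      have h1 := hI.comp_tendsto hcont
      have h2 : ((fun u => u - γ t y) ∘ fun s => γ s y) =O[𝓝 t] fun s => s - t :=
        Asymptotics.IsBigO.of_bound K (Eventually.of_forall fun s => hγs y s t)
      simpa [Function.comp_def, hF] using h1.trans_isBigO h2
    · exact hI.comp t (hy h0)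
  -- `γ'` is an arbitrary function; the product is measurable as an almost everywhere limit of
  -- difference quotients.
  have hmeas : AEStronglyMeasurable (fun y => h (graphMap L (γ t) y) * γ' y) volume := by
    have hseq : Tendsto (fun n : ℕ => t + 1 / ((n : ℝ) + 1)) atTop (𝓝[≠] t) := by
      refine tendsto_nhdsWithin_iff.2 ⟨?_, Eventually.of_forall fun n => ?_⟩
      · simpa using (tendsto_const_nhds (x := t)).add (tendsto_one_div_add_atTop_nhds_zero_nat (𝕜 := ℝ))
      · have : (0:ℝ) < 1 / ((n : ℝ) + 1) := by positivity
        simp only [mem_compl_iff, mem_singleton_iff]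
        linarith
    refine aestronglyMeasurable_of_tendsto_ae (u := atTop)
      (f := fun (n : ℕ) y => slope (F · y) t (t + 1 / ((n : ℝ) + 1))) (fun n => ?_) ?_
    · simp only [slope_def_field]
      exact (((hFc _).sub (hFc _)).div_const _).aestronglyMeasurable
    · filter_upwards [hdiff] with y hy
      exact hy.tendsto_slope.comp hseq
  obtain ⟨hi, hD⟩ := hasDerivAt_integral_of_dominated_loc_of_lip (μ := (volume : Measure E2))
    (F := F) (x₀ := t) univ_mem (Eventually.of_forall fun s => (hFc s).aestronglyMeasurable)
    (by simp [hF]) hmeas (Eventually.of_forall hlip) hbd hdiff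
  refine ⟨hi, ?_⟩
  have : (fun s => ∫ x in subgraph L (γ s), h x)
      = fun s => (∫ x in subgraph L (γ t), h x) + ∫ y, F s y := by
    funext s
    exact setIntegral_subgraph_sub L hc hs (hγc t) (hγc s)
  rw [this]
  exact hD.const_add _

lemma frontier_subgraph {γ : E2 → ℝ} (hγ : Continuous γ) :
    frontier (subgraph L γ) = range (graphMap L γ) := by
  have h1 : Continuous fun x : E3 => L x 2 := by fun_prop
  have h2 : Continuous fun x : E3 => γ (base (L x)) :=
    hγ.comp (continuous_base.comp L.continuous)
  refine Subset.antisymm (fun x hx => ?_) ?_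
  · have : L x 2 = γ (base (L x)) := frontier_lt_subset_eq h1 h2 hx
    exact ⟨base (L x), by simp [graphMap, ← this]⟩
  · rintro _ ⟨y, rfl⟩
    have ho : IsOpen (subgraph L γ) := isOpen_lt h1 h2
    rw [ho.frontier_eq]
    refine ⟨?_, by simp [subgraph, graphMap]⟩
    have hc : Tendsto (fun s : ℝ => L.symm (lift y (γ y - s))) (𝓝[>] 0)
        (𝓝 (graphMap L γ y)) := by
      have : Continuous fun s : ℝ => L.symm (lift y (γ y - s)) :=
        L.symm.continuous.comp (continuous_lift.comp
          (by fun_prop : Continuous fun s : ℝ => (y, γ y - s)))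
      simpa [graphMap] using (this.tendsto 0).mono_left nhdsWithin_le_nhds
    refine mem_closure_of_tendsto hc (eventually_nhdsWithin_of_forall fun s hs => ?_)
    simpa [subgraph] using hs

lemma frontier_inter_of_forall_mem_iff {G G' U : Set E3} (hU : IsOpen U)
    (h : ∀ x ∈ U, (x ∈ G ↔ x ∈ G')) : frontier G ∩ U = frontier G' ∩ U := by
  rw [← frontier_inter_open_inter hU, ← frontier_inter_open_inter (s := G') hU]
  congr 2
  ext x
  exact and_congr_left (h x)

end Subgraph

/-! ### Moving domains -/

/-- Near `(t, x)`, the moving domain `G` lies below the moving graph of a Lipschitz function, and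
the graph moves at time `t` with normal velocity `V`. -/
def HasMovingChart (G : ℝ → Set E3) (V : E3 → ℝ) (t : ℝ) (x : E3) : Prop :=
  ∃ (L : E3 ≃ₗᵢ[ℝ] E3) (K : NNReal) (γ : ℝ → E2 → ℝ),
    LipschitzWith K (fun q : ℝ × E2 => γ q.1 q.2) ∧
    (∀ᶠ q : ℝ × E3 in 𝓝 (t, x), (q.2 ∈ G q.1 ↔ q.2 ∈ subgraph L (γ q.1))) ∧
    ∃ U ∈ 𝓝 x, ∀ᵐ y, graphMap L (γ t) y ∈ U → HasDerivAt (fun s => γ s y)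
      (‖slopeVec (fderiv ℝ (γ t) y)‖ * V (graphMap L (γ t) y)) t

/-- The boundary of the moving domain `G` is at time `t` locally a Lipschitz graph that moves with
normal velocity `V`. -/
structure IsMovingDomain (G : ℝ → Set E3) (V : E3 → ℝ) (t : ℝ) : Prop where
  measurable : ∀ᶠ s in 𝓝 t, MeasurableSet (G s)
  locally_const : ∀ x ∉ frontier (G t), ∀ᶠ q : ℝ × E3 in 𝓝 (t, x), (q.2 ∈ G q.1 ↔ x ∈ G t)
  chart : ∀ x ∈ frontier (G t), HasMovingChart G V t x

/-- A partition of unity on the support of `h` reduces an additive property to functions supported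
near one point. -/
lemma continuous_induction_of_local {P : (E3 → ℝ) → Prop} (h0 : P 0)
    (hadd : ∀ f g, Continuous f → HasCompactSupport f → Continuous g → HasCompactSupport g →
      P f → P g → P (f + g))
    (hloc : ∀ x, ∃ U ∈ 𝓝 x, ∀ f, Continuous f → HasCompactSupport f → tsupport f ⊆ U → P f)
    {h : E3 → ℝ} (hc : Continuous h) (hs : HasCompactSupport h) : P h := by
  choose U hU hP using hloc
  obtain ⟨τ, -, hτ⟩ := hs.isCompact.elim_nhds_subcover (fun x => interior (U x))
    fun x _ => interior_mem_nhds.2 (hU x)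
  let e := τ.equivFin
  have hcov : tsupport h ⊆ ⋃ i, interior (U (e.symm i)) := fun x hx => by
    obtain ⟨y, hy, hxy⟩ := mem_iUnion₂.1 (hτ hx)
    exact mem_iUnion.2 ⟨e ⟨y, hy⟩, by simpa using hxy⟩
  obtain ⟨f, hf1, hf2, -, hf4⟩ := exists_continuous_sum_one_of_isOpen_isCompact
    (fun i => isOpen_interior) hs.isCompact hcov
  have hsum : h = ∑ i, fun x => f i x * h x := by
    funext x
    rw [Finset.sum_apply, ← Finset.sum_mul]
    by_cases hx : x ∈ tsupport h
    · have := hf2 hx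
      rw [Finset.sum_apply] at this
      rw [this]; simp
    · simp [image_eq_zero_of_notMem_tsupport hx]
  have hci : ∀ i, Continuous fun x => f i x * h x := fun i => (f i).continuous.mul hc
  have hsi : ∀ i, HasCompactSupport fun x => f i x * h x := fun i => (hf4 i).mul_right
  -- Continuity and compact support of the partial sums are carried along, because `hadd` requires
  -- them.
  have key : ∀ s : Finset (Fin τ.card), Continuous (∑ i ∈ s, fun x => f i x * h x) ∧
      HasCompactSupport (∑ i ∈ s, fun x => f i x * h x) ∧ P (∑ i ∈ s, fun x => f i x * h x) := by
    intro s
    induction s using Finset.induction_on with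
    | empty => exact ⟨by simpa using continuous_zero, by simpa using HasCompactSupport.zero, by simpa using h0⟩
    | insert i s hi ih =>
      rw [Finset.sum_insert hi]
      refine ⟨(hci i).add ih.1, (hsi i).add ih.2.1, hadd _ _ (hci i) (hsi i) ih.1 ih.2.1 ?_ ih.2.2⟩
      refine hP (e.symm i) _ (hci i) (hsi i) ?_
      exact (tsupport_mul_subset_left).trans ((hf1 i).trans interior_subset)
  rw [hsum]
  exact (key _).2.2

lemma setIntegral_congr_of_tsupport_subset {G G' U : Set E3} {h : E3 → ℝ} (hG : MeasurableSet G)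
    (hG' : MeasurableSet G') (hU : tsupport h ⊆ U) (hGG : ∀ x ∈ U, (x ∈ G ↔ x ∈ G')) :
    ∫ x in G, h x = ∫ x in G', h x := by
  rw [← integral_indicator hG, ← integral_indicator hG']
  congr 1
  funext x
  by_cases hx : x ∈ tsupport h
  · by_cases hxG : x ∈ G
    · rw [indicator_of_mem hxG, indicator_of_mem ((hGG x (hU hx)).1 hxG)]
    · rw [indicator_of_notMem hxG, indicator_of_notMem fun h' => hxG ((hGG x (hU hx)).2 h')]
  · simp [indicator, image_eq_zero_of_notMem_tsupport hx]

namespace IsMovingDomain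

variable {G : ℝ → Set E3} {V : E3 → ℝ} {t : ℝ}

/-- The **transport theorem** for a fixed continuous function on a moving domain. -/
theorem transport (hG : IsMovingDomain G V t) {h : E3 → ℝ} (hc : Continuous h)
    (hs : HasCompactSupport h) :
    IntegrableOn (fun x => h x * V x) (frontier (G t)) μHE[2] ∧
    HasDerivAt (fun s => ∫ x in G s, h x) (∫ x in frontier (G t), h x * V x ∂μHE[2]) t := by
  refine continuous_induction_of_local (P := fun h =>
    IntegrableOn (fun x => h x * V x) (frontier (G t)) μHE[2] ∧
    HasDerivAt (fun s => ∫ x in G s, h x) (∫ x in frontier (G t), h x * V x ∂μHE[2]) t)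
    ?_ ?_ ?_ hc hs
  · simp [hasDerivAt_const]
  · rintro f g hf hfs hg hgs ⟨hf1, hf2⟩ ⟨hg1, hg2⟩
    have h1 : ∀ s, ∫ x in G s, (f + g) x = (∫ x in G s, f x) + ∫ x in G s, g x := fun s =>
      integral_add (hf.integrable_of_hasCompactSupport hfs).integrableOn
        (hg.integrable_of_hasCompactSupport hgs).integrableOn
    have h2 : (fun x => (f + g) x * V x) = fun x => f x * V x + g x * V x := by
      funext x; simp [add_mul]
    rw [h2]
    refine ⟨hf1.add hg1, ?_⟩
    simp only [h1]
    rw [integral_add hf1 hg1]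
    exact hf2.add hg2
  · intro x
    by_cases hx : x ∈ frontier (G t)
    · obtain ⟨L, K, γ, hγ, hev, W, hW, hder⟩ := hG.chart x hx
      have hγc : ∀ s, Continuous (γ s) := fun s =>
        hγ.continuous.comp (by fun_prop : Continuous fun y : E2 => (s, y))
      rw [nhds_prod_eq] at hev
      obtain ⟨p, hp, q, hq, hpq⟩ := eventually_prod_iff.1 hev
      obtain ⟨U, hUsub, hUo, hxU⟩ := mem_nhds_iff.1 (inter_mem hq hW)
      refine ⟨U, hUo.mem_nhds hxU, fun f hf hfs hfU => ?_⟩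
      have hiff : ∀ s, p s → ∀ x ∈ U, (x ∈ G s ↔ x ∈ subgraph L (γ s)) := fun s hps x hxU =>
        hpq hps (hUsub hxU).1
      have hfr : frontier (G t) ∩ U = range (graphMap L (γ t)) ∩ U := by
        rw [← frontier_subgraph L (hγc t)]
        exact frontier_inter_of_forall_mem_iff hUo (hiff t hp.self_of_nhds)
      have hf0 : ∀ z ∉ U, f z = 0 := fun z hz =>
        image_eq_zero_of_notMem_tsupport fun h' => hz (hfU h')
      -- The time derivative of `γ` is known only for graph points in `W`. This suffices, since `f`
      -- vanishes outside `U ⊆ W`.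
      obtain ⟨hi, hd⟩ := hasDerivAt_setIntegral_subgraph L hf hfs hγ (t := t)
        (γ' := fun y => ‖slopeVec (fderiv ℝ (γ t) y)‖ * V (graphMap L (γ t) y)) (by
          filter_upwards [hder] with y hy hne
          refine hy (hUsub ?_).2
          by_contra h'
          exact hne (hf0 _ h'))
      have hgraph : LipschitzWith K (γ t) := LipschitzWith.of_dist_le_mul fun y y' => by
        simpa [Prod.dist_eq] using hγ.dist_le_mul (t, y) (t, y')
      -- The factor that converts normal velocity into vertical speed is also the area density of
      -- the graph, so the integral over the plane becomes a surface integral.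
      have hcomm : ∀ y, f (graphMap L (γ t) y) *
          (‖slopeVec (fderiv ℝ (γ t) y)‖ * V (graphMap L (γ t) y)) =
          ‖slopeVec (fderiv ℝ (γ t) y)‖ *
            (f (graphMap L (γ t) y) * V (graphMap L (γ t) y)) := fun y => by ring
      simp only [hcomm] at hi hd
      have hrm : MeasurableSet (range (graphMap L (γ t))) :=
        (measurableEmbedding_graphMap L (hγc t)).measurableSet_range
      have hfm : MeasurableSet (frontier (G t)) := isClosed_frontier.measurableSet
      have hsub : frontier (G t) ∩ U ⊆ frontier (G t) := inter_subset_left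
      have hsub' : frontier (G t) ∩ U ⊆ range (graphMap L (γ t)) := hfr ▸ inter_subset_left
      have hz1 : ∀ z ∈ frontier (G t) \ (frontier (G t) ∩ U), f z * V z = 0 := fun z hz => by
        rw [hf0 z fun h' => hz.2 ⟨hz.1, h'⟩, zero_mul]
      have hz2 : ∀ z ∈ range (graphMap L (γ t)) \ (frontier (G t) ∩ U), f z * V z = 0 :=
        fun z hz => by
          rw [hf0 z fun h' => hz.2 (hfr ▸ ⟨hz.1, h'⟩), zero_mul]
      constructor
      · have := (integrableOn_range_graphMap L hgraph (f := fun x => f x * V x)).2 hi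
        exact (this.mono_set hsub').of_forall_sdiff_eq_zero hfm hz1
      · rw [setIntegral_eq_of_subset_of_forall_sdiff_eq_zero hfm hsub hz1,
          ← setIntegral_eq_of_subset_of_forall_sdiff_eq_zero hrm hsub' hz2,
          setIntegral_range_graphMap L hgraph]
        refine hd.congr_of_eventuallyEq ?_
        filter_upwards [hp, hG.measurable] with s hs hms
        exact setIntegral_congr_of_tsupport_subset hms (measurableSet_subgraph L (hγc s)) hfU
          (hiff s hs)
    -- Away from the boundary the domain does not change near `x` for times near `t`, so both sides
    -- vanish.
    · have hev := hG.locally_const x hx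
      rw [nhds_prod_eq] at hev
      obtain ⟨p, hp, q, hq, hpq⟩ := eventually_prod_iff.1 hev
      obtain ⟨U, hUsub, hUo, hxU⟩ := mem_nhds_iff.1
        (inter_mem hq (isClosed_frontier.isOpen_compl.mem_nhds hx))
      refine ⟨U, hUo.mem_nhds hxU, fun f hf hfs hfU => ?_⟩
      have hz : ∀ z ∈ frontier (G t), f z * V z = 0 := fun z hz => by
        rw [image_eq_zero_of_notMem_tsupport fun h' => (hUsub (hfU h')).2 hz, zero_mul]
      have hfm : MeasurableSet (frontier (G t)) := isClosed_frontier.measurableSet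
      constructor
      · exact (integrableOn_congr_fun hz hfm).2 (integrableOn_zero)
      · rw [setIntegral_eq_zero_of_forall_eq_zero hz]
        refine (hasDerivAt_const t (∫ x in G t, f x)).congr_of_eventuallyEq ?_
        filter_upwards [hp, hG.measurable] with s hs hms
        refine setIntegral_congr_of_tsupport_subset hms hG.measurable.self_of_nhds hfU
          fun z hz => ?_
        have h1 := hpq hs (hUsub hz).1
        have h2 := hpq hp.self_of_nhds (hUsub hz).1
        simp only at h1 h2
        rw [h1, h2]

end IsMovingDomain

end BulkSurface

namespace BulkSurface

/-! ### Cutoff and extension -/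

section Extension

variable {E F : Type*} [NormedAddCommGroup E] [NormedSpace ℝ E] [FiniteDimensional ℝ E]
  [NormedAddCommGroup F] [NormedSpace ℝ F]

lemma exists_cutoff {K U : Set E} (hK : IsCompact K) (hU : IsOpen U) (hKU : K ⊆ U) :
    ∃ χ : E → ℝ, ContDiff ℝ ∞ χ ∧ HasCompactSupport χ ∧ tsupport χ ⊆ U ∧ ∀ᶠ x in 𝓝ˢ K, χ x = 1 := by
  obtain ⟨C, hC, hKC, hCU⟩ := exists_compact_between hK hU hKU
  obtain ⟨f, h1, h2, -⟩ := exists_contMDiffMap_one_nhds_of_subset_interior (n := ⊤)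
    (modelWithCornersSelf ℝ E) hK.isClosed hKC
  have hsub : tsupport f ⊆ C := closure_minimal (fun x hx => by
    by_contra h'; exact hx (h2 x h')) hC.isClosed
  exact ⟨f, f.contMDiff.contDiff, hC.of_isClosed_subset (isClosed_tsupport _) hsub,
    hsub.trans hCU, h1⟩

/-- A function that is `Cⁿ` at the points of a compact set agrees near this set with a compactly
supported `Cⁿ` function. -/
lemma exists_extension {K : Set E} (hK : IsCompact K) {n : ℕ} {f : E → F}
    (hf : ∀ x ∈ K, ContDiffAt ℝ n f x) :
    ∃ g : E → F, ContDiff ℝ n g ∧ HasCompactSupport g ∧ ∀ᶠ x in 𝓝ˢ K, g x = f x := by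
  set U : Set E := interior {x | ContDiffAt ℝ n f x}
  have hKU : K ⊆ U := fun x hx => by
    rw [mem_interior_iff_mem_nhds]
    exact (hf x hx).eventually (by simp)
  obtain ⟨χ, h1, h2, h3, h4⟩ := exists_cutoff hK isOpen_interior hKU
  refine ⟨fun x => χ x • f x, ?_, h2.smul_right, ?_⟩
  · refine contDiff_iff_contDiffAt.2 fun x => ?_
    by_cases hx : x ∈ tsupport χ
    · have : ContDiffAt ℝ n f x := interior_subset (h3 hx)
      exact ((h1.of_le (by exact_mod_cast le_top)).contDiffAt).smul this
    · have : (fun x => χ x • f x) =ᶠ[𝓝 x] fun _ => 0 := by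
        filter_upwards [(isClosed_tsupport χ).isOpen_compl.mem_nhds hx] with y hy
        simp [image_eq_zero_of_notMem_tsupport hy]
      exact contDiffAt_const.congr_of_eventuallyEq this
  · filter_upwards [h4] with x hx
    simp [hx]

end Extension

/-! ### Outward normals -/

/-- For distinct unit vectors the direction `ν' - ν` makes an obtuse angle with `ν` and an acute one
with `ν'`, so the ray along it would start both inside `G` and outside its closure. -/
lemma _root_.IsOutwardUnitNormal.unique {G : Set E3} {x ν ν' : E3}
    (h : IsOutwardUnitNormal G x ν) (h' : IsOutwardUnitNormal G x ν') : ν = ν' := by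
  by_contra hne
  have hlt : inner ℝ ν ν' < 1 := by
    refine lt_of_le_of_ne ?_ fun h1 => hne ((inner_eq_one_iff_of_norm_eq_one h.1 h'.1).1 h1)
    simpa [h.1, h'.1] using real_inner_le_norm ν ν'
  have h1 : inner ℝ (ν' - ν) ν < 0 := by
    rw [inner_sub_left, real_inner_self_eq_norm_sq, h.1, real_inner_comm]; linarith
  have h2 : 0 < inner ℝ (ν' - ν) ν' := by
    rw [inner_sub_left, real_inner_self_eq_norm_sq, h'.1]; linarith
  obtain ⟨s, hs1, hs2⟩ := ((h.2.1 _ h1).and (h'.2.2 _ h2)).exists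
  exact hs2 (subset_closure hs1)

/-- The upward unit normal of a graph. -/
noncomputable def graphNormal (L : E3 ≃ₗᵢ[ℝ] E3) (γ : E2 → ℝ) (y : E2) : E3 :=
  ‖slopeVec (fderiv ℝ γ y)‖⁻¹ • L.symm (slopeVec (fderiv ℝ γ y))

/-- The right-hand side is the derivative along `v` of the height above the graph. This identity
links normals to vertical speeds in all graph computations. -/
lemma norm_mul_inner_graphNormal (L : E3 ≃ₗᵢ[ℝ] E3) (γ : E2 → ℝ) (y : E2) (v : E3) :
    ‖slopeVec (fderiv ℝ γ y)‖ * inner ℝ v (graphNormal L γ y)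
      = L v 2 - fderiv ℝ γ y (base (L v)) := by
  rw [graphNormal, inner_smul_right, ← mul_assoc, mul_inv_cancel₀ (norm_slopeVec_pos _).ne',
    one_mul, ← inner_slopeVec, ← L.inner_map_map, L.apply_symm_apply]

/-- Along a ray in direction `v`, the height above the graph has at the base point a derivative that
is a positive multiple of `v·ν`, so the sign of `v·ν` decides the side on which the ray starts.
Differentiability at the single point `y` is enough. -/
lemma isOutwardUnitNormal_graphNormal {G : Set E3} {L : E3 ≃ₗᵢ[ℝ] E3} {γ : E2 → ℝ}
    (hγ : Continuous γ) {y : E2} (hd : DifferentiableAt ℝ γ y)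
    (hG : ∀ᶠ x in 𝓝 (graphMap L γ y), (x ∈ G ↔ x ∈ subgraph L γ)) :
    IsOutwardUnitNormal G (graphMap L γ y) (graphNormal L γ y) := by
  set x := graphMap L γ y with hx
  set N := slopeVec (fderiv ℝ γ y)
  have hpos : 0 < ‖N‖ := norm_slopeVec_pos _
  have h1 : Continuous fun x : E3 => L x 2 := by fun_prop
  have h2 : Continuous fun x : E3 => γ (base (L x)) :=
    hγ.comp (continuous_base.comp L.continuous)
  set f : E3 → ℝ := fun x => L x 2 - γ (base (L x)) with hf
  have hfx : f x = 0 := by simp [hf, hx, graphMap]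
  have hslope : ∀ v : E3, Tendsto (fun s : ℝ => s⁻¹ * f (x + s • v)) (𝓝[>] 0)
      (𝓝 (‖N‖ * inner ℝ v (graphNormal L γ y))) := fun v => by
    rw [norm_mul_inner_graphNormal]
    have hline : HasDerivAt (fun s : ℝ => y + s • base (L v)) (base (L v)) 0 := by
      simpa using ((hasDerivAt_id (0:ℝ)).smul_const (base (L v))).const_add y
    have hγ' : HasFDerivAt γ (fderiv ℝ γ y) (y + (0:ℝ) • base (L v)) := by
      simpa using hd.hasFDerivAt
    have hcomp := hγ'.comp_hasDerivAt (0:ℝ) hline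
    have hlin : HasDerivAt (fun s : ℝ => γ y + s * L v 2) (L v 2) 0 := by
      simpa using ((hasDerivAt_id (0:ℝ)).mul_const (L v 2)).const_add (γ y)
    have hder : HasDerivAt (fun s : ℝ => f (x + s • v)) (L v 2 - fderiv ℝ γ y (base (L v))) 0 := by
      have : (fun s : ℝ => f (x + s • v)) =
          fun s => (γ y + s * L v 2) - (γ ∘ fun s : ℝ => y + s • base (L v)) s := by
        funext s
        simp [hf, hx, graphMap, base_add, base_smul]
      rw [this]
      exact hlin.sub hcomp
    simpa [hfx] using hder.tendsto_slope_zero_right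
  have hpath : ∀ v : E3, Tendsto (fun s : ℝ => x + s • v) (𝓝[>] 0) (𝓝 x) := fun v => by
    have : Continuous fun s : ℝ => x + s • v := by fun_prop
    simpa using (this.tendsto 0).mono_left nhdsWithin_le_nhds
  refine ⟨?_, fun v hv => ?_, fun v hv => ?_⟩
  · rw [graphNormal, norm_smul, LinearIsometryEquiv.norm_map, norm_inv, norm_norm,
      inv_mul_cancel₀ hpos.ne']
  · filter_upwards [(hslope v).eventually_lt_const (mul_neg_of_pos_of_neg hpos hv),
      (hpath v).eventually hG, self_mem_nhdsWithin] with s hs1 hs2 hs3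
    rw [hs2]
    have : f (x + s • v) < 0 := by
      by_contra h'
      exact absurd hs1 (not_lt.2 (mul_nonneg (inv_nonneg.2 (le_of_lt hs3)) (not_lt.1 h')))
    simpa [subgraph, hf] using this
  · filter_upwards [(hslope v).eventually_const_lt (mul_pos hpos hv),
      -- To stay outside the closure, a point must have a whole neighbourhood outside `G`, hence the
      -- neighbourhood form of `hG`.
      (hpath v).eventually hG.eventually_nhds, self_mem_nhdsWithin] with s hs1 hs2 hs3
    have hfp : 0 < f (x + s • v) := by
      by_contra h'
      exact absurd hs1 (not_lt.2 (mul_nonpos_of_nonneg_of_nonpos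
        (inv_nonneg.2 (le_of_lt hs3)) (not_lt.1 h')))
    rw [mem_closure_iff_frequently]
    intro hfreq
    have hfc : Continuous f := h1.sub h2
    obtain ⟨z, hz1, hz2, hz3⟩ := (hfreq.and_eventually
      (hs2.and (hfc.continuousAt.eventually_const_lt hfp))).exists
    have := hz2.1 hz1
    exact absurd this (not_lt.2 (sub_pos.1 hz3).le)

/-! ### Lipschitz domains: translations, Green's formula and the divergence theorem -/

/-- A bounded domain with Lipschitz boundary and outward unit normal `ν`. -/
structure IsLipschitzDomain (G : Set E3) (ν : E3 → E3) : Prop where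
  measurable : MeasurableSet G
  bounded : Bornology.IsBounded G
  lipschitz : HasLipschitzBoundary G
  normal : ∀ᵐ x ∂((μHE[2] : Measure E3).restrict (frontier G)), IsOutwardUnitNormal G x (ν x)

/-- The translate of `G` by `v`. -/
def translate (G : Set E3) (v : E3) : Set E3 := {x | x - v ∈ G}

/-- The general measure and weight serve two cases: volume with weight `1`, and boundary area
weighted by a component of the normal. -/
lemma hasDerivAt_integral_shift {μ : Measure E3} {w : E3 → ℝ} (hw : Integrable w μ) {f : E3 → ℝ}
    (hf : ContDiff ℝ 1 f) (hs : HasCompactSupport f) (v : E3) :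
    HasDerivAt (fun s : ℝ => ∫ x, f (x + s • v) * w x ∂μ) (∫ x, fderiv ℝ f x v * w x ∂μ) 0 := by
  have hfd : Continuous fun x => fderiv ℝ f x v := (hf.continuous_fderiv one_ne_zero).clm_apply continuous_const
  obtain ⟨C, hC⟩ := (hs.fderiv_apply (𝕜 := ℝ) v).exists_bound_of_continuous hfd
  obtain ⟨B, hB⟩ := hs.exists_bound_of_continuous hf.continuous
  have hm : ∀ {g : E3 → ℝ}, Continuous g → ∀ s : ℝ,
      AEStronglyMeasurable (fun x => g (x + s • v) * w x) μ := fun hg s =>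
    (hg.comp (by fun_prop : Continuous fun x : E3 => x + s • v)).aestronglyMeasurable.mul hw.1
  have := (hasDerivAt_integral_of_dominated_loc_of_deriv_le (μ := μ) (x₀ := (0:ℝ)) (s := univ)
    (F := fun s x => f (x + s • v) * w x) (F' := fun s x => fderiv ℝ f (x + s • v) v * w x)
    (bound := fun x => C * ‖w x‖) univ_mem (Eventually.of_forall fun s => hm hf.continuous s)
    ?_ (hm hfd 0) ?_ (hw.norm.const_mul C) ?_).2
  · simpa using this
  · exact hw.bdd_mul (hf.continuous.comp (by fun_prop)).aestronglyMeasurable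
      (Eventually.of_forall fun x => hB _)
  · refine Eventually.of_forall fun x s _ => ?_
    rw [norm_mul]
    exact mul_le_mul_of_nonneg_right (hC _) (norm_nonneg _)
  · refine Eventually.of_forall fun x s _ => HasDerivAt.mul_const ?_ _
    have hline : HasDerivAt (fun s : ℝ => x + s • v) v s := by
      simpa using ((hasDerivAt_id s).smul_const v).const_add x
    exact ((hf.differentiable one_ne_zero).differentiableAt.hasFDerivAt).comp_hasDerivAt s hline

lemma setIntegral_translate (G : Set E3) (f : E3 → ℝ) (v : E3) :
    ∫ x in translate G v, f x = ∫ x in G, f (x + v) := by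
  have h := (measurePreserving_add_right (volume : Measure E3) v).setIntegral_preimage_emb
    (measurableEmbedding_addRight v) f (translate G v)
  rw [← h]
  congr 2
  ext x
  simp [translate]

namespace IsLipschitzDomain

variable {G : Set E3} {ν : E3 → E3} (hG : IsLipschitzDomain G ν)
include hG

lemma ae_normal : ∀ᵐ x ∂(μHE[2] : Measure E3), x ∈ frontier G → IsOutwardUnitNormal G x (ν x) :=
  (ae_restrict_iff' isClosed_frontier.measurableSet).1 hG.normal

/-- If `b` and `c` are the horizontal and vertical parts of `L v`, the translated graph is that of
`γ (y - s • b) + s * c`. At `s = 0` its speed is `c - dγ(b)`, which is the slope norm times `v·ν`.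
By Rademacher's theorem this holds for almost every `y`, as `HasMovingChart` demands;
`ae_graphMap_of_ae` carries the almost everywhere defined normal to the plane. -/
lemma isMovingDomain_translate (v : E3) :
    IsMovingDomain (fun s : ℝ => translate G (s • v)) (fun x => inner ℝ v (ν x)) 0 := by
  have h0 : translate G ((0:ℝ) • v) = G := by simp [translate]
  have hcont : ∀ x : E3, Tendsto (fun q : ℝ × E3 => q.2 - q.1 • v) (𝓝 ((0:ℝ), x)) (𝓝 x) :=
    fun x => by
      have : Continuous fun q : ℝ × E3 => q.2 - q.1 • v := by fun_prop
      simpa using this.tendsto ((0:ℝ), x)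
  refine ⟨Eventually.of_forall fun s => ?_, fun x hx => ?_, fun x hx => ?_⟩
  · exact (by fun_prop : Measurable fun x : E3 => x - s • v) hG.measurable
  · simp only [h0] at hx ⊢
    by_cases hxG : x ∈ G
    · have : x ∈ interior G := by
        by_contra h'; exact hx ⟨subset_closure hxG, h'⟩
      filter_upwards [(hcont x).eventually (mem_interior_iff_mem_nhds.1 this)] with q hq
      exact iff_of_true hq hxG
    · have : x ∉ closure G := fun h' => hx ⟨h', fun hi => hxG (interior_subset hi)⟩
      filter_upwards [(hcont x).eventually (isClosed_closure.isOpen_compl.mem_nhds this)] with q hq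
      exact iff_of_false (fun h' => hq (subset_closure h')) hxG
  · simp only [h0] at hx
    obtain ⟨L, K, γ, hγ, hev⟩ := hG.lipschitz x hx
    have hev' : ∀ᶠ y in 𝓝 x, (y ∈ G ↔ y ∈ subgraph L γ) := hev
    set c : ℝ := L v 2
    set b : E2 := base (L v)
    refine ⟨L, K * (1 + ‖b‖₊) + ‖c‖₊, fun s y => γ (y - s • b) + s * c, ?_, ?_, ?_⟩
    · have h1 : LipschitzWith (1 + ‖b‖₊) fun q : ℝ × E2 => q.2 - q.1 • b := by
        refine LipschitzWith.of_dist_le_mul fun q q' => ?_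
        have e : (q.2 - q.1 • b) - (q'.2 - q'.1 • b) = (q.2 - q'.2) - (q.1 - q'.1) • b := by
          rw [sub_smul]; abel
        rw [dist_eq_norm, dist_eq_norm, e]
        refine (norm_sub_le _ _).trans ?_
        rw [norm_smul]
        have a1 := norm_fst_le (q - q')
        have a2 := norm_snd_le (q - q')
        have a3 := mul_le_mul_of_nonneg_right a1 (norm_nonneg b)
        simp only [Prod.fst_sub, Prod.snd_sub] at a1 a2 a3
        push_cast
        linarith
      have h2 : LipschitzWith ‖c‖₊ fun q : ℝ × E2 => q.1 * c := by
        refine LipschitzWith.of_dist_le_mul fun q q' => ?_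
        rw [dist_eq_norm, dist_eq_norm, ← sub_mul, norm_mul, mul_comm]
        exact mul_le_mul_of_nonneg_left (norm_fst_le (q - q')) (norm_nonneg _)
      exact (hγ.comp h1).add h2
    · filter_upwards [(hcont x).eventually hev'] with q hq
      have h1 : q.2 ∈ translate G (q.1 • v) ↔ q.2 - q.1 • v ∈ subgraph L γ := hq
      rw [h1]
      simp [subgraph, base_sub, base_smul, b, c, sub_lt_iff_lt_add]
    · have hγ0 : (fun y => γ (y - (0:ℝ) • b) + 0 * c) = γ := by funext y; simp
      obtain ⟨U, hUs, hUo, hxU⟩ := mem_nhds_iff.1 hev'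
      refine ⟨U, hUo.mem_nhds hxU, ?_⟩
      simp only [hγ0]
      filter_upwards [hγ.ae_differentiableAt, ae_graphMap_of_ae L γ hG.ae_normal]
        with y hd hν hyU
      have hfr : graphMap L γ y ∈ frontier G :=
        ((frontier_inter_of_forall_mem_iff hUo fun z hz => hUs hz).symm.subset
          ⟨(frontier_subgraph L hγ.continuous).symm.subset ⟨y, rfl⟩, hyU⟩).1
      have heq := (hν hfr).unique (isOutwardUnitNormal_graphNormal hγ.continuous hd
        (mem_of_superset (hUo.mem_nhds hyU) hUs))
      rw [heq, norm_mul_inner_graphNormal]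
      have hline : HasDerivAt (fun s : ℝ => y - s • b) (-b) 0 := by
        simpa using ((hasDerivAt_id (0:ℝ)).smul_const b).const_sub y
      have hγ' : HasFDerivAt γ (fderiv ℝ γ y) (y - (0:ℝ) • b) := by
        simpa using hd.hasFDerivAt
      have hlin : HasDerivAt (fun s : ℝ => s * c) c 0 := by
        simpa using (hasDerivAt_id (0:ℝ)).mul_const c
      refine ((hγ'.comp_hasDerivAt (0:ℝ) hline).add hlin).congr_deriv ?_
      rw [map_neg]; ring

lemma integrableOn_of_continuous {f : E3 → ℝ} (hf : Continuous f) : IntegrableOn f G :=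
  (hf.continuousOn.integrableOn_compact hG.bounded.isCompact_closure).mono_set subset_closure

lemma isCompact_frontier : IsCompact (frontier G) :=
  hG.bounded.isCompact_closure.of_isClosed_subset isClosed_frontier frontier_subset_closure

lemma volume_lt_top : volume G < ⊤ := hG.bounded.measure_lt_top

/-- Transport theorem for translations. -/
lemma transport_translate {f : E3 → ℝ} (hc : Continuous f) (hs : HasCompactSupport f) (v : E3) :
    IntegrableOn (fun x => f x * inner ℝ v (ν x)) (frontier G) μHE[2] ∧
    HasDerivAt (fun s : ℝ => ∫ x in G, f (x + s • v))
      (∫ x in frontier G, f x * inner ℝ v (ν x) ∂μHE[2]) 0 := by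
  have h := (hG.isMovingDomain_translate v).transport hc hs
  have h0 : translate G ((0:ℝ) • v) = G := by simp [translate]
  simpa only [h0, setIntegral_translate] using h

/-- **Green's formula** for a compactly supported function. -/
theorem green {f : E3 → ℝ} (hf : ContDiff ℝ 1 f) (hs : HasCompactSupport f) (v : E3) :
    ∫ x in G, fderiv ℝ f x v = ∫ x in frontier G, f x * inner ℝ v (ν x) ∂μHE[2] := by
  have : IsFiniteMeasure (volume.restrict G) := ⟨by simpa using hG.volume_lt_top⟩
  -- The derivative of `∫ x in G, f (x + s • v)` at `s = 0` is computed twice: by transport of the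
  -- domain and under the integral sign.
  have h1 := (hG.transport_translate hf.continuous hs v).2
  have h2 := hasDerivAt_integral_shift (μ := volume.restrict G) (w := fun _ => 1)
    (integrable_const 1) hf hs v
  simp only [mul_one] at h2
  exact h2.unique h1

/-- The transport theorem contains the integrability of its boundary term; a cutoff equal to `1` on
the boundary extracts it. Measurability of `ν` and finiteness of the boundary area both come from
here. -/
lemma integrableOn_inner_normal (v : E3) :
    IntegrableOn (fun x => inner ℝ v (ν x)) (frontier G) μHE[2] := by
  obtain ⟨χ, h1, h2, -, h4⟩ := exists_cutoff hG.isCompact_frontier isOpen_univ (subset_univ _)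
  refine (hG.transport_translate h1.continuous h2 v).1.congr_fun (fun x hx => ?_)
    isClosed_frontier.measurableSet
  simp [h4.self_of_nhdsSet x hx]

lemma integrableOn_normal : IntegrableOn ν (frontier G) μHE[2] := by
  have hν : ν = fun x => ∑ i, inner ℝ (EuclideanSpace.single i (1:ℝ)) (ν x) •
      EuclideanSpace.single i (1:ℝ) := by
    funext x
    ext j
    fin_cases j <;> simp [Fin.sum_univ_three, EuclideanSpace.inner_single_left]
  rw [hν]
  exact integrable_finsetSum _ fun i _ => (hG.integrableOn_inner_normal _).smul_const _

/-- The integrable field `ν` has norm `1` almost everywhere on the boundary. -/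
lemma area_frontier_lt_top : μHE[2] (frontier G) < ⊤ := by
  have h1 : IntegrableOn (fun _ : E3 => (1:ℝ)) (frontier G) μHE[2] := by
    refine hG.integrableOn_normal.norm.congr ?_
    filter_upwards [hG.normal] with x hx using hx.1
  simpa [integrableOn_const_iff] using h1

lemma isFiniteMeasure_frontier : IsFiniteMeasure ((μHE[2] : Measure E3).restrict (frontier G)) :=
  ⟨by simpa using hG.area_frontier_lt_top⟩

/-- A set of finite two-dimensional measure is null for the three-dimensional one. -/
lemma volume_frontier : volume (frontier G) = 0 := by
  have h := Measure.euclideanHausdorffMeasure_zero_or_top (show 2 < 3 by norm_num) (frontier G)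
  rw [EuclideanSpace.euclideanHausdorffMeasure_eq_volume] at h
  exact h.resolve_right hG.area_frontier_lt_top.ne

lemma integrableOn_frontier_of_continuousOn {f : E3 → ℝ} (hf : ContinuousOn f (frontier G)) :
    IntegrableOn f (frontier G) μHE[2] := by
  obtain ⟨C, hC⟩ := hG.isCompact_frontier.exists_bound_of_continuousOn hf
  have := hG.isFiniteMeasure_frontier
  refine Integrable.of_bound (hf.aestronglyMeasurable isClosed_frontier.measurableSet) C ?_
  exact (ae_restrict_iff' isClosed_frontier.measurableSet).2 (Eventually.of_forall hC)

lemma integrableOn_inner_normal_of_continuousOn {F : E3 → E3} (hF : ContinuousOn F (frontier G)) :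
    IntegrableOn (fun x => inner ℝ (F x) (ν x)) (frontier G) μHE[2] := by
  obtain ⟨C, hC⟩ := hG.isCompact_frontier.exists_bound_of_continuousOn hF
  have := hG.isFiniteMeasure_frontier
  refine Integrable.of_bound ((hF.aestronglyMeasurable isClosed_frontier.measurableSet).inner
    hG.integrableOn_normal.1) C ?_
  filter_upwards [hG.normal, ae_restrict_mem isClosed_frontier.measurableSet] with x h1 h2
  refine (norm_inner_le_norm _ _).trans ?_
  rw [h1.1, mul_one]
  exact hC x h2

/-- The **divergence theorem**. -/
theorem divergence {F : E3 → E3} (hF : ContDiff ℝ 1 F) (hs : HasCompactSupport F) :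
    ∫ x in G, TensorCalc.dvg F x = ∫ x in frontier G, inner ℝ (F x) (ν x) ∂μHE[2] := by
  have hFi : ∀ i : Fin 3, ContDiff ℝ 1 fun x => F x i := fun i => by fun_prop
  have hsi : ∀ i : Fin 3, HasCompactSupport fun x => F x i := fun i =>
    hs.comp_left (g := fun v : E3 => v i) rfl
  have hd : ∀ x (i : Fin 3), TensorCalc.grad F x i i
      = fderiv ℝ (fun x => F x i) x (EuclideanSpace.single i 1) := fun x i => by
    have h1 : DifferentiableAt ℝ F x := hF.differentiable one_ne_zero x
    have h2 := ((EuclideanSpace.proj i : E3 →L[ℝ] ℝ).hasFDerivAt.comp x h1.hasFDerivAt).fderiv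
    have h3 : (fun x => F x i) = (EuclideanSpace.proj i : E3 →L[ℝ] ℝ) ∘ F := rfl
    rw [h3, h2]
    rfl
  have h1 : ∀ x, TensorCalc.dvg F x
      = ∑ i, fderiv ℝ (fun x => F x i) x (EuclideanSpace.single i 1) := fun x => by
    simp [TensorCalc.dvg, Matrix.trace, hd]
  have h2 : ∀ x, inner ℝ (F x) (ν x)
      = ∑ i, F x i * inner ℝ (EuclideanSpace.single i (1:ℝ)) (ν x) := fun x => by
    simp [PiLp.inner_apply, mul_comm]
  simp only [h1, h2]
  rw [integral_finsetSum _ fun i _ => ?_, integral_finsetSum _ fun i _ => ?_]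
  · exact Finset.sum_congr rfl fun i _ => hG.green (hFi i) (hsi i) _
  · exact (hG.transport_translate (hFi i).continuous (hsi i) _).1
  · exact hG.integrableOn_of_continuous (((hFi i).continuous_fderiv one_ne_zero).clm_apply
      continuous_const)

/-- Tangential derivatives have zero mean on the boundary. -/
theorem integral_tangential_deriv {f : E3 → ℝ} (hf : ContDiff ℝ 1 f) (hs : HasCompactSupport f)
    (v w : E3) :
    ∫ x in frontier G, fderiv ℝ f x v * inner ℝ w (ν x) ∂μHE[2] =
      ∫ x in frontier G, fderiv ℝ f x w * inner ℝ v (ν x) ∂μHE[2] := by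
  -- Green's formula in direction `w` for the shifted function `f (· + s • v)` is an identity in
  -- `s`, which is differentiated at `s = 0`: the boundary side under the integral, the volume side
  -- by transport. Second derivatives of `f` never appear.
  have h1 := hasDerivAt_integral_shift (hG.integrableOn_inner_normal w) hf hs v
  have hc : Continuous fun x => fderiv ℝ f x w :=
    (hf.continuous_fderiv one_ne_zero).clm_apply continuous_const
  have h2 := (hG.transport_translate hc (hs.fderiv_apply (𝕜 := ℝ) w) v).2
  refine (h2.unique (h1.congr_of_eventuallyEq (Eventually.of_forall fun s => ?_))).symm
  have hfs : ContDiff ℝ 1 fun x => f (x + s • v) := hf.comp (by fun_prop)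
  have hss : HasCompactSupport fun x => f (x + s • v) :=
    hs.comp_homeomorph (Homeomorph.addRight (s • v))
  have := hG.green hfs hss w
  simpa only [fderiv_comp_add_right] using this

end IsLipschitzDomain

end BulkSurface

namespace BulkSurface

/-! ### Level sets as moving graphs -/

/-- Graph coordinates in space-time. -/
noncomputable def spaceTimeCoord (L : E3 ≃ₗᵢ[ℝ] E3) : (ℝ × E2) × ℝ → ℝ × E3 :=
  fun p => (p.1.1, L.symm (lift p.1.2 p.2))

lemma contDiff_spaceTimeCoord (L : E3 ≃ₗᵢ[ℝ] E3) {n : ℕ∞ω} : ContDiff ℝ n (spaceTimeCoord L) := by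
  have h : ContDiff ℝ n fun p : (ℝ × E2) × ℝ => coordEquiv (p.1.2, p.2) :=
    coordEquiv.contDiff.comp (by fun_prop)
  exact (contDiff_fst.comp contDiff_fst).prodMk (L.symm.contDiff.comp h)

lemma spaceTimeCoord_base (L : E3 ≃ₗᵢ[ℝ] E3) (q : ℝ × E3) :
    spaceTimeCoord L ((q.1, base (L q.2)), L q.2 2) = q := by
  simp [spaceTimeCoord]

lemma isInvertible_of_apply_one_ne_zero {A : ℝ →L[ℝ] ℝ} (h : A 1 ≠ 0) : A.IsInvertible := by
  refine ⟨ContinuousLinearEquiv.unitsEquivAut ℝ (Units.mk0 (A 1) h), ?_⟩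
  ext
  simp

/-- The reflection that exchanges the gradient of `D` with a vertical vector of the same length
makes `D` increase upwards. Orientation plays no role, so a reflection serves as well as a rotation.
-/
lemma exists_rotation {D : E3 →L[ℝ] ℝ} (hD : D ≠ 0) :
    ∃ L : E3 ≃ₗᵢ[ℝ] E3, 0 < D (L.symm (lift 0 1)) := by
  set g : E3 := (InnerProductSpace.toDual ℝ E3).symm D
  have hg : ∀ v, inner ℝ g v = D v := fun v => InnerProductSpace.toDual_symm_apply
  have hg0 : 0 < ‖g‖ := by
    rw [norm_pos_iff]
    intro h
    exact hD (by ext v; rw [← hg, h]; simp)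
  have he : ‖lift 0 1‖ = 1 := by rw [norm_lift_zero]; simp
  set w : E3 := ‖g‖ • lift 0 1
  have hw : ‖g‖ = ‖w‖ := by rw [norm_smul, he, norm_norm, mul_one]
  set L := (ℝ ∙ (g - w))ᗮ.reflection
  have hL : L g = w := Submodule.reflection_sub hw
  refine ⟨L, ?_⟩
  rw [← hg, ← L.inner_map_map, L.apply_symm_apply, hL, inner_smul_left,
    real_inner_self_eq_norm_sq, he]
  simpa using hg0

/-- A space-time level set with nonzero spatial gradient is locally a moving graph. -/
theorem exists_chart_of_levelSet {G : ℝ → Set E3} {t : ℝ} {x : E3} {φ : ℝ × E3 → ℝ}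
    (hφ : ContDiffAt ℝ 1 φ (t, x)) (hD : fderiv ℝ (fun y => φ (t, y)) x ≠ 0) (h0 : φ (t, x) = 0)
    (hG : ∀ᶠ q : ℝ × E3 in 𝓝 (t, x), (q.2 ∈ G q.1 ↔ φ q < 0)) :
    ∃ (L : E3 ≃ₗᵢ[ℝ] E3) (K : NNReal) (γ : ℝ → E2 → ℝ),
      LipschitzWith K (fun q : ℝ × E2 => γ q.1 q.2) ∧
      (∀ᶠ q : ℝ × E3 in 𝓝 (t, x), (q.2 ∈ G q.1 ↔ q.2 ∈ subgraph L (γ q.1))) ∧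
      ∀ᶠ p : ℝ × E2 in 𝓝 (t, base (L x)), DifferentiableAt ℝ (fun q : ℝ × E2 => γ q.1 q.2) p := by
  obtain ⟨L, hL⟩ := exists_rotation hD
  set u : (ℝ × E2) × ℝ := ((t, base (L x)), L x 2) with hu
  have hAu : spaceTimeCoord L u = (t, x) := spaceTimeCoord_base L (t, x)
  set ψ : (ℝ × E2) × ℝ → ℝ := φ ∘ spaceTimeCoord L with hψ
  have hψc : ContDiffAt ℝ 1 ψ u :=
    ContDiffAt.comp u (by rw [hAu]; exact hφ) (contDiff_spaceTimeCoord L).contDiffAt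
  have hψu : ψ u = 0 := by simp [hψ, hAu, h0]
  -- `a` is the vertical derivative of the level function; the choice of `L` makes it positive.
  set a : ℝ := (fderiv ℝ ψ u ∘L .inr ℝ (ℝ × E2) ℝ) 1 with ha
  have hapos : 0 < a := by
    have h1 : HasDerivAt (fun z : ℝ => ((t, base (L x)), z)) ((0 : ℝ × E2), (1:ℝ)) (L x 2) :=
      (hasDerivAt_const _ _).prodMk (hasDerivAt_id _)
    have h2 : HasDerivAt (fun z : ℝ => ψ ((t, base (L x)), z)) a (L x 2) :=
      ((hψc.differentiableAt one_ne_zero).hasFDerivAt).comp_hasDerivAt _ h1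
    have h3 : HasDerivAt (fun z : ℝ => L.symm (lift (base (L x)) z)) (L.symm (lift 0 1)) (L x 2) := by
      have hc : HasDerivAt (fun z : ℝ => ((base (L x)), z)) ((0 : E2), (1:ℝ)) (L x 2) :=
        (hasDerivAt_const _ _).prodMk (hasDerivAt_id _)
      exact ((L.symm.toContinuousLinearEquiv : E3 →L[ℝ] E3).hasFDerivAt).comp_hasDerivAt _
        ((coordEquiv : E2 × ℝ →L[ℝ] E3).hasFDerivAt.comp_hasDerivAt _ hc)
    have h4 : DifferentiableAt ℝ (fun y => φ (t, y)) (L.symm (lift (base (L x)) (L x 2))) := by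
      rw [lift_base, L.symm_apply_apply]
      exact (hφ.differentiableAt one_ne_zero).comp x (by fun_prop)
    have h5 := h4.hasFDerivAt.comp_hasDerivAt _ h3
    rw [lift_base, L.symm_apply_apply] at h5
    have : a = _ := h2.unique h5
    rw [this]
    exact hL
  have hinv : (fderiv ℝ ψ u ∘L .inr ℝ (ℝ × E2) ℝ).IsInvertible :=
    isInvertible_of_apply_one_ne_zero hapos.ne'
  set γ₀ : ℝ × E2 → ℝ := hψc.implicitFunction one_ne_zero hinv
  have hγ₀ : ContDiffAt ℝ 1 γ₀ u.1 := hψc.contDiffAt_implicitFunction one_ne_zero hinv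
  have hγ₀u : γ₀ u.1 = u.2 := hψc.implicitFunction_apply_self one_ne_zero hinv
  have hγ₀0 : ∀ᶠ p in 𝓝 u.1, ψ (p, γ₀ p) = 0 := by
    have := hψc.eventually_apply_implicitFunction one_ne_zero hinv
    rwa [hψu] at this
  obtain ⟨K, s, hs, hlip⟩ := hγ₀.exists_lipschitzOnWith
  -- The implicit function is Lipschitz only near the point, while a chart requires a globally
  -- Lipschitz function.
  obtain ⟨g, hg, heq⟩ := hlip.extend_real
  have hgγ : γ₀ =ᶠ[𝓝 u.1] g := mem_of_superset hs fun p hp => heq hp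
  have hsign : ∀ᶠ q in 𝓝 u, (ψ q < 0 ↔ q.2 < g q.1) := by
    -- Strict differentiability compares `ψ` at `q` with its zero on the graph over the same base
    -- point: `ψ q` equals `a` times the height above the graph, up to an error of at most `a / 2`
    -- times that height. Hence both have the same sign.
    have hst := (hψc.hasStrictFDerivAt one_ne_zero).isLittleO.def (half_pos hapos)
    have hc1 : Tendsto (fun q : (ℝ × E2) × ℝ => q.1) (𝓝 u) (𝓝 u.1) := continuous_fst.tendsto u
    have hc2 : Tendsto (fun q : (ℝ × E2) × ℝ => (q, (q.1, γ₀ q.1))) (𝓝 u) (𝓝 (u, u)) := by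
      have h1 : Tendsto (fun q : (ℝ × E2) × ℝ => γ₀ q.1) (𝓝 u) (𝓝 u.2) := by
        rw [← hγ₀u]; exact hγ₀.continuousAt.tendsto.comp hc1
      exact tendsto_id.prodMk_nhds (hc1.prodMk_nhds h1)
    filter_upwards [hc2.eventually hst, hc1.eventually hγ₀0, hc1.eventually hgγ] with q h1 h2 h3
    have e1 : q - (q.1, γ₀ q.1) = (q.2 - γ₀ q.1) • ((0 : ℝ × E2), (1:ℝ)) := by
      ext <;> simp
    have e2 : fderiv ℝ ψ u ((0 : ℝ × E2), (1:ℝ)) = a := rfl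
    simp only [h2, sub_zero, e1, map_smul, e2, smul_eq_mul, norm_smul] at h1
    have e3 : ‖((0 : ℝ × E2), (1:ℝ))‖ = 1 := by simp
    rw [e3, mul_one, Real.norm_eq_abs, Real.norm_eq_abs] at h1
    rw [← h3]
    have h1' := abs_le.1 h1
    constructor
    · intro h
      by_contra hn
      rw [abs_of_nonneg (by linarith)] at h1'
      nlinarith
    · intro h
      rw [abs_of_neg (by linarith)] at h1'
      nlinarith
  refine ⟨L, K, fun r y => g (r, y), hg, ?_, ?_⟩
  · have hc : Tendsto (fun q : ℝ × E3 => ((q.1, base (L q.2)), L q.2 2)) (𝓝 (t, x)) (𝓝 u) := by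
      have : Continuous fun q : ℝ × E3 => ((q.1, base (L q.2)), L q.2 2) := by fun_prop
      exact this.tendsto (t, x)
    filter_upwards [hG, hc.eventually hsign] with q h1 h2
    rw [h1, ← show ψ ((q.1, base (L q.2)), L q.2 2) = φ q by
      simp only [hψ, Function.comp_apply, spaceTimeCoord_base], h2]
    rfl
  · have h1 : ∀ᶠ p in 𝓝 u.1, ContDiffAt ℝ 1 γ₀ p := hγ₀.eventually (by simp)
    filter_upwards [h1, hgγ.eventuallyEq_nhds] with p hp1 hp2
    exact (hp1.differentiableAt one_ne_zero).congr_of_eventuallyEq hp2.symm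

lemma eq_zero_of_mem_frontier {G : Set E3} {x : E3} {φ : E3 → ℝ} (hφ : ContinuousAt φ x)
    (hG : ∀ᶠ y in 𝓝 x, (y ∈ G ↔ φ y < 0)) (hx : x ∈ frontier G) : φ x = 0 := by
  rcases lt_trichotomy (φ x) 0 with h | h | h
  · refine absurd (mem_interior_iff_mem_nhds.2 ?_) hx.2
    filter_upwards [hG, hφ.eventually_lt_const h] with y h1 h2 using h1.2 h2
  · exact h
  · have h1 : ∃ᶠ y in 𝓝 x, y ∈ G := mem_closure_iff_frequently.1 hx.1
    obtain ⟨y, hy1, hy2, hy3⟩ := (h1.and_eventually (hG.and (hφ.eventually_const_lt h))).exists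
    exact absurd (hy2.1 hy1) (not_lt.2 hy3.le)

end BulkSurface

/-! ### The interface as a moving domain -/

namespace TwoPhaseFlow

open BulkSurface

variable {S : TwoPhaseFlow} {t : ℝ}

namespace IsInterface

variable (hS : S.IsInterface) (ht : t ∈ Ioo 0 S.T)
include hS ht

lemma isOpen_Ωm : IsOpen (S.Ωm t) := by
  refine isOpen_iff_mem_nhds.2 fun x hx => ?_
  have h := hS.cont_mem t ht x hx
  have hc : Tendsto (fun y : E3 => (t, y)) (𝓝 x) (𝓝 (t, x)) :=
    (by fun_prop : Continuous fun y : E3 => (t, y)).tendsto x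
  exact hc.eventually h

lemma exists_chart {x : E3} (hx : x ∈ S.Γ t) :
    ∃ (L : E3 ≃ₗᵢ[ℝ] E3) (K : NNReal) (γ : ℝ → E2 → ℝ),
      LipschitzWith K (fun q : ℝ × E2 => γ q.1 q.2) ∧
      (∀ᶠ q : ℝ × E3 in 𝓝 (t, x), (q.2 ∈ S.Ωm q.1 ↔ q.2 ∈ subgraph L (γ q.1))) ∧
      ∀ᶠ p : ℝ × E2 in 𝓝 (t, base (L x)),
        DifferentiableAt ℝ (fun q : ℝ × E2 => γ q.1 q.2) p := by
  obtain ⟨φ, h1, h2, h3⟩ := hS.levelSet t ht x hx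
  have hc : Tendsto (fun y : E3 => (t, y)) (𝓝 x) (𝓝 (t, x)) :=
    (by fun_prop : Continuous fun y : E3 => (t, y)).tendsto x
  refine exists_chart_of_levelSet (h1.of_le one_le_two) h2 ?_ h3
  exact eq_zero_of_mem_frontier (φ := fun y => φ (t, y))
    (ContinuousAt.comp (f := fun y : E3 => (t, y)) h1.continuousAt hc) (hc.eventually h3) hx

lemma isLipschitzDomain (hb : Bornology.IsBounded S.Ω) :
    IsLipschitzDomain (S.Ωm t) (S.n t) := by
  refine ⟨(hS.isOpen_Ωm ht).measurableSet, ?_, fun x hx => ?_, ?_⟩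
  · exact hb.subset (subset_closure.trans (hS.internal t ⟨ht.1.le, ht.2.le⟩))
  · obtain ⟨L, K, γ, h1, h2, -⟩ := hS.exists_chart ht hx
    refine ⟨L, K, γ t, LipschitzWith.of_dist_le_mul fun y y' => ?_, ?_⟩
    · simpa [Prod.dist_eq] using h1.dist_le_mul (t, y) (t, y')
    · have hc : Tendsto (fun y : E3 => (t, y)) (𝓝 x) (𝓝 (t, x)) :=
        (by fun_prop : Continuous fun y : E3 => (t, y)).tendsto x
      exact hc.eventually h2
  · exact (ae_restrict_iff' isClosed_frontier.measurableSet).2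
      (Eventually.of_forall (hS.normal t ht))

/-- The interface is at time `t` a domain that moves with normal velocity `U_N`. -/
theorem isMovingDomain : IsMovingDomain S.Ωm (S.UN t) t := by
  refine ⟨?_, fun x hx => ?_, fun x hx => ?_⟩
  · filter_upwards [Ioo_mem_nhds ht.1 ht.2] with s hs using (hS.isOpen_Ωm hs).measurableSet
  · by_cases hxG : x ∈ S.Ωm t
    · filter_upwards [hS.cont_mem t ht x hxG] with q hq using iff_of_true hq hxG
    · have : x ∉ closure (S.Ωm t) := fun h =>
        hx ⟨h, fun hi => hxG (interior_subset hi)⟩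
      filter_upwards [hS.cont_notMem t ht x this] with q hq
      exact iff_of_false (fun h => hq (subset_closure h)) hxG
  obtain ⟨L, K, γ, hγ, hev, hdiff⟩ := hS.exists_chart ht hx
  refine ⟨L, K, γ, hγ, hev, ?_⟩
  have hγc : ∀ s, Continuous (γ s) := fun s =>
    hγ.continuous.comp (by fun_prop : Continuous fun y : E2 => (s, y))
  have hslice : ∀ (s : ℝ) (x : E3), Tendsto (fun y : E3 => (s, y)) (𝓝 x) (𝓝 (s, x)) := fun s x =>
    (by fun_prop : Continuous fun y : E3 => (s, y)).tendsto x
  have hW : ∀ᶠ z in 𝓝 x, (∀ᶠ q : ℝ × E3 in 𝓝 (t, z), (q.2 ∈ S.Ωm q.1 ↔ q.2 ∈ subgraph L (γ q.1))) ∧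
      DifferentiableAt ℝ (fun q : ℝ × E2 => γ q.1 q.2) (t, base (L z)) := by
    refine ((hslice t x).eventually hev.eventually_nhds).and ?_
    have : Tendsto (fun z : E3 => (t, base (L z))) (𝓝 x) (𝓝 (t, base (L x))) :=
      (by fun_prop : Continuous fun z : E3 => (t, base (L z))).tendsto x
    exact this.eventually hdiff
  refine ⟨_, hW, Eventually.of_forall fun y hy => ?_⟩
  obtain ⟨hev', hd⟩ := hy
  set z := graphMap L (γ t) y with hz
  have hLz : base (L z) = y := by simp [hz, graphMap]
  rw [hLz] at hd
  have hzΓ : z ∈ S.Γ t := by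
    obtain ⟨V, hVs, hVo, hzV⟩ := mem_nhds_iff.1 ((hslice t z).eventually hev')
    exact ((frontier_inter_of_forall_mem_iff hVo fun z hz => hVs hz).symm.subset
          ⟨(frontier_subgraph L (hγc t)).symm.subset ⟨y, rfl⟩, hzV⟩).1
  -- The trajectory of `Ψ` through `z` stays on the moving graph and has velocity `w = U_N n` at
  -- time `t`. Differentiating its height gives `w₃ = ∂ₜγ + dγ(w_h)`, with `w_h` the horizontal
  -- part, so `∂ₜγ` is the slope norm times `w·n = U_N`.
  obtain ⟨x0, hx0, hxz⟩ := (hS.lagrange_bij t ⟨ht.1.le, ht.2.le⟩).surjOn hzΓ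
  have hc := hS.lagrange_ode x0 hx0 t ht
  rw [hxz] at hc
  set w : E3 := S.UN t z • S.n t z
  have hgraph : ∀ᶠ s in 𝓝 t, L (S.Ψ s x0) 2 = γ s (base (L (S.Ψ s x0))) := by
    have hcc : Tendsto (fun s => (s, S.Ψ s x0)) (𝓝 t) (𝓝 (t, z)) := by
      have := hc.continuousAt.tendsto
      rw [hxz] at this
      exact tendsto_id.prodMk_nhds this
    filter_upwards [hcc.eventually hev'.eventually_nhds, Ioo_mem_nhds ht.1 ht.2] with s h1 h2
    have hmem : S.Ψ s x0 ∈ frontier (S.Ωm s) :=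
      (hS.lagrange_bij s ⟨h2.1.le, h2.2.le⟩).mapsTo hx0
    obtain ⟨V, hVs, hVo, hzV⟩ := mem_nhds_iff.1 ((hslice s _).eventually h1)
    obtain ⟨y', hy'⟩ := (frontier_subgraph L (hγc s)).subset
      ((frontier_inter_of_forall_mem_iff hVo fun z hz => hVs hz).subset ⟨hmem, hzV⟩).1
    rw [← hy']
    simp [graphMap]
  set D := fderiv ℝ (fun q : ℝ × E2 => γ q.1 q.2) (t, y)
  have hLc : HasDerivAt (fun s => L (S.Ψ s x0)) (L w) t :=
    ((L.toContinuousLinearEquiv : E3 →L[ℝ] E3).hasFDerivAt).comp_hasDerivAt t hc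
  have hL2 : HasDerivAt (fun s => L (S.Ψ s x0) 2) (L w 2) t :=
    ((EuclideanSpace.proj 2 : E3 →L[ℝ] ℝ).hasFDerivAt).comp_hasDerivAt t hLc
  have hLb : HasDerivAt (fun s => base (L (S.Ψ s x0))) (base (L w)) t :=
    (baseL.hasFDerivAt).comp_hasDerivAt t hLc
  have hpt : (t, base (L (S.Ψ t x0))) = (t, y) := by rw [hxz, hLz]
  have hR : HasDerivAt (fun s => γ s (base (L (S.Ψ s x0)))) (D (1, base (L w))) t := by
    have h1 : HasFDerivAt (fun q : ℝ × E2 => γ q.1 q.2) D (t, base (L (S.Ψ t x0))) := by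
      rw [hpt]; exact hd.hasFDerivAt
    exact h1.comp_hasDerivAt t ((hasDerivAt_id t).prodMk hLb)
  have hkey : L w 2 = D (1, base (L w)) := hL2.unique (hR.congr_of_eventuallyEq hgraph)
  have htime : HasDerivAt (fun s => γ s y) (D (1, 0)) t :=
    HasFDerivAt.comp_hasDerivAt (l := fun q : ℝ × E2 => γ q.1 q.2) (f := fun s : ℝ => (s, y)) t
      hd.hasFDerivAt ((hasDerivAt_id t).prodMk (hasDerivAt_const t y))
  have hspace : HasFDerivAt (γ t) (D.comp (ContinuousLinearMap.inr ℝ ℝ E2)) y :=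
    hd.hasFDerivAt.comp y (hasFDerivAt_prodMk_right t y)
  have hn : S.n t z = graphNormal L (γ t) y :=
    (hS.normal t ht z hzΓ).unique (isOutwardUnitNormal_graphNormal (hγc t)
      hspace.differentiableAt ((hslice t z).eventually hev'))
  refine htime.congr_deriv ?_
  have e1 : D (1, base (L w)) = D (1, 0) + D (0, base (L w)) := by
    rw [← map_add]; simp
  have e2 := norm_mul_inner_graphNormal L (γ t) y w
  have e3 : inner ℝ w (graphNormal L (γ t) y) = S.UN t z := by
    rw [← hn, real_inner_smul_left, real_inner_self_eq_norm_sq, (hS.normal t ht z hzΓ).1]; ring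
  rw [e3, hspace.fderiv] at e2
  rw [hspace.fderiv, e2, hkey, e1]
  simp

end IsInterface

end TwoPhaseFlow

namespace BulkSurface

/-! ### Time-dependent fields -/

section TimeDeriv

variable {F : Type*} [NormedAddCommGroup F] [NormedSpace ℝ F] {f : ℝ → E3 → F}

lemma hasDerivAt_time (hf : ContDiff ℝ 1 (Function.uncurry f)) (s : ℝ) (x : E3) :
    HasDerivAt (fun r => f r x) (fderiv ℝ (Function.uncurry f) (s, x) (1, 0)) s :=
  HasFDerivAt.comp_hasDerivAt (l := Function.uncurry f) (f := fun r : ℝ => (r, x)) s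
    (hf.differentiable one_ne_zero (s, x)).hasFDerivAt
    ((hasDerivAt_id s).prodMk (hasDerivAt_const s x))

lemma continuous_deriv_time (hf : ContDiff ℝ 1 (Function.uncurry f)) :
    Continuous fun q : ℝ × E3 => deriv (fun r => f r q.2) q.1 := by
  have : (fun q : ℝ × E3 => deriv (fun r => f r q.2) q.1)
      = fun q => fderiv ℝ (Function.uncurry f) q (1, 0) := by
    funext q; exact (hasDerivAt_time hf q.1 q.2).deriv
  rw [this]
  exact (hf.continuous_fderiv one_ne_zero).clm_apply continuous_const

lemma continuous_deriv_time_slice (hf : ContDiff ℝ 1 (Function.uncurry f)) (s : ℝ) :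
    Continuous fun x => deriv (fun r => f r x) s :=
  (continuous_deriv_time hf).comp (by fun_prop : Continuous fun x : E3 => (s, x))

lemma contDiff_slice {n : ℕ∞ω} (hf : ContDiff ℝ n (Function.uncurry f)) (s : ℝ) :
    ContDiff ℝ n (f s) :=
  hf.comp (by fun_prop : ContDiff ℝ n fun x : E3 => (s, x))

lemma isClosedEmbedding_slice (s : ℝ) : IsClosedEmbedding fun x : E3 => (s, x) :=
  Isometry.isClosedEmbedding (Isometry.of_dist_eq fun x y => by simp [Prod.dist_eq])

omit [NormedSpace ℝ F] in
lemma hasCompactSupport_slice (hs : HasCompactSupport (Function.uncurry f)) (s : ℝ) :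
    HasCompactSupport (f s) :=
  hs.comp_isClosedEmbedding (isClosedEmbedding_slice s)

lemma hasCompactSupport_deriv_time (hf : ContDiff ℝ 1 (Function.uncurry f))
    (hs : HasCompactSupport (Function.uncurry f)) (s : ℝ) :
    HasCompactSupport fun x => deriv (fun r => f r x) s := by
  have : (fun x => deriv (fun r => f r x) s)
      = (fun q => fderiv ℝ (Function.uncurry f) q (1, 0)) ∘ fun x : E3 => (s, x) := by
    funext x; exact (hasDerivAt_time hf s x).deriv
  rw [this]
  exact (hs.fderiv_apply (𝕜 := ℝ) (1, 0)).comp_isClosedEmbedding (isClosedEmbedding_slice s)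

/-- The difference quotients in time converge uniformly in space. -/
lemma uniform_time_quotient (hf : ContDiff ℝ 1 (Function.uncurry f))
    (hs : HasCompactSupport (Function.uncurry f)) (t : ℝ) {ε : ℝ} (hε : 0 < ε) :
    ∀ᶠ s in 𝓝 t, ∀ x, ‖f s x - f t x - (s - t) • deriv (fun r => f r x) t‖ ≤ ε * |s - t| := by
  set D : ℝ × E3 → F := fun q => fderiv ℝ (Function.uncurry f) q (1, 0)
  have hD : Continuous D := (hf.continuous_fderiv one_ne_zero).clm_apply continuous_const
  -- Compact support makes the time derivative uniformly continuous, so one `δ` serves all points of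
  -- space; the mean value inequality does the rest.
  have huc : UniformContinuous D :=
    HasCompactSupport.uniformContinuous_of_continuous (hs.fderiv_apply (𝕜 := ℝ) (1, 0)) hD
  obtain ⟨δ, hδ, hδ'⟩ := Metric.uniformContinuous_iff.1 huc ε hε
  filter_upwards [Metric.ball_mem_nhds t hδ] with s hst x
  rw [(hasDerivAt_time hf t x).deriv]
  have hder : ∀ r ∈ Metric.ball t δ, HasDerivWithinAt
      (fun r => f r x - (r - t) • D (t, x)) (D (r, x) - D (t, x)) (Metric.ball t δ) r := by
    intro r _
    have h2 : HasDerivAt (fun r : ℝ => (r - t) • D (t, x)) ((1:ℝ) • D (t, x)) r :=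
      ((hasDerivAt_id r).sub_const t).smul_const _
    rw [one_smul] at h2
    exact ((hasDerivAt_time hf r x).sub h2).hasDerivWithinAt
  have hb : ∀ r ∈ Metric.ball t δ, ‖D (r, x) - D (t, x)‖ ≤ ε := fun r hr => by
    rw [← dist_eq_norm]
    refine (hδ' ?_).le
    simpa [Prod.dist_eq] using hr
  have := (convex_ball t δ).norm_image_sub_le_of_norm_hasDerivWithin_le hder hb
    (Metric.mem_ball_self hδ) hst
  simpa [sub_right_comm] using this

end TimeDeriv

/-- Used for integrals whose domain and integrand both vary: `A` has the integrand frozen at time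
`t`, `B` integrates its frozen time derivative over the moving domain, and `C` bounds the measure of
the domain. Only continuity of `B` at `t` is needed. -/
lemma hasDerivAt_of_approx {Φ A B : ℝ → ℝ} {a C t : ℝ} (hA : HasDerivAt A a t)
    (hB : ContinuousAt B t)
    (h : ∀ ε > 0, ∀ᶠ s in 𝓝 t, |Φ s - A s - (s - t) * B s| ≤ ε * |s - t| * C) :
    HasDerivAt Φ (a + B t) t := by
  have hC : ∀ c > 0, ∃ ε > 0, ε * C ≤ c := fun c hc => by
    refine ⟨c / (|C| + 1), by positivity, ?_⟩
    rw [div_mul_eq_mul_div, div_le_iff₀ (by positivity)]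
    nlinarith [le_abs_self C]
  have h0 : Φ t = A t := by
    have := (h 1 one_pos).self_of_nhds
    simp only [sub_self, abs_zero, mul_zero, zero_mul, sub_zero] at this
    exact sub_eq_zero.1 (abs_nonpos_iff.1 this)
  have h1 : HasDerivAt (fun s => (s - t) * B s) (B t) t := by
    rw [hasDerivAt_iff_isLittleO]
    refine Asymptotics.IsLittleO.of_bound fun c hc => ?_
    filter_upwards [Metric.continuousAt_iff'.1 hB c hc] with s hs
    have : (s - t) * B s - (t - t) * B t - (s - t) • B t = (B s - B t) * (s - t) := by
      simp only [smul_eq_mul]; ring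
    rw [this, norm_mul]
    exact mul_le_mul_of_nonneg_right (by rw [← dist_eq_norm]; exact hs.le) (norm_nonneg _)
  have h2 : HasDerivAt (fun s => Φ s - A s - (s - t) * B s) 0 t := by
    rw [hasDerivAt_iff_isLittleO]
    refine Asymptotics.IsLittleO.of_bound fun c hc => ?_
    obtain ⟨ε, hε, hεc⟩ := hC c hc
    filter_upwards [h ε hε] with s hs
    simp only [h0, sub_self, zero_mul, smul_zero, sub_zero]
    refine hs.trans ?_
    rw [mul_right_comm]
    exact mul_le_mul_of_nonneg_right hεc (abs_nonneg _)
  have := (hA.add h1).add h2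
  rw [add_zero] at this
  exact this.congr_of_eventuallyEq (Eventually.of_forall fun s => by simp)

lemma integral_sub_sub_const_mul {α : Type*} {_ : MeasurableSpace α} {μ : Measure α}
    {a b c : α → ℝ} (ha : Integrable a μ) (hb : Integrable b μ) (hc : Integrable c μ) (k : ℝ) :
    ∫ x, a x ∂μ - ∫ x, b x ∂μ - k * ∫ x, c x ∂μ = ∫ x, (a x - b x - k * c x) ∂μ := by
  have h1 := integral_sub (ha.sub hb) (hc.const_mul k)
  have h2 := integral_sub ha hb
  rw [integral_const_mul] at h1
  simp only [Pi.sub_apply] at h1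
  rw [h1, h2]

/-! ### Reynolds' transport theorem -/

/-- A moving domain that stays in a bounded set. -/
structure IsBoundedMovingDomain (G : ℝ → Set E3) (V : E3 → ℝ) (t : ℝ) : Prop
    extends IsMovingDomain G V t where
  bounded : ∃ B, Bornology.IsBounded B ∧ ∀ᶠ s in 𝓝 t, G s ⊆ B

/-- **Reynolds' transport theorem**. -/
theorem IsBoundedMovingDomain.reynolds {G : ℝ → Set E3} {V : E3 → ℝ} {t : ℝ}
    (hG : IsBoundedMovingDomain G V t) {f : ℝ → E3 → ℝ} (hf : ContDiff ℝ 1 (Function.uncurry f))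
    (hs : HasCompactSupport (Function.uncurry f)) :
    HasDerivAt (fun s => ∫ x in G s, f s x)
      ((∫ x in frontier (G t), f t x * V x ∂μHE[2]) + ∫ x in G t, deriv (fun r => f r x) t) t := by
  obtain ⟨B, hB, hGB⟩ := hG.bounded
  have hint : ∀ {g : E3 → ℝ}, Continuous g → HasCompactSupport g → ∀ s, IntegrableOn g (G s) :=
    fun hg hgs s => (hg.integrable_of_hasCompactSupport hgs).integrableOn
  have hi1 := fun s => hint (contDiff_slice hf s).continuous (hasCompactSupport_slice hs s)
  have hi2 := hint (continuous_deriv_time_slice hf t) (hasCompactSupport_deriv_time hf hs t)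
  refine hasDerivAt_of_approx (A := fun s => ∫ x in G s, f t x)
    (B := fun s => ∫ x in G s, deriv (fun r => f r x) t) (C := volume.real B)
    -- The transport theorem is used twice: for the derivative of the frozen integral, and for the
    -- continuity in time of the integral of the time derivative.
    (hG.transport (contDiff_slice hf t).continuous (hasCompactSupport_slice hs t)).2
    (hG.transport (continuous_deriv_time_slice hf t)
      (hasCompactSupport_deriv_time hf hs t)).2.continuousAt fun ε hε => ?_
  filter_upwards [uniform_time_quotient hf hs t hε, hGB] with s h1 h2
  rw [integral_sub_sub_const_mul (hi1 s s) (hi1 t s) (hi2 s), ← Real.norm_eq_abs]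
  have hlt : volume (G s) < ⊤ := (measure_mono h2).trans_lt hB.measure_lt_top
  refine (norm_setIntegral_le_of_norm_le_const hlt fun x _ => h1 x).trans ?_
  exact mul_le_mul_of_nonneg_left (measureReal_mono h2 hB.measure_lt_top.ne) (by positivity)

/-! ### Transport of surface integrals -/

lemma IsLipschitzDomain.abs_flux_le {G : Set E3} {ν : E3 → E3} (hG : IsLipschitzDomain G ν)
    {F : E3 → E3} {c : ℝ} (hF : ∀ x, ‖F x‖ ≤ c) :
    |∫ x in frontier G, inner ℝ (F x) (ν x) ∂μHE[2]| ≤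
      c * (μHE[2] : Measure E3).real (frontier G) := by
  rw [← Real.norm_eq_abs]
  refine norm_setIntegral_le_of_norm_le_const_ae hG.area_frontier_lt_top ?_
  filter_upwards [hG.normal] with x hx
  refine (norm_inner_le_norm _ _).trans ?_
  rw [hx.1, mul_one]
  exact hF x

/-- A bounded moving domain whose boundary is Lipschitz with outward unit normal `n s` at all times
`s` near `t`, where `n` extends to a `C¹` field. -/
structure IsRegularMovingDomain (G : ℝ → Set E3) (V : E3 → ℝ) (n : ℝ → E3 → E3) (t : ℝ) : Prop
    extends IsBoundedMovingDomain G V t where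
  lipschitz : ∀ᶠ s in 𝓝 t, IsLipschitzDomain (G s) (n s)
  normal_ext : ∃ N : ℝ → E3 → E3, ContDiff ℝ 1 (Function.uncurry N) ∧
    HasCompactSupport (Function.uncurry N) ∧ ∀ᶠ s in 𝓝 t, ∀ x ∈ frontier (G s), N s x = n s x

lemma continuous_grad {w : E3 → E3} (hw : ContDiff ℝ 1 w) (i j : Fin 3) :
    Continuous fun x => TensorCalc.grad w x i j := by
  have h : Continuous fun x => fderiv ℝ w x (EuclideanSpace.single j 1) :=
    (hw.continuous_fderiv one_ne_zero).clm_apply continuous_const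
  exact (EuclideanSpace.proj i : E3 →L[ℝ] ℝ).continuous.comp h

lemma continuous_dvg {w : E3 → E3} (hw : ContDiff ℝ 1 w) : Continuous (TensorCalc.dvg w) := by
  unfold TensorCalc.dvg Matrix.trace
  exact continuous_finsetSum _ fun i _ => continuous_grad hw i i

lemma hasCompactSupport_dvg {w : E3 → E3} (hs : HasCompactSupport w) :
    HasCompactSupport (TensorCalc.dvg w) := by
  have h : TensorCalc.dvg w = (fun A : E3 →L[ℝ] E3 => ∑ i, A (EuclideanSpace.single i 1) i) ∘
      fderiv ℝ w := by
    funext x; simp [TensorCalc.dvg, Matrix.trace, TensorCalc.grad]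
  rw [h]
  exact (hs.fderiv (𝕜 := ℝ)).comp_left (by simp)

namespace IsRegularMovingDomain

variable {G : ℝ → Set E3} {V : E3 → ℝ} {n : ℝ → E3 → E3} {t : ℝ}
  (hG : IsRegularMovingDomain G V n t)
include hG

/-- The area of the boundary is locally bounded in time. -/
lemma exists_area_bound : ∃ M : ℝ, ∀ᶠ s in 𝓝 t, (μHE[2] : Measure E3).real (frontier (G s)) ≤ M := by
  obtain ⟨N, hN, hNs, hNn⟩ := hG.normal_ext
  obtain ⟨B, hB, hGB⟩ := hG.bounded
  -- The divergences of all time slices form one continuous function with compact support in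
  -- space-time, so a single bound `C` holds at all times.
  set d : ℝ × E3 → ℝ := fun q => ∑ i, fderiv ℝ (Function.uncurry N) q
    (0, EuclideanSpace.single i 1) i
  have hdc : Continuous d := continuous_finsetSum _ fun i _ =>
    (EuclideanSpace.proj i : E3 →L[ℝ] ℝ).continuous.comp
      ((hN.continuous_fderiv one_ne_zero).clm_apply continuous_const)
  have hds : HasCompactSupport d :=
    (hNs.fderiv (𝕜 := ℝ)).comp_left (g := fun A : ℝ × E3 →L[ℝ] E3 =>
      ∑ i, A (0, EuclideanSpace.single i 1) i) (by simp)
  obtain ⟨C, hC⟩ := hds.exists_bound_of_continuous hdc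
  have hdd : ∀ s x, TensorCalc.dvg (N s) x = d (s, x) := fun s x => by
    have h := (hN.differentiable one_ne_zero (s, x)).hasFDerivAt.comp x (hasFDerivAt_prodMk_right s x)
    have h' : HasFDerivAt (N s) _ x := h
    simp only [TensorCalc.dvg, Matrix.trace, TensorCalc.grad, h'.fderiv, d]
    rfl
  refine ⟨C * volume.real B, ?_⟩
  filter_upwards [hNn, hGB, hG.lipschitz] with s h1 h2 h3
  have hlt : volume (G s) < ⊤ := (measure_mono h2).trans_lt hB.measure_lt_top
  have hdiv := h3.divergence (contDiff_slice hN s) (hasCompactSupport_slice hNs s)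
  -- Since `N` equals the unit normal on the boundary, the area is the flux of `N`, that is, the
  -- integral of its divergence over a set of bounded volume.
  have harea : ∫ x in frontier (G s), inner ℝ (N s x) (n s x) ∂μHE[2]
      = (μHE[2] : Measure E3).real (frontier (G s)) := by
    have : ∫ x in frontier (G s), inner ℝ (N s x) (n s x) ∂μHE[2]
        = ∫ x in frontier (G s), (1:ℝ) ∂μHE[2] := by
      refine integral_congr_ae ?_
      filter_upwards [h3.normal, ae_restrict_mem isClosed_frontier.measurableSet] with x hx hx'
      rw [h1 x hx', real_inner_self_eq_norm_sq, hx.1, one_pow]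
    rw [this]; simp
  rw [← harea, ← hdiv]
  refine (le_abs_self _).trans ?_
  rw [← Real.norm_eq_abs]
  refine (norm_setIntegral_le_of_norm_le_const hlt fun x _ => by rw [hdd]; exact hC _).trans ?_
  exact mul_le_mul_of_nonneg_left (measureReal_mono h2 hB.measure_lt_top.ne)
    ((norm_nonneg _).trans (hC (0, 0)))

/-- The flux of a continuous field through the moving boundary is continuous in time. -/
lemma continuousAt_flux {Z : E3 → E3} (hZ : Continuous Z) (hs : HasCompactSupport Z) :
    ContinuousAt (fun s => ∫ x in frontier (G s), inner ℝ (Z x) (n s x) ∂μHE[2]) t := by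
  obtain ⟨M, hM⟩ := hG.exists_area_bound
  have hM0 : 0 ≤ M := measureReal_nonneg.trans hM.self_of_nhds
  -- `Z` is merely continuous, as time derivatives of `C¹` fields are. A uniformly close `C¹` field
  -- has a flux equal to the volume integral of its divergence, which is continuous in time by
  -- transport; the area bound controls the error.
  refine continuousAt_of_locally_uniform_approx_of_continuousAt fun u hu => ?_
  obtain ⟨ε, hε, hεu⟩ := Metric.mem_uniformity_dist.1 hu
  have hδ : 0 < ε / (M + 1) := by positivity
  obtain ⟨Z', hZ'1, hZ'2, hZ'3⟩ := hZ.exists_contDiff_approx 1 continuous_const fun _ => hδ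
  have hZ'1' : ContDiff ℝ 1 Z' := hZ'1
  have hs' : HasCompactSupport Z' := hs.mono hZ'3
  refine ⟨_, hM.and hG.lipschitz, fun s => ∫ x in G s, TensorCalc.dvg Z' x,
    (hG.transport (continuous_dvg hZ'1') (hasCompactSupport_dvg hs')).2.continuousAt,
    fun s hs => hεu ?_⟩
  obtain ⟨h1, h2⟩ := hs
  simp only
  rw [h2.divergence hZ'1' hs', Real.dist_eq, ← integral_sub
    (h2.integrableOn_inner_normal_of_continuousOn hZ.continuousOn)
    (h2.integrableOn_inner_normal_of_continuousOn hZ'1.continuous.continuousOn)]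
  simp only [← inner_sub_left]
  refine (h2.abs_flux_le (c := ε / (M + 1)) fun x => ?_).trans_lt ?_
  · rw [← dist_eq_norm, dist_comm]; exact (hZ'2 x).le
  · refine (mul_le_mul_of_nonneg_left h1 hδ.le).trans_lt ?_
    rw [div_mul_eq_mul_div, div_lt_iff₀ (by positivity)]
    nlinarith

/-- The rate of change of the flux of a field through the moving boundary. -/
theorem hasDerivAt_flux {W : ℝ → E3 → E3} (hW : ContDiff ℝ 1 (Function.uncurry W))
    (hs : HasCompactSupport (Function.uncurry W)) :
    HasDerivAt (fun s => ∫ x in frontier (G s), inner ℝ (W s x) (n s x) ∂μHE[2])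
      ((∫ x in frontier (G t), TensorCalc.dvg (W t) x * V x ∂μHE[2]) +
        ∫ x in frontier (G t), inner ℝ (deriv (fun r => W r x) t) (n t x) ∂μHE[2]) t := by
  obtain ⟨M, hM⟩ := hG.exists_area_bound
  have hWt := contDiff_slice hW t
  have hWs := hasCompactSupport_slice hs t
  -- For the frozen field the divergence theorem turns the flux into the integral of a fixed
  -- function over the moving domain.
  have hA : HasDerivAt (fun s => ∫ x in frontier (G s), inner ℝ (W t x) (n s x) ∂μHE[2])
      (∫ x in frontier (G t), TensorCalc.dvg (W t) x * V x ∂μHE[2]) t := by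
    refine (hG.transport (continuous_dvg hWt) (hasCompactSupport_dvg hWs)).2.congr_of_eventuallyEq ?_
    filter_upwards [hG.lipschitz] with s h
    exact (h.divergence hWt hWs).symm
  refine hasDerivAt_of_approx (C := M) hA (hG.continuousAt_flux (continuous_deriv_time_slice hW t)
    (hasCompactSupport_deriv_time hW hs t)) fun ε hε => ?_
  filter_upwards [uniform_time_quotient hW hs t hε, hM, hG.lipschitz] with s h1 h2 h3
  have hi : ∀ {F : E3 → E3}, Continuous F →
      IntegrableOn (fun x => inner ℝ (F x) (n s x)) (frontier (G s)) μHE[2] := fun hF =>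
    h3.integrableOn_inner_normal_of_continuousOn hF.continuousOn
  have i1 := hi (contDiff_slice hW s).continuous
  have i2 := hi (contDiff_slice hW t).continuous
  have i3 := hi (continuous_deriv_time_slice hW t)
  rw [integral_sub_sub_const_mul i1 i2 i3]
  simp only [← inner_sub_left, ← real_inner_smul_left]
  refine (h3.abs_flux_le (c := ε * |s - t|) h1).trans ?_
  exact mul_le_mul_of_nonneg_left h2 (by positivity)

end IsRegularMovingDomain

end BulkSurface

namespace BulkSurface

open TensorCalc

/-! ### Tensor calculus -/

lemma app_apply (A : Mat3) (v : E3) (i : Fin 3) : app A v i = ∑ j, A i j * v j := rfl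

lemma app_grad (w : E3 → E3) (x v : E3) : app (grad w x) v = fderiv ℝ w x v := by
  have hv : v = ∑ j, v j • EuclideanSpace.single j (1:ℝ) := by
    ext j; fin_cases j <;> simp [Fin.sum_univ_three]
  conv_rhs => rw [hv, map_sum]
  ext i
  rw [app_apply]
  simp [grad, mul_comm]

lemma grad_eq_of_eventuallyEq {w w' : E3 → E3} {x : E3} (h : w =ᶠ[𝓝 x] w') :
    grad w x = grad w' x := by
  unfold grad; rw [h.fderiv_eq]

lemma dvg_eq_of_eventuallyEq {w w' : E3 → E3} {x : E3} (h : w =ᶠ[𝓝 x] w') :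
    dvg w x = dvg w' x := by
  unfold dvg; rw [grad_eq_of_eventuallyEq h]

lemma inner_eq_sum (v w : E3) : inner ℝ v w = ∑ i, v i * w i := by
  simp [PiLp.inner_apply, mul_comm]

lemma sum_sq_of_norm_eq_one {v : E3} (h : ‖v‖ = 1) : v 0 * v 0 + v 1 * v 1 + v 2 * v 2 = 1 := by
  have h1 := inner_eq_sum v v
  rw [real_inner_self_eq_norm_sq, h, Fin.sum_univ_three] at h1
  linarith

lemma proj_mul_proj {n : E3 → E3} {x : E3} (h : ‖n x‖ = 1) : proj n x * proj n x = proj n x := by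
  have h1 := sum_sq_of_norm_eq_one h
  have h2 : (Matrix.of fun i j => n x i * n x j) * (Matrix.of fun i j => n x i * n x j)
      = Matrix.of fun i j => n x i * n x j := by
    ext i j
    simp only [Matrix.mul_apply, Matrix.of_apply, Fin.sum_univ_three]
    linear_combination (n x i * n x j) * h1
  unfold proj
  rw [mul_sub, sub_mul, sub_mul, h2]
  simp

/-- By cyclicity of the trace and `P² = P`, only one projection remains under the trace. In this
form the surface divergence obeys the usual product rules. -/
lemma surfDvg_eq {n w : E3 → E3} {x : E3} (h : ‖n x‖ = 1) :
    surfDvg n w x = dvg w x - inner ℝ (n x) (fderiv ℝ w x (n x)) := by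
  unfold surfDvg surfGrad dvg
  rw [mul_assoc, Matrix.trace_mul_comm, mul_assoc, proj_mul_proj h, ← app_grad, proj, mul_sub,
    mul_one, Matrix.trace_sub, inner_eq_sum]
  congr 1
  simp only [Matrix.trace, Matrix.diag, Matrix.mul_apply, Matrix.of_apply, app_apply,
    Fin.sum_univ_three]
  ring

lemma fderiv_smul_field {g : E3 → ℝ} {w : E3 → E3} {x : E3} (hg : DifferentiableAt ℝ g x)
    (hw : DifferentiableAt ℝ w x) (v : E3) :
    fderiv ℝ (fun y => g y • w y) x v = g x • fderiv ℝ w x v + fderiv ℝ g x v • w x := by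
  rw [fderiv_fun_smul hg hw]
  simp

lemma dvg_smul {g : E3 → ℝ} {w : E3 → E3} {x : E3} (hg : DifferentiableAt ℝ g x)
    (hw : DifferentiableAt ℝ w x) :
    dvg (fun y => g y • w y) x = g x * dvg w x + fderiv ℝ g x (w x) := by
  have hv : w x = ∑ j, w x j • EuclideanSpace.single j (1:ℝ) := by
    ext j; fin_cases j <;> simp [Fin.sum_univ_three]
  conv_rhs => rw [hv, map_sum]
  simp only [dvg, Matrix.trace, Matrix.diag, grad, Matrix.of_apply, fderiv_smul_field hg hw,
    Finset.mul_sum, ← Finset.sum_add_distrib]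
  simp [mul_comm]

lemma surfDvg_smul {n : E3 → E3} {g : E3 → ℝ} {w : E3 → E3} {x : E3} (h : ‖n x‖ = 1)
    (hg : DifferentiableAt ℝ g x) (hw : DifferentiableAt ℝ w x) :
    surfDvg n (fun y => g y • w y) x = g x * surfDvg n w x + fderiv ℝ g x (w x)
      - inner ℝ (w x) (n x) * fderiv ℝ g x (n x) := by
  rw [surfDvg_eq h, surfDvg_eq h, dvg_smul hg hw, fderiv_smul_field hg hw, inner_add_right,
    inner_smul_right, inner_smul_right, real_inner_comm (n x)]
  ring

/-! ### The divergence theorem on closed surfaces -/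

/-- A bounded domain with a closed boundary surface whose unit normal has a `C¹` extension. -/
structure IsSmoothSurface (G : Set E3) (n : E3 → E3) : Prop extends IsLipschitzDomain G n where
  smooth : ContDiff ℝ 1 n
  unit : ∀ x ∈ frontier G, ‖n x‖ = 1
  tangential : ∀ x ∈ frontier G, ∀ v, inner ℝ v (n x) = 0 → inner ℝ (n x) (fderiv ℝ n x v) = 0

lemma continuous_inner_fderiv {n w : E3 → E3} (hn : Continuous n) (hw : ContDiff ℝ 1 w) :
    Continuous fun x => inner ℝ (n x) (fderiv ℝ w x (n x)) :=
  hn.inner ((hw.continuous_fderiv one_ne_zero).clm_apply hn)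

lemma continuousOn_surfDvg {G : Set E3} {n w : E3 → E3} (hn : IsSmoothSurface G n)
    (hw : ContDiff ℝ 1 w) : ContinuousOn (surfDvg n w) (frontier G) := by
  refine ((continuous_dvg hw).sub
    (continuous_inner_fderiv hn.smooth.continuous hw)).continuousOn.congr fun x hx => ?_
  exact surfDvg_eq (hn.unit x hx)

namespace IsSmoothSurface

variable {G : Set E3} {n : E3 → E3} (hG : IsSmoothSurface G n)
include hG

lemma integrableOn_surfDvg {w : E3 → E3} (hw : ContDiff ℝ 1 w) :
    IntegrableOn (surfDvg n w) (frontier G) μHE[2] :=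
  hG.integrableOn_frontier_of_continuousOn (continuousOn_surfDvg hG hw)

lemma integrableOn_curvature_mul {w : E3 → E3} (hw : Continuous w) :
    IntegrableOn (fun x => curvature n x * inner ℝ (w x) (n x)) (frontier G) μHE[2] :=
  hG.integrableOn_frontier_of_continuousOn ((continuousOn_surfDvg hG hG.smooth).mul
    (hw.inner hG.smooth.continuous).continuousOn)

/-- The **surface divergence theorem** on a closed surface. -/
theorem integral_surfDvg {w : E3 → E3} (hw : ContDiff ℝ 1 w) (hs : HasCompactSupport w) :
    ∫ x in frontier G, surfDvg n w x ∂μHE[2] =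
      ∫ x in frontier G, curvature n x * inner ℝ (w x) (n x) ∂μHE[2] := by
  have hn := hG.smooth
  have hni : ∀ i : Fin 3, ContDiff ℝ 1 fun x => n x i := fun i => by fun_prop
  have hwi : ∀ i : Fin 3, ContDiff ℝ 1 fun x => w x i := fun i => by fun_prop
  have hsi : ∀ i j : Fin 3, HasCompactSupport fun x => n x i * w x j := fun i j =>
    (hs.comp_left (g := fun v : E3 => v j) rfl).mul_left
  have hb : ∀ i j : Fin 3, ContDiff ℝ 1 fun x => n x i * w x j := fun i j => (hni i).mul (hwi j)
  set e : Fin 3 → E3 := fun i => EuclideanSpace.single i 1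
  have hein : ∀ i x, inner ℝ (e i) (n x) = n x i := fun i x => by
    simp [e, EuclideanSpace.inner_single_left]
  have hcomp : ∀ {u : E3 → E3}, ContDiff ℝ 1 u → ∀ x i v,
      fderiv ℝ (fun y => u y i) x v = fderiv ℝ u x v i := fun hu x i v => by
    have h1 := ((EuclideanSpace.proj i : E3 →L[ℝ] ℝ).hasFDerivAt.comp x
      (hu.differentiable one_ne_zero x).hasFDerivAt)
    have h2 : HasFDerivAt (fun y => _) _ x := h1
    exact congrArg (fun A : E3 →L[ℝ] ℝ => A v) h1.fderiv
  have hd : ∀ x i j v, fderiv ℝ (fun y => n y i * w y j) x v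
      = n x i * fderiv ℝ w x v j + w x j * fderiv ℝ n x v i := fun x i j v => by
    rw [fderiv_fun_mul ((hni i).differentiable one_ne_zero x) ((hwi j).differentiable one_ne_zero x)]
    simp [hcomp hn, hcomp hw]
  have hint : ∀ i j a b, IntegrableOn
      (fun x => fderiv ℝ (fun y => n y i * w y j) x (e a) * n x b) (frontier G) μHE[2] :=
    fun i j a b => hG.integrableOn_frontier_of_continuousOn
      ((((hb i j).continuous_fderiv one_ne_zero).clm_apply continuous_const).mul
        (hni b).continuous).continuousOn
  -- This sums `integral_tangential_deriv` for the functions `nᵢ wⱼ` in the directions `eⱼ` and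
  -- `eᵢ`. The difference of the two integrands is `div w - n·∂ₙw - (w·n) div n + n·∂_w n`.
  have key : ∑ i, ∑ j, ∫ x in frontier G,
        fderiv ℝ (fun y => n y i * w y j) x (e j) * n x i ∂μHE[2] =
      ∑ i, ∑ j, ∫ x in frontier G,
        fderiv ℝ (fun y => n y i * w y j) x (e i) * n x j ∂μHE[2] := by
    refine Finset.sum_congr rfl fun i _ => Finset.sum_congr rfl fun j _ => ?_
    have := hG.integral_tangential_deriv (hb i j) (hsi i j) (e j) (e i)
    simpa only [hein] using this
  have hswap : ∀ f : Fin 3 → Fin 3 → E3 → ℝ,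
      (∀ i j, IntegrableOn (f i j) (frontier G) μHE[2]) →
      ∑ i, ∑ j, ∫ x in frontier G, f i j x ∂μHE[2]
        = ∫ x in frontier G, ∑ i, ∑ j, f i j x ∂μHE[2] := fun f hf => by
    rw [integral_finsetSum _ fun i _ => integrable_finsetSum _ fun j _ => hf i j]
    exact Finset.sum_congr rfl fun i _ => (integral_finsetSum _ fun j _ => hf i j).symm
  rw [hswap _ fun i j => hint i j j i, hswap _ fun i j => hint i j i j, ← sub_eq_zero,
    ← integral_sub (integrable_finsetSum _ fun i _ => integrable_finsetSum _ fun j _ => hint i j j i)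
      (integrable_finsetSum _ fun i _ => integrable_finsetSum _ fun j _ => hint i j i j)] at key
  rw [← sub_eq_zero, ← integral_sub (hG.integrableOn_surfDvg hw)
    (hG.integrableOn_curvature_mul hw.continuous), ← key]
  refine setIntegral_congr_fun isClosed_frontier.measurableSet fun x hx => ?_
  have hu := hG.unit x hx
  have hsq := sum_sq_of_norm_eq_one hu
  -- `n` is orthogonal to its derivative along the tangential part of `w`, so `n·∂_w n = (w·n)
  -- n·∂ₙn`. This turns `(w·n) div n` into the curvature term.
  have htan := hG.tangential x hx (w x - inner ℝ (w x) (n x) • n x) (by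
    rw [inner_sub_left, real_inner_smul_left, real_inner_self_eq_norm_sq, hu]; ring)
  rw [map_sub, map_smul, inner_sub_right, inner_smul_right, sub_eq_zero] at htan
  simp only
  rw [curvature, surfDvg_eq hu, surfDvg_eq hu, sub_mul, mul_comm (inner ℝ (n x) _), ← htan]
  have he : ∀ (u : E3 → E3) i j, fderiv ℝ u x (e j) i = grad u x i j := fun _ _ _ => rfl
  simp only [hd, he]
  simp only [dvg, Matrix.trace, Matrix.diag, inner_eq_sum, ← app_grad, app_apply,
    Fin.sum_univ_three]
  linear_combination (-grad w x 0 0 - grad w x 1 1 - grad w x 2 2) * hsq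

end IsSmoothSurface

end BulkSurface

/-! ### Local statements made uniform along a moving domain -/

namespace BulkSurface

namespace IsBoundedMovingDomain

variable {G : ℝ → Set E3} {V : E3 → ℝ} {t : ℝ} (hG : IsBoundedMovingDomain G V t)
include hG

/-- The moving boundary stays close to its position at time `t`. -/
lemma eventually_forall_mem_frontier {P : ℝ → E3 → Prop}
    (h : ∀ x ∈ frontier (G t), ∀ᶠ q : ℝ × E3 in 𝓝 (t, x), P q.1 q.2) :
    ∀ᶠ s in 𝓝 t, ∀ x ∈ frontier (G s), P s x := by
  obtain ⟨B, hB, hGB⟩ := hG.bounded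
  have key : ∀ᶠ s in 𝓝 t, ∀ x ∈ closure B, x ∈ frontier (G s) → P s x := by
    -- Compactness turns neighbourhoods in space-time into a uniform time interval. Near a point off
    -- the boundary at time `t` the domain is locally constant, so no boundary point appears there
    -- at nearby times.
    refine hB.isCompact_closure.eventually_forall_of_forall_eventually fun x _ => ?_
    by_cases hx : x ∈ frontier (G t)
    · filter_upwards [h x hx] with q hq _ using hq
    · filter_upwards [(hG.locally_const x hx).eventually_nhds] with q hq hfr
      have hc : Tendsto (fun y : E3 => (q.1, y)) (𝓝 q.2) (𝓝 q) :=
        (by fun_prop : Continuous fun y : E3 => (q.1, y)).tendsto q.2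
      have hq' : ∀ᶠ y in 𝓝 q.2, (y ∈ G q.1 ↔ x ∈ G t) := hc.eventually hq
      by_cases hxG : x ∈ G t
      · exact absurd (mem_interior_iff_mem_nhds.2 (hq'.mono fun y hy => hy.2 hxG)) hfr.2
      · obtain ⟨y, hy1, hy2⟩ :=
          ((mem_closure_iff_frequently.1 hfr.1).and_eventually hq').exists
        exact absurd (hy2.1 hy1) hxG
  filter_upwards [key, hGB] with s h1 h2 x hx
  exact h1 x (closure_mono h2 hx.1) hx

/-- The moving domain stays close to its position at time `t`. -/
lemma eventually_forall_mem {P : ℝ → E3 → Prop}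
    (h : ∀ x ∈ closure (G t), ∀ᶠ q : ℝ × E3 in 𝓝 (t, x), P q.1 q.2) :
    ∀ᶠ s in 𝓝 t, ∀ x ∈ G s, P s x := by
  obtain ⟨B, hB, hGB⟩ := hG.bounded
  have key : ∀ᶠ s in 𝓝 t, ∀ x ∈ closure B, x ∈ G s → P s x := by
    refine hB.isCompact_closure.eventually_forall_of_forall_eventually fun x _ => ?_
    by_cases hx : x ∈ closure (G t)
    · filter_upwards [h x hx] with q hq _ using hq
    · filter_upwards [hG.locally_const x fun h' => hx h'.1] with q hq hm
      exact absurd (subset_closure (hq.1 hm)) hx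
  filter_upwards [key, hGB] with s h1 h2 x hx
  exact h1 x (subset_closure (h2 hx)) hx

end IsBoundedMovingDomain

lemma integral_add_add_sub {α : Type*} {_ : MeasurableSpace α} {μ : Measure α}
    {a b c d : α → ℝ} (ha : Integrable a μ) (hb : Integrable b μ) (hc : Integrable c μ)
    (hd : Integrable d μ) :
    ∫ x, a x ∂μ + ∫ x, b x ∂μ + (∫ x, c x ∂μ - ∫ x, d x ∂μ)
      = ∫ x, (a x + b x + (c x - d x)) ∂μ := by
  rw [← integral_add ha hb, ← integral_sub hc hd]
  exact (integral_add (ha.add hb) (hc.sub hd)).symm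

lemma graphMap_mem_frontier {G : Set E3} {L : E3 ≃ₗᵢ[ℝ] E3} {γ : E2 → ℝ} (hγ : Continuous γ)
    {y : E2} (h : ∀ᶠ x in 𝓝 (graphMap L γ y), (x ∈ G ↔ x ∈ subgraph L γ)) :
    graphMap L γ y ∈ frontier G := by
  obtain ⟨V, hVs, hVo, hzV⟩ := mem_nhds_iff.1 h
  exact ((frontier_inter_of_forall_mem_iff hVo fun z hz => hVs hz).symm.subset
    ⟨(frontier_subgraph L hγ).symm.subset ⟨y, rfl⟩, hzV⟩).1

end BulkSurface

/-! ### The normal field of the interface and transport of surface integrals -/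

namespace TwoPhaseFlow.IsInterface

open BulkSurface TensorCalc

variable {S : TwoPhaseFlow} {t : ℝ} (hS : S.IsInterface) (ht : t ∈ Ioo 0 S.T)
include hS ht

lemma isBoundedMovingDomain (hb : Bornology.IsBounded S.Ω) :
    IsBoundedMovingDomain S.Ωm (S.UN t) t :=
  { hS.isMovingDomain ht with
    bounded := ⟨S.Ω, hb, by
      filter_upwards [Ioo_mem_nhds ht.1 ht.2] with s hs using
        subset_closure.trans (hS.internal s ⟨hs.1.le, hs.2.le⟩)⟩ }

omit hS ht in
lemma isCompact_Γ (hb : Bornology.IsBounded S.Ω) (h : closure (S.Ωm t) ⊆ S.Ω) :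
    IsCompact (S.Γ t) :=
  (hb.subset (subset_closure.trans h)).isCompact_closure.of_isClosed_subset isClosed_frontier
    frontier_subset_closure

/-- The unit normal near the interface, extended to all of space-time. -/
lemma exists_normal_ext (hb : Bornology.IsBounded S.Ω) :
    ∃ N : ℝ → E3 → E3, ContDiff ℝ 1 (Function.uncurry N) ∧
      HasCompactSupport (Function.uncurry N) ∧
      ∀ x ∈ S.Γ t, ∀ᶠ q : ℝ × E3 in 𝓝 (t, x), N q.1 q.2 = S.n q.1 q.2 := by
  have hK : IsCompact (({t} : Set ℝ) ×ˢ S.Γ t) :=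
    isCompact_singleton.prod (isCompact_Γ hb (hS.internal t ⟨ht.1.le, ht.2.le⟩))
  obtain ⟨N, h1, h2, h3⟩ := exists_extension (n := 1) hK (f := Function.uncurry S.n) (by
    rintro ⟨s, x⟩ ⟨hs, hx⟩
    have hs' : s = t := hs
    subst hs'
    exact hS.normal_C1 _ ht x hx)
  refine ⟨fun s x => N (s, x), h1, h2, fun x hx => ?_⟩
  exact eventually_nhdsSet_iff_forall.1 h3 (t, x) ⟨rfl, hx⟩

lemma isRegularMovingDomain (hb : Bornology.IsBounded S.Ω) :
    IsRegularMovingDomain S.Ωm (S.UN t) S.n t :=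
  { hS.isBoundedMovingDomain ht hb with
    lipschitz := by
      filter_upwards [Ioo_mem_nhds ht.1 ht.2] with s hs using hS.isLipschitzDomain hs hb
    normal_ext := by
      obtain ⟨N, h1, h2, h3⟩ := hS.exists_normal_ext ht hb
      exact ⟨N, h1, h2, (hS.isBoundedMovingDomain ht hb).eventually_forall_mem_frontier
        (P := fun s x => N s x = S.n s x) h3⟩ }

omit hS ht in
lemma tendsto_slice (x : E3) : Tendsto (fun y : E3 => (t, y)) (𝓝 x) (𝓝 (t, x)) :=
  (by fun_prop : Continuous fun y : E3 => (t, y)).tendsto x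

lemma differentiableAt_n {x : E3} (hx : x ∈ S.Γ t) : DifferentiableAt ℝ (S.n t) x :=
  ((hS.normal_C1 t ht x hx).differentiableAt one_ne_zero).comp x
    (by fun_prop : DifferentiableAt ℝ (fun y : E3 => (t, y)) x)

/-- The normal is orthogonal to its tangential derivatives. -/
lemma inner_fderiv_normal_eq_zero {x : E3} (hx : x ∈ S.Γ t) {v : E3}
    (hv : inner ℝ v (S.n t x) = 0) : inner ℝ (S.n t x) (fderiv ℝ (S.n t) x v) = 0 := by
  obtain ⟨L, K, γ, hγ, hev, hdiff⟩ := hS.exists_chart ht hx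
  have hγc : Continuous (γ t) := hγ.continuous.comp (by fun_prop : Continuous fun y : E2 => (t, y))
  have hev' : ∀ᶠ z in 𝓝 x, (z ∈ S.Ωm t ↔ z ∈ subgraph L (γ t)) :=
    (tendsto_slice x).eventually hev
  obtain ⟨V, hVs, hVo, hxV⟩ := mem_nhds_iff.1 hev'
  obtain ⟨y, hy⟩ := (frontier_subgraph L hγc).subset
    ((frontier_inter_of_forall_mem_iff hVo fun z hz => hVs hz).subset ⟨hx, hxV⟩).1
  have hby : base (L x) = y := by rw [← hy]; simp [graphMap]
  have hd : DifferentiableAt ℝ (γ t) y := by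
    have := hdiff.self_of_nhds
    rw [hby] at this
    exact this.comp y (by fun_prop : DifferentiableAt ℝ (fun y : E2 => (t, y)) y)
  have hn : S.n t x = graphNormal L (γ t) y := by
    rw [← hy] at hev' hx ⊢
    exact (hS.normal t ht _ hx).unique (isOutwardUnitNormal_graphNormal hγc hd hev')
  have hLv : L v 2 = fderiv ℝ (γ t) y (base (L v)) := by
    have := norm_mul_inner_graphNormal L (γ t) y v
    rw [← hn, hv, mul_zero] at this
    linarith
  have hgr : HasFDerivAt (graphMap L (γ t)) ((L.symm.toContinuousLinearEquiv : E3 →L[ℝ] E3).comp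
      ((coordEquiv : E2 × ℝ →L[ℝ] E3).comp
        ((ContinuousLinearMap.id ℝ E2).prod (fderiv ℝ (γ t) y)))) y :=
    (L.symm.toContinuousLinearEquiv : E3 →L[ℝ] E3).hasFDerivAt.comp y
      ((coordEquiv : E2 × ℝ →L[ℝ] E3).hasFDerivAt.comp y
        ((hasFDerivAt_id y).prodMk hd.hasFDerivAt))
  -- Since `v` is tangential, lifting a straight line in the plane to the graph gives a curve on the
  -- interface with velocity `v`. The extended normal has unit length along this curve, and
  -- differentiating `n·n = 1` gives the claim.
  have hcurve : HasDerivAt (fun s : ℝ => graphMap L (γ t) (y + s • base (L v))) v 0 := by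
    have hline : HasDerivAt (fun s : ℝ => y + s • base (L v)) (base (L v)) 0 := by
      simpa using ((hasDerivAt_id (0:ℝ)).smul_const (base (L v))).const_add y
    have h0 : y + (0:ℝ) • base (L v) = y := by simp
    have := HasFDerivAt.comp_hasDerivAt (0:ℝ) (by rw [h0]; exact hgr) hline
    refine this.congr_deriv ?_
    have e : lift (base (L v)) (fderiv ℝ (γ t) y (base (L v))) = L v := by
      rw [← hLv, lift_base]
    change L.symm (lift (base (L v)) (fderiv ℝ (γ t) y (base (L v)))) = v
    rw [e, L.symm_apply_apply]
  have h0 : graphMap L (γ t) (y + (0:ℝ) • base (L v)) = x := by simp [hy]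
  have hnc : HasDerivAt (fun s : ℝ => S.n t (graphMap L (γ t) (y + s • base (L v))))
      (fderiv ℝ (S.n t) x v) 0 := by
    have hnd := (hS.differentiableAt_n ht hx).hasFDerivAt
    exact HasFDerivAt.comp_hasDerivAt (0:ℝ) (by rw [h0]; exact hnd) hcurve
  have hone : ∀ᶠ s in 𝓝 (0:ℝ), inner ℝ (S.n t (graphMap L (γ t) (y + s • base (L v))))
      (S.n t (graphMap L (γ t) (y + s • base (L v)))) = (1:ℝ) := by
    have hct := hcurve.continuousAt.tendsto
    rw [h0] at hct
    filter_upwards [hct.eventually hev'.eventually_nhds] with s hs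
    rw [real_inner_self_eq_norm_sq, (hS.normal t ht _ (graphMap_mem_frontier hγc hs)).1, one_pow]
  have hz := (hnc.inner ℝ hnc).unique ((hasDerivAt_const (0:ℝ) (1:ℝ)).congr_of_eventuallyEq hone)
  rw [h0, real_inner_comm (S.n t x)] at hz
  linarith

/-- The normal is orthogonal to its derivative along the moving interface. -/
lemma inner_deriv_normal_eq_zero {x : E3} (hx : x ∈ S.Γ t) :
    inner ℝ (S.n t x) (deriv (fun s => S.n s x) t)
      + S.UN t x * inner ℝ (S.n t x) (fderiv ℝ (S.n t) x (S.n t x)) = 0 := by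
  obtain ⟨x0, hx0, hxz⟩ := (hS.lagrange_bij t ⟨ht.1.le, ht.2.le⟩).surjOn hx
  have hc := hS.lagrange_ode x0 hx0 t ht
  rw [hxz] at hc
  set D := fderiv ℝ (Function.uncurry S.n) (t, x)
  have hD : HasFDerivAt (Function.uncurry S.n) D (t, x) :=
    ((hS.normal_C1 t ht x hx).differentiableAt one_ne_zero).hasFDerivAt
  have h1 : HasDerivAt (fun s => S.n s (S.Ψ s x0)) (D (1, S.UN t x • S.n t x)) t :=
    HasFDerivAt.comp_hasDerivAt (l := Function.uncurry S.n) (f := fun s => (s, S.Ψ s x0)) t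
      (by rw [hxz]; exact hD) ((hasDerivAt_id t).prodMk hc)
  have h2 : deriv (fun s => S.n s x) t = D (1, 0) :=
    (HasFDerivAt.comp_hasDerivAt (l := Function.uncurry S.n) (f := fun s : ℝ => (s, x)) t
      hD ((hasDerivAt_id t).prodMk (hasDerivAt_const t x))).deriv
  have h3 : HasFDerivAt (S.n t) (D.comp (ContinuousLinearMap.inr ℝ ℝ E3)) x :=
    hD.comp x (hasFDerivAt_prodMk_right t x)
  -- The trajectory stays on the interface, the only place where the extended normal is known to
  -- have unit length.
  have hone : ∀ᶠ s in 𝓝 t, inner ℝ (S.n s (S.Ψ s x0)) (S.n s (S.Ψ s x0)) = (1:ℝ) := by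
    filter_upwards [Ioo_mem_nhds ht.1 ht.2] with s hs
    have hmem := (hS.lagrange_bij s ⟨hs.1.le, hs.2.le⟩).mapsTo hx0
    rw [real_inner_self_eq_norm_sq, (hS.normal s hs _ hmem).1, one_pow]
  have hz := (h1.inner ℝ h1).unique ((hasDerivAt_const t (1:ℝ)).congr_of_eventuallyEq hone)
  rw [hxz, real_inner_comm (S.n t x) (D _)] at hz
  have e1 : D (1, S.UN t x • S.n t x) = D (1, 0) + S.UN t x • D (0, S.n t x) := by
    rw [← map_smul, ← map_add]; simp
  rw [e1, inner_add_right, inner_smul_right] at hz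
  rw [h2, h3.fderiv]
  change inner ℝ (S.n t x) (D (1, 0)) + S.UN t x * inner ℝ (S.n t x) (D (0, S.n t x)) = 0
  linarith

section Extended

variable (hb : Bornology.IsBounded S.Ω) {N : ℝ → E3 → E3}
  (hN : ContDiff ℝ 1 (Function.uncurry N))
  (hNn : ∀ x ∈ S.Γ t, ∀ᶠ q : ℝ × E3 in 𝓝 (t, x), N q.1 q.2 = S.n q.1 q.2)

omit hS ht in
include hNn in
lemma ext_eventuallyEq {x : E3} (hx : x ∈ S.Γ t) : N t =ᶠ[𝓝 x] S.n t :=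
  ((by fun_prop : Continuous fun y : E3 => (t, y)).tendsto x).eventually (hNn x hx)

omit hS ht in
include hNn in
lemma ext_time_eventuallyEq {x : E3} (hx : x ∈ S.Γ t) :
    (fun s => N s x) =ᶠ[𝓝 t] fun s => S.n s x :=
  ((by fun_prop : Continuous fun s : ℝ => (s, x)).tendsto t).eventually (hNn x hx)

include hb hN hNn

lemma isSmoothSurface : IsSmoothSurface (S.Ωm t) (N t) := by
  have heq : ∀ x ∈ S.Γ t, N t x = S.n t x := fun x hx => (ext_eventuallyEq hNn hx).self_of_nhds
  have hL := hS.isLipschitzDomain ht hb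
  refine { hL with
    normal := ?_
    smooth := contDiff_slice hN t
    unit := fun x hx => ?_
    tangential := fun x hx v hv => ?_ }
  · filter_upwards [hL.normal, ae_restrict_mem isClosed_frontier.measurableSet] with x h1 h2
    rwa [heq x h2]
  · rw [heq x hx]; exact (hS.normal t ht x hx).1
  · rw [heq x hx] at hv ⊢
    rw [(ext_eventuallyEq hNn hx).fderiv_eq]
    exact hS.inner_fderiv_normal_eq_zero ht hx hv

/-- Transport of surface integrals with the moving interface. -/
theorem hasDerivAt_surface (hNs : HasCompactSupport (Function.uncurry N)) {g : ℝ → E3 → ℝ}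
    (hg : ContDiff ℝ 1 (Function.uncurry g)) {w : E3 → E3} (hw : ContDiff ℝ 1 w)
    (hgs : HasCompactSupport (Function.uncurry g))
    (hwn : ∀ x ∈ S.Γ t, inner ℝ (w x) (N t x) = S.UN t x)
    (hdiv : ∀ x ∈ S.Γ t, surfDvg (N t) w x = 0) :
    HasDerivAt (fun s => ∫ x in S.Γ s, g s x ∂μHE[2])
      (∫ x in S.Γ t, (deriv (fun s => g s x) t + fderiv ℝ (g t) x (w x)) ∂μHE[2]) t := by
  have hR := hS.isRegularMovingDomain ht hb
  have hSS := hS.isSmoothSurface ht hb hN hNn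
  -- On the interface `g = (g n)·n`, so the surface integral is the flux of `g N`.
  set W : ℝ → E3 → E3 := fun s x => g s x • N s x
  have hW : ContDiff ℝ 1 (Function.uncurry W) := hg.smul hN
  have hWs : HasCompactSupport (Function.uncurry W) := hNs.smul_left (f := Function.uncurry g)
  have hflux := hR.hasDerivAt_flux hW hWs
  have heq := hR.eventually_forall_mem_frontier (P := fun s x => N s x = S.n s x) hNn
  have hLHS : (fun s => ∫ x in S.Γ s, g s x ∂μHE[2]) =ᶠ[𝓝 t]
      fun s => ∫ x in frontier (S.Ωm s), inner ℝ (W s x) (S.n s x) ∂μHE[2] := by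
    filter_upwards [heq, Ioo_mem_nhds ht.1 ht.2] with s h1 h2
    refine setIntegral_congr_fun isClosed_frontier.measurableSet fun x hx => ?_
    simp only [W]
    rw [h1 x hx, real_inner_smul_left, real_inner_self_eq_norm_sq, (hS.normal s h2 x hx).1]
    ring
  have hgt := contDiff_slice hg t
  have hgw : ContDiff ℝ 1 fun x => g t x • w x := hgt.smul hw
  -- Adding this vanishing difference replaces transport along the normal by transport along `w`:
  -- the divergence of `N` cancels against the curvature, and the normal derivative of `g` cancels
  -- as well. What remains besides the material derivative is `g` times the expression in
  -- `inner_deriv_normal_eq_zero`.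
  have hsd := hSS.integral_surfDvg hgw ((hasCompactSupport_slice hgs t).smul_right)
  have i1 := (hR.transport (continuous_dvg (contDiff_slice hW t))
    (hasCompactSupport_dvg (hasCompactSupport_slice hWs t))).1
  have i2 := hSS.integrableOn_inner_normal_of_continuousOn
    (continuous_deriv_time_slice hW t).continuousOn
  have hNt : ∀ x ∈ S.Γ t, N t x = S.n t x := fun x hx => (ext_eventuallyEq hNn hx).self_of_nhds
  have i2' : IntegrableOn (fun x => inner ℝ (deriv (fun r => W r x) t) (S.n t x))
      (frontier (S.Ωm t)) μHE[2] := by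
    refine i2.congr_fun (fun x hx => ?_) isClosed_frontier.measurableSet
    simp only [hNt x hx]
  have i3 := hSS.integrableOn_surfDvg hgw
  have i4 := hSS.integrableOn_curvature_mul hgw.continuous
  refine (hflux.congr_of_eventuallyEq hLHS).congr_deriv ?_
  rw [← sub_eq_zero] at hsd
  rw [← add_zero (_ + _), ← hsd, integral_add_add_sub i1 i2' i3 i4]
  refine setIntegral_congr_fun isClosed_frontier.measurableSet fun x hx => ?_
  have hu : ‖N t x‖ = 1 := hSS.unit x hx
  have hgd := hgt.differentiable one_ne_zero x
  have hNd := (contDiff_slice hN t).differentiable one_ne_zero x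
  have hWt : deriv (fun r => W r x) t
      = g t x • deriv (fun s => N s x) t + deriv (fun s => g s x) t • N t x :=
    ((hasDerivAt_time hg t x).differentiableAt.hasDerivAt.smul
      (hasDerivAt_time hN t x).differentiableAt.hasDerivAt).deriv
  have hder := hS.inner_deriv_normal_eq_zero ht hx
  rw [← hNt x hx, ← (ext_eventuallyEq hNn hx).fderiv_eq,
    ← (ext_time_eventuallyEq hNn hx).deriv_eq] at hder
  have hdW : dvg (W t) x = _ := dvg_smul hgd hNd
  rw [hdW, hWt, ← hNt x hx, surfDvg_smul hu hgd (hw.differentiable one_ne_zero x), hdiv x hx,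
    curvature, surfDvg_eq hu, inner_add_left, real_inner_smul_left, real_inner_smul_left,
    real_inner_smul_left, hwn x hx, real_inner_self_eq_norm_sq, hu,
    real_inner_comm (N t x) (deriv _ t)]
  linear_combination (g t x) * hder

end Extended

end TwoPhaseFlow.IsInterface

namespace BulkSurface

open TensorCalc

/-! ### Calculus of tensor fields -/

lemma contDiff_grad {w : E3 → E3} (hw : ContDiff ℝ 2 w) (i j : Fin 3) :
    ContDiff ℝ 1 fun x => grad w x i j := by
  have h : ContDiff ℝ 1 fun x => fderiv ℝ w x (EuclideanSpace.single j 1) :=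
    (hw.fderiv_right (m := 1) (by norm_num)).clm_apply contDiff_const
  exact (EuclideanSpace.proj i : E3 →L[ℝ] ℝ).contDiff.comp h

lemma contDiff_strain {w : E3 → E3} (hw : ContDiff ℝ 2 w) (i j : Fin 3) :
    ContDiff ℝ 1 fun x => strain w x i j := by
  simp only [strain, Matrix.smul_apply, Matrix.add_apply, Matrix.transpose_apply, smul_eq_mul]
  exact contDiff_const.mul ((contDiff_grad hw i j).add (contDiff_grad hw j i))

lemma contDiff_stress {mu : ℝ} {p : E3 → ℝ} {w : E3 → E3} (hp : ContDiff ℝ 1 p)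
    (hw : ContDiff ℝ 2 w) (i j : Fin 3) : ContDiff ℝ 1 fun x => stress mu p w x i j := by
  simp only [stress, Matrix.smul_apply, Matrix.add_apply, smul_eq_mul]
  exact (hp.neg.mul contDiff_const).add (contDiff_const.mul (contDiff_strain hw i j))

lemma contDiff_proj {n : E3 → E3} (hn : ContDiff ℝ 1 n) (i j : Fin 3) :
    ContDiff ℝ 1 fun x => proj n x i j := by
  simp only [proj, Matrix.sub_apply, Matrix.of_apply]
  exact contDiff_const.sub (by fun_prop)

lemma contDiff_mul_apply {A B : E3 → Mat3} (hA : ∀ i j, ContDiff ℝ 1 fun x => A x i j)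
    (hB : ∀ i j, ContDiff ℝ 1 fun x => B x i j) (i j : Fin 3) :
    ContDiff ℝ 1 fun x => (A x * B x) i j := by
  simp only [Matrix.mul_apply]
  exact ContDiff.sum fun k _ => (hA i k).mul (hB k j)

lemma contDiff_surfGrad {n w : E3 → E3} (hn : ContDiff ℝ 1 n) (hw : ContDiff ℝ 2 w)
    (i j : Fin 3) : ContDiff ℝ 1 fun x => surfGrad n w x i j :=
  contDiff_mul_apply (contDiff_mul_apply (contDiff_proj hn) (contDiff_grad hw))
    (contDiff_proj hn) i j

lemma contDiff_surfStrain {n w : E3 → E3} (hn : ContDiff ℝ 1 n) (hw : ContDiff ℝ 2 w)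
    (i j : Fin 3) : ContDiff ℝ 1 fun x => surfStrain n w x i j := by
  simp only [surfStrain, Matrix.smul_apply, Matrix.add_apply, Matrix.transpose_apply, smul_eq_mul]
  exact contDiff_const.mul ((contDiff_surfGrad hn hw i j).add (contDiff_surfGrad hn hw j i))

lemma contDiff_row {A : E3 → Mat3} (hA : ∀ i j, ContDiff ℝ 1 fun x => A x i j) (i : Fin 3) :
    ContDiff ℝ 1 (row A i) :=
  contDiff_euclidean.2 fun j => hA i j

lemma continuous_normSq {A : E3 → Mat3} (hA : ∀ i j, ContDiff ℝ 1 fun x => A x i j) :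
    Continuous fun x => normSq (A x) :=
  continuous_finsetSum _ fun i _ => continuous_finsetSum _ fun j _ => (hA i j).continuous.pow 2

lemma continuousOn_app {K : Set E3} {A : E3 → Mat3} {w : E3 → E3}
    (hA : ∀ i j, ContinuousOn (fun x => A x i j) K) (hw : ContinuousOn w K) :
    ContinuousOn (fun x => app (A x) (w x)) K := by
  refine (PiLp.continuous_toLp 2 _).comp_continuousOn (continuousOn_pi.2 fun i => ?_)
  have : (fun x => (A x).mulVec (w x).ofLp i) = fun x => ∑ j, A x i j * w x j := rfl
  rw [this]
  exact continuousOn_finsetSum _ fun j _ => (hA i j).mul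
    ((EuclideanSpace.proj j : E3 →L[ℝ] ℝ).continuous.comp_continuousOn hw)

lemma transpose_strain (w : E3 → E3) (x : E3) : (strain w x).transpose = strain w x := by
  rw [strain, Matrix.transpose_smul, Matrix.transpose_add, Matrix.transpose_transpose, add_comm]

lemma transpose_stress (mu : ℝ) (p : E3 → ℝ) (w : E3 → E3) (x : E3) :
    (stress mu p w x).transpose = stress mu p w x := by
  rw [stress, Matrix.transpose_add, Matrix.transpose_smul, Matrix.transpose_smul,
    Matrix.transpose_one, transpose_strain]

lemma transpose_surfStrain (n w : E3 → E3) (x : E3) :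
    (surfStrain n w x).transpose = surfStrain n w x := by
  rw [surfStrain, Matrix.transpose_smul, Matrix.transpose_add, Matrix.transpose_transpose,
    add_comm]

lemma inner_app_comm {A : Mat3} (hA : A.transpose = A) (v w : E3) :
    inner ℝ (app A v) w = inner ℝ v (app A w) := by
  have h : ∀ i j, A i j = A j i := fun i j => congrFun (congrFun hA j) i
  simp only [inner_eq_sum, app_apply, Fin.sum_univ_three]
  linear_combination (v 1 * w 0) * h 0 1 + (v 2 * w 0) * h 0 2 + (v 0 * w 1) * h 1 0
    + (v 2 * w 1) * h 1 2 + (v 0 * w 2) * h 2 0 + (v 1 * w 2) * h 2 1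

lemma transpose_proj (n : E3 → E3) (x : E3) : (proj n x).transpose = proj n x := by
  rw [proj, Matrix.transpose_sub, Matrix.transpose_one]
  congr 1
  ext i j
  simp [mul_comm]

lemma app_proj (n : E3 → E3) (x v : E3) : app (proj n x) v = v - inner ℝ v (n x) • n x := by
  ext i
  simp only [app_apply, proj, Matrix.sub_apply, Matrix.of_apply, sub_mul, Finset.sum_sub_distrib,
    Matrix.one_apply, ite_mul, one_mul, zero_mul, Finset.sum_ite_eq, Finset.mem_univ, if_true,
    inner_eq_sum, PiLp.sub_apply, PiLp.smul_apply, smul_eq_mul, Finset.sum_mul]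
  congr 1
  exact Finset.sum_congr rfl fun j _ => by ring

lemma app_sum_row {A : E3 → Mat3} {x : E3} (hA : (A x).transpose = A x) (v : E3) :
    app (A x) v = ∑ i, v i • row A i x := by
  ext j
  have h : ∀ i, A x j i = A x i j := fun i => congrFun (congrFun hA i) j
  simp [app_apply, row, h, mul_comm]

lemma dvg_add {v w : E3 → E3} {x : E3} (hv : DifferentiableAt ℝ v x)
    (hw : DifferentiableAt ℝ w x) : dvg (fun y => v y + w y) x = dvg v x + dvg w x := by
  simp [dvg, Matrix.trace, grad, fderiv_fun_add hv hw, Finset.sum_add_distrib]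

lemma dvg_sub {v w : E3 → E3} {x : E3} (hv : DifferentiableAt ℝ v x)
    (hw : DifferentiableAt ℝ w x) : dvg (fun y => v y - w y) x = dvg v x - dvg w x := by
  simp [dvg, Matrix.trace, grad, fderiv_fun_sub hv hw, Finset.sum_sub_distrib]

lemma dvg_sum {v : Fin 3 → E3 → E3} {x : E3} (hv : ∀ i, DifferentiableAt ℝ (v i) x) :
    dvg (fun y => ∑ i, v i y) x = ∑ i, dvg (v i) x := by
  simp only [Fin.sum_univ_three]
  rw [dvg_add (v := fun y => v 0 y + v 1 y) ((hv 0).add (hv 1)) (hv 2), dvg_add (hv 0) (hv 1)]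

lemma fderiv_apply_coord {w : E3 → E3} {x : E3} (hw : DifferentiableAt ℝ w x) (i : Fin 3)
    (v : E3) : fderiv ℝ (fun y => w y i) x v = ∑ j, grad w x i j * v j := by
  have h := ((EuclideanSpace.proj i : E3 →L[ℝ] ℝ).hasFDerivAt.comp x hw.hasFDerivAt).fderiv
  have h' : (fun y => w y i) = (EuclideanSpace.proj i : E3 →L[ℝ] ℝ) ∘ w := rfl
  rw [h', h, ← app_apply, app_grad]
  rfl

/-- The double contraction `A : B`. -/
def contraction (A B : Mat3) : ℝ := ∑ i, ∑ j, A i j * B i j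

lemma contraction_eq_trace (A B : Mat3) : contraction A B = (A.transpose * B).trace := by
  simp only [contraction, Matrix.trace, Matrix.diag, Matrix.mul_apply, Matrix.transpose_apply]
  exact Finset.sum_comm

lemma normSq_eq_contraction (A : Mat3) : normSq A = contraction A A := by
  simp only [normSq, contraction, sq]

lemma differentiableAt_row {A : E3 → Mat3} (hA : ∀ i j, ContDiff ℝ 1 fun x => A x i j)
    (i : Fin 3) (x : E3) : DifferentiableAt ℝ (row A i) x :=
  (contDiff_row hA i).differentiable one_ne_zero x

lemma dvg_app {A : E3 → Mat3} {w : E3 → E3} (hA : ∀ i j, ContDiff ℝ 1 fun x => A x i j)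
    (hs : ∀ x, (A x).transpose = A x) (hw : ContDiff ℝ 1 w) (x : E3) :
    dvg (fun y => app (A y) (w y)) x
      = inner ℝ (w x) (dvgT A x) + contraction (A x) (grad w x) := by
  have hwd := hw.differentiable one_ne_zero
  have hwi : ∀ i, DifferentiableAt ℝ (fun y => w y i) x := fun i => by fun_prop
  have e : (fun y => app (A y) (w y)) = fun y => ∑ i, w y i • row A i y := by
    funext y; exact app_sum_row (hs y) (w y)
  rw [e, dvg_sum (v := fun i y => w y i • row A i y) fun i =>
    (hwi i).smul (differentiableAt_row hA i x)]
  simp only [dvg_smul (hwi _) (differentiableAt_row hA _ x), Finset.sum_add_distrib,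
    fderiv_apply_coord (hwd x), inner_eq_sum, contraction]
  congr 1
  exact Finset.sum_congr rfl fun i _ => Finset.sum_congr rfl fun j _ => mul_comm _ _

/-- As `A` is symmetric and `A n = 0`, its rows are tangential. The normal derivative in
`surfDvg_smul` therefore drops out, and the contraction may use the full gradient of `w`. -/
lemma surfDvg_app {n : E3 → E3} {A : E3 → Mat3} {w : E3 → E3}
    (hA : ∀ i j, ContDiff ℝ 1 fun x => A x i j) (hs : ∀ x, (A x).transpose = A x)
    (hw : ContDiff ℝ 1 w) {x : E3} (hn : ‖n x‖ = 1) (h0 : app (A x) (n x) = 0) :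
    surfDvg n (fun y => app (A y) (w y)) x
      = inner ℝ (w x) (surfDvgT n A x) + contraction (A x) (grad w x) := by
  have hwd := hw.differentiable one_ne_zero
  have hwi : ∀ i, DifferentiableAt ℝ (fun y => w y i) x := fun i => by fun_prop
  have e : (fun y => app (A y) (w y)) = fun y => ∑ i, w y i • row A i y := by
    funext y; exact app_sum_row (hs y) (w y)
  have hd : ∀ i, DifferentiableAt ℝ (fun y => w y i • row A i y) x := fun i =>
    (hwi i).smul (differentiableAt_row hA i x)
  have hzero : ∀ i, inner ℝ (row A i x) (n x) = 0 := fun i => by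
    have := congrArg (fun v : E3 => v i) h0
    simpa [app_apply, inner_eq_sum, row] using this
  have hsum : surfDvg n (fun y => ∑ i, w y i • row A i y) x
      = ∑ i, surfDvg n (fun y => w y i • row A i y) x := by
    simp only [surfDvg_eq hn, dvg_sum hd, Finset.sum_sub_distrib]
    rw [fderiv_fun_sum fun i _ => hd i]
    simp [inner_sum]
  rw [e, hsum]
  simp only [surfDvg_smul hn (hwi _) (differentiableAt_row hA _ x), hzero, zero_mul, sub_zero,
    Finset.sum_add_distrib, fderiv_apply_coord (hwd x), inner_eq_sum, contraction]
  congr 1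
  exact Finset.sum_congr rfl fun i _ => Finset.sum_congr rfl fun j _ => mul_comm _ _

lemma contraction_stress (mu : ℝ) (p : E3 → ℝ) (w : E3 → E3) (x : E3) :
    contraction (stress mu p w x) (grad w x)
      = -(p x) * dvg w x + 2 * mu * normSq (strain w x) := by
  simp only [contraction, stress, strain, normSq, dvg, Matrix.trace, Matrix.diag,
    Matrix.smul_apply, Matrix.add_apply, Matrix.transpose_apply, Matrix.one_apply,
    Fin.sum_univ_three, smul_eq_mul]
  simp
  ring

lemma app_surfStrain_normal {n w : E3 → E3} {x : E3} (hn : ‖n x‖ = 1) :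
    app (surfStrain n w x) (n x) = 0 := by
  have hP : (proj n x).mulVec (n x).ofLp = 0 := by
    have h := app_proj n x (n x)
    rw [real_inner_self_eq_norm_sq, hn] at h
    have h2 := congrArg WithLp.ofLp h
    simpa [app] using h2
  unfold app surfStrain surfGrad
  rw [Matrix.transpose_mul, Matrix.transpose_mul, transpose_proj, Matrix.smul_mulVec,
    Matrix.add_mulVec, ← Matrix.mulVec_mulVec, hP, ← Matrix.mulVec_mulVec, ← Matrix.mulVec_mulVec,
    ← Matrix.mulVec_mulVec, hP]
  simp

/-- `D_Γ` is symmetric and satisfies `P D_Γ P = D_Γ`, so contracting with `∇w` sees only the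
symmetric part of `P ∇w P`. -/
lemma contraction_surfStrain {n w : E3 → E3} {x : E3} (hn : ‖n x‖ = 1) :
    contraction (surfStrain n w x) (grad w x) = normSq (surfStrain n w x) := by
  have hP := proj_mul_proj hn
  have hPt := transpose_proj n x
  rw [normSq_eq_contraction, contraction_eq_trace, contraction_eq_trace, transpose_surfStrain]
  set P := proj n x
  set H := grad w x
  have hA : surfStrain n w x = (1 / 2 : ℝ) • (P * H * P + P * H.transpose * P) := by
    rw [surfStrain, surfGrad, Matrix.transpose_mul, Matrix.transpose_mul, hPt, mul_assoc P H.transpose]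
  have h1 : P * surfStrain n w x * P = surfStrain n w x := by
    rw [hA, mul_smul_comm, smul_mul_assoc, mul_add, add_mul]
    congr 2
    · rw [mul_assoc, mul_assoc (P * H), hP, ← mul_assoc, ← mul_assoc, hP]
    · rw [mul_assoc, mul_assoc (P * H.transpose), hP, ← mul_assoc, ← mul_assoc, hP]
  have h2 : (surfStrain n w x * H.transpose).trace = (surfStrain n w x * H).trace := by
    rw [← Matrix.trace_transpose, Matrix.transpose_mul, Matrix.transpose_transpose,
      transpose_surfStrain, Matrix.trace_mul_comm]
  have h3 : ∀ B : Mat3, (surfStrain n w x * (P * B * P)).trace = (surfStrain n w x * B).trace :=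
    fun B => by
      rw [← mul_assoc, Matrix.trace_mul_comm, ← mul_assoc, ← mul_assoc, h1]
  nth_rw 3 [hA]
  rw [mul_smul_comm, mul_add, Matrix.trace_smul, Matrix.trace_add, h3, h3, h2, smul_eq_mul]
  ring

lemma inner_surfGradS (n : E3 → E3) (f : E3 → ℝ) (x v : E3) :
    inner ℝ v (surfGradS n f x) = fderiv ℝ f x v - inner ℝ v (n x) * fderiv ℝ f x (n x) := by
  have hg : ∀ v : E3, inner ℝ v (gradS f x) = fderiv ℝ f x v := fun v => by
    have hv : v = ∑ j, v j • EuclideanSpace.single j (1:ℝ) := by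
      ext j; fin_cases j <;> simp [Fin.sum_univ_three]
    conv_rhs => rw [hv, map_sum]
    simp [inner_eq_sum, gradS]
  rw [surfGradS, ← inner_app_comm (transpose_proj n x), app_proj, inner_sub_left,
    real_inner_smul_left, hg, hg]

/-! ### Dependence on germs -/

lemma strain_congr {w w' : E3 → E3} {x : E3} (h : w =ᶠ[𝓝 x] w') : strain w x = strain w' x := by
  rw [strain, strain, grad_eq_of_eventuallyEq h]

lemma stress_congr {mu : ℝ} {p p' : E3 → ℝ} {w w' : E3 → E3} {x : E3} (hp : p x = p' x)
    (h : w =ᶠ[𝓝 x] w') : stress mu p w x = stress mu p' w' x := by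
  rw [stress, stress, strain_congr h, hp]

lemma dvgT_congr {A A' : E3 → Mat3} {x : E3} (h : A =ᶠ[𝓝 x] A') : dvgT A x = dvgT A' x := by
  unfold dvgT
  congr 1
  funext i
  exact dvg_eq_of_eventuallyEq (h.mono fun y hy => by rw [row, row, hy])

lemma dvgT_stress_congr {mu : ℝ} {p p' : E3 → ℝ} {w w' : E3 → E3} {x : E3} (hp : p =ᶠ[𝓝 x] p')
    (h : w =ᶠ[𝓝 x] w') : dvgT (stress mu p w) x = dvgT (stress mu p' w') x :=
  dvgT_congr (by filter_upwards [hp, h.eventually_nhds] with y h1 h2 using stress_congr h1 h2)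

lemma matDeriv_congr {w w' : ℝ → E3 → E3} {t : ℝ} {x : E3}
    (h : ∀ᶠ q : ℝ × E3 in 𝓝 (t, x), w q.1 q.2 = w' q.1 q.2) :
    matDeriv w t x = matDeriv w' t x := by
  have h1 : (fun s => w s x) =ᶠ[𝓝 t] fun s => w' s x :=
    ((by fun_prop : Continuous fun s : ℝ => (s, x)).tendsto t).eventually h
  have h2 : w t =ᶠ[𝓝 x] w' t :=
    ((by fun_prop : Continuous fun y : E3 => (t, y)).tendsto x).eventually h
  rw [matDeriv, matDeriv, h1.deriv_eq, h2.fderiv_eq, h2.self_of_nhds]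

lemma proj_congr {n n' : E3 → E3} {x : E3} (h : n x = n' x) : proj n x = proj n' x := by
  unfold proj; rw [h]

lemma surfGrad_congr {n n' w w' : E3 → E3} {x : E3} (hn : n x = n' x) (h : w =ᶠ[𝓝 x] w') :
    surfGrad n w x = surfGrad n' w' x := by
  rw [surfGrad, surfGrad, proj_congr hn, grad_eq_of_eventuallyEq h]

lemma surfDvg_congr {n n' w w' : E3 → E3} {x : E3} (hn : n x = n' x) (h : w =ᶠ[𝓝 x] w') :
    surfDvg n w x = surfDvg n' w' x := by
  rw [surfDvg, surfDvg, surfGrad_congr hn h]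

lemma surfStrain_congr {n n' w w' : E3 → E3} {x : E3} (hn : n x = n' x) (h : w =ᶠ[𝓝 x] w') :
    surfStrain n w x = surfStrain n' w' x := by
  rw [surfStrain, surfStrain, surfGrad_congr hn h]

lemma surfGradS_congr {n n' : E3 → E3} {f f' : E3 → ℝ} {x : E3} (hn : n x = n' x)
    (h : f =ᶠ[𝓝 x] f') : surfGradS n f x = surfGradS n' f' x := by
  rw [surfGradS, surfGradS, proj_congr hn, gradS, gradS, h.fderiv_eq]

lemma surfDvgT_surfStrain_congr {n n' w w' : E3 → E3} {x : E3} (hn : n =ᶠ[𝓝 x] n')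
    (h : w =ᶠ[𝓝 x] w') :
    surfDvgT n (surfStrain n w) x = surfDvgT n' (surfStrain n' w') x := by
  unfold surfDvgT
  congr 1
  funext i
  refine surfDvg_congr hn.self_of_nhds ?_
  filter_upwards [hn, h.eventually_nhds] with y h1 h2
  rw [row, row, surfStrain_congr h1 h2]

end BulkSurface

namespace BulkSurface

open TensorCalc

/-! ### The balance of power in the bulk -/

lemma fderiv_norm_sq_field {u : E3 → E3} {x : E3} (hu : DifferentiableAt ℝ u x) (c : ℝ) (v : E3) :
    fderiv ℝ (fun y => c * ‖u y‖ ^ 2) x v = c * (2 * inner ℝ (u x) (fderiv ℝ u x v)) := by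
  have h := (hu.hasFDerivAt.norm_sq.const_mul c).fderiv
  rw [h]
  simp

lemma deriv_norm_sq_field {u : ℝ → E3} {t : ℝ} (hu : DifferentiableAt ℝ u t) (c : ℝ) :
    deriv (fun s => c * ‖u s‖ ^ 2) t = c * (2 * inner ℝ (u t) (deriv u t)) :=
  (hu.hasDerivAt.norm_sq.const_mul c).deriv

lemma app_zero (A : Mat3) : app A 0 = 0 := by
  ext i
  simp [app_apply]

lemma contDiff_app_of_symm {A : E3 → Mat3} {w : E3 → E3}
    (hA : ∀ i j, ContDiff ℝ 1 fun x => A x i j) (hs : ∀ x, (A x).transpose = A x)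
    (hw : ContDiff ℝ 1 w) : ContDiff ℝ 1 fun x => app (A x) (w x) := by
  have e : (fun y => app (A y) (w y)) = fun y => ∑ i, w y i • row A i y := by
    funext y; exact app_sum_row (hs y) (w y)
  rw [e]
  exact ContDiff.sum fun i _ => (by fun_prop : ContDiff ℝ 1 fun y => w y i).smul (contDiff_row hA i)

/-- The flux of power through the boundary: work of the stress minus convection of energy. -/
noncomputable def energyFlux (rho mu : ℝ) (p : E3 → ℝ) (u : E3 → E3) (x : E3) : E3 :=
  app (stress mu p u x) (u x) - (1 / 2 * rho * ‖u x‖ ^ 2) • u x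

section EnergyFlux

variable {rho mu : ℝ} {p : E3 → ℝ} {u : E3 → E3} (hp : ContDiff ℝ 1 p) (hu : ContDiff ℝ 2 u)
include hp hu

lemma contDiff_app_stress : ContDiff ℝ 1 fun x => app (stress mu p u x) (u x) := by
  exact contDiff_app_of_symm (contDiff_stress hp hu) (transpose_stress mu p u)
    (hu.of_le (by norm_num))

omit hp in
lemma contDiff_convection : ContDiff ℝ 1 fun x => (1 / 2 * rho * ‖u x‖ ^ 2) • u x := by
  have hu1 : ContDiff ℝ 1 u := hu.of_le (by norm_num)
  exact (contDiff_const.mul (hu1.norm_sq ℝ)).smul hu1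

lemma contDiff_energyFlux : ContDiff ℝ 1 (energyFlux rho mu p u) :=
  (contDiff_app_stress hp hu).sub (contDiff_convection hu)

omit hp hu in
lemma hasCompactSupport_energyFlux (hs : HasCompactSupport u) :
    HasCompactSupport (energyFlux rho mu p u) :=
  hs.mono fun x hx hx' => hx (by
    have h0 : u x = 0 := hx'
    rw [energyFlux, h0, smul_zero, sub_zero, app_zero])

lemma dvg_energyFlux (x : E3) :
    dvg (energyFlux rho mu p u) x = inner ℝ (u x) (dvgT (stress mu p u) x)
      + (-(p x) * dvg u x + 2 * mu * normSq (strain u x))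
      - (1 / 2 * rho * ‖u x‖ ^ 2 * dvg u x + rho * inner ℝ (u x) (fderiv ℝ u x (u x))) := by
  have hu1 : ContDiff ℝ 1 u := hu.of_le (by norm_num)
  have hud := hu1.differentiable one_ne_zero x
  have hq : ContDiff ℝ 1 fun x => 1 / 2 * rho * ‖u x‖ ^ 2 := contDiff_const.mul (hu1.norm_sq ℝ)
  have h1 := dvg_sub ((contDiff_app_stress (mu := mu) hp hu).differentiable one_ne_zero x)
    ((contDiff_convection (rho := rho) hu).differentiable one_ne_zero x)
  rw [dvg_app (contDiff_stress hp hu) (transpose_stress mu p u) hu1, contraction_stress,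
    dvg_smul (hq.differentiable one_ne_zero x) hud, fderiv_norm_sq_field hud] at h1
  refine h1.trans ?_
  ring

end EnergyFlux

lemma integrableOn_of_eqOn {α : Type*} [TopologicalSpace α] [MeasurableSpace α]
    {μ : Measure α} {G : Set α} (hG : MeasurableSet G) {f g : α → ℝ} (hf : IntegrableOn f G μ)
    (h : ∀ x ∈ G, g x = f x) : IntegrableOn g G μ :=
  hf.congr_fun (fun x hx => (h x hx).symm) hG

/-- The balance of power for an incompressible Newtonian fluid. -/
theorem bulk_power_balance {G : Set E3} (hGm : MeasurableSet G) (hGb : Bornology.IsBounded G)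
    {rho mu t : ℝ} {p : E3 → ℝ} {u : ℝ → E3 → E3} {f : E3 → E3}
    (hu : ContDiff ℝ 2 (Function.uncurry u)) (hp : ContDiff ℝ 1 p)
    (hmom : ∀ x ∈ G, rho • matDeriv u t x = dvgT (stress mu p (u t)) x + f x)
    (hdiv : ∀ x ∈ G, dvg (u t) x = 0) :
    IntegrableOn (fun x => normSq (strain (u t) x)) G ∧
    IntegrableOn (fun x => inner ℝ (u t x) (f x)) G ∧
    ∫ x in G, deriv (fun s => 1 / 2 * rho * ‖u s x‖ ^ 2) t =
      (∫ x in G, dvg (energyFlux rho mu p (u t)) x)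
        - 2 * mu * (∫ x in G, normSq (strain (u t) x)) + ∫ x in G, inner ℝ (u t x) (f x) := by
  have hint : ∀ {g : E3 → ℝ}, Continuous g → IntegrableOn g G := fun hg =>
    (hg.continuousOn.integrableOn_compact hGb.isCompact_closure).mono_set subset_closure
  have hu1 : ContDiff ℝ 1 (Function.uncurry u) := hu.of_le (by norm_num)
  have hut := contDiff_slice hu t
  have hut1 := contDiff_slice hu1 t
  have hfl := contDiff_energyFlux (rho := rho) (mu := mu) hp hut
  have hder : ∀ x, deriv (fun s => 1 / 2 * rho * ‖u s x‖ ^ 2) t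
      = rho * inner ℝ (u t x) (deriv (fun s => u s x) t) := fun x => by
    rw [deriv_norm_sq_field (hasDerivAt_time hu1 t x).differentiableAt]
    ring
  -- Nothing is assumed about the force `f`. On `G` the momentum equation writes its power as a
  -- combination of continuous functions, which also gives integrability.
  have hforce : ∀ x ∈ G, inner ℝ (u t x) (f x)
      = rho * inner ℝ (u t x) (deriv (fun s => u s x) t)
        - dvg (energyFlux rho mu p (u t)) x + 2 * mu * normSq (strain (u t) x) := fun x hx => by
    have h := congrArg (fun v => inner ℝ (u t x) v) (hmom x hx)
    simp only [matDeriv, inner_smul_right, inner_add_right] at h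
    rw [dvg_energyFlux hp hut, hdiv x hx]
    linarith
  have c1 : Continuous fun x => rho * inner ℝ (u t x) (deriv (fun s => u s x) t) :=
    continuous_const.mul (hut.continuous.inner (continuous_deriv_time_slice hu1 t))
  have i1 := hint c1
  have i2 := hint (continuous_dvg hfl)
  have i3 := hint (continuous_normSq (contDiff_strain hut))
  refine ⟨i3, integrableOn_of_eqOn hGm
    ((i1.sub i2).add (i3.const_mul (2 * mu))) hforce, ?_⟩
  have h4 := setIntegral_congr_fun (μ := volume) hGm hforce
  have h5 := integral_add (i1.sub i2) (i3.const_mul (2 * mu))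
  have h6 := integral_sub i1 i2
  rw [integral_const_mul] at h5
  simp only [Pi.sub_apply] at h5
  simp only [hder]
  rw [h4, h5, h6]
  ring

/-! ### The balance of power on the surface -/

section SurfacePower

variable {G : Set E3} {n : E3 → E3} (hG : IsSmoothSurface G n)
include hG

/-- Partial integration of the viscous surface force. -/
lemma integral_inner_surfDvgT {w : E3 → E3} (hw : ContDiff ℝ 2 w) (hs : HasCompactSupport w) :
    IntegrableOn (fun x => normSq (surfStrain n w x)) (frontier G) μHE[2] ∧
    IntegrableOn (fun x => inner ℝ (w x) (surfDvgT n (surfStrain n w) x)) (frontier G) μHE[2] ∧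
    ∫ x in frontier G, inner ℝ (w x) (surfDvgT n (surfStrain n w) x) ∂μHE[2]
      = -∫ x in frontier G, normSq (surfStrain n w x) ∂μHE[2] := by
  have hm : MeasurableSet (frontier G) := isClosed_frontier.measurableSet
  have hw1 : ContDiff ℝ 1 w := hw.of_le (by norm_num)
  have hA := contDiff_surfStrain hG.smooth hw
  have hAs := transpose_surfStrain n w
  have hV : ContDiff ℝ 1 fun x => app (surfStrain n w x) (w x) := contDiff_app_of_symm hA hAs hw1
  have hVs : HasCompactSupport fun x => app (surfStrain n w x) (w x) :=
    hs.mono fun x hx hx' => hx (by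
      have h0 : w x = 0 := hx'
      simp only [h0, app_zero])
  have i1 := hG.integrableOn_surfDvg hV
  have i4 : IntegrableOn (fun x => normSq (surfStrain n w x)) (frontier G) μHE[2] :=
    hG.integrableOn_frontier_of_continuousOn (continuous_normSq hA).continuousOn
  have key : ∀ x ∈ frontier G, inner ℝ (w x) (surfDvgT n (surfStrain n w) x)
      = surfDvg n (fun y => app (surfStrain n w y) (w y)) x - normSq (surfStrain n w x) :=
    fun x hx => by
      have hu := hG.unit x hx
      rw [surfDvg_app hA hAs hw1 hu (app_surfStrain_normal hu), contraction_surfStrain hu]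
      ring
  refine ⟨i4, integrableOn_of_eqOn hm (i1.sub i4) key, ?_⟩
  -- The curvature term of the surface divergence theorem vanishes, because `D_Γ w` is tangential.
  rw [setIntegral_congr_fun hm key, integral_sub i1 i4, hG.integral_surfDvg hV hVs,
    setIntegral_eq_zero_of_forall_eq_zero fun x hx => ?_, zero_sub]
  rw [inner_app_comm (hAs x), app_surfStrain_normal (hG.unit x hx), inner_zero_right, mul_zero]

/-- The surface pressure does no work in an inextensible flow. -/
lemma integral_pressure {w : E3 → E3} {π : E3 → ℝ} (hw : ContDiff ℝ 1 w)
    (hs : HasCompactSupport w) (hπ : ContDiff ℝ 1 π) (hdiv : ∀ x ∈ frontier G, surfDvg n w x = 0) :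
    IntegrableOn (fun x => inner ℝ (w x) (-surfGradS n π x + (π x * curvature n x) • n x))
      (frontier G) μHE[2] ∧
    ∫ x in frontier G, inner ℝ (w x) (-surfGradS n π x + (π x * curvature n x) • n x) ∂μHE[2]
      = 0 := by
  have hm : MeasurableSet (frontier G) := isClosed_frontier.measurableSet
  have hW : ContDiff ℝ 1 fun x => π x • w x := hπ.smul hw
  have i2 := hG.integrableOn_surfDvg hW
  have i3 := hG.integrableOn_curvature_mul hW.continuous
  -- The tangential and normal pressure forces together have the power `κ (π w)·n - div_Γ (π w)`,
  -- whose integral vanishes by the surface divergence theorem.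
  have key : ∀ x ∈ frontier G, inner ℝ (w x) (-surfGradS n π x + (π x * curvature n x) • n x)
      = curvature n x * inner ℝ (π x • w x) (n x) - surfDvg n (fun y => π y • w y) x :=
    fun x hx => by
      rw [surfDvg_smul (hG.unit x hx) (hπ.differentiable one_ne_zero x)
        (hw.differentiable one_ne_zero x), hdiv x hx, inner_add_right, inner_neg_right,
        inner_surfGradS, inner_smul_right, real_inner_smul_left]
      ring
  refine ⟨integrableOn_of_eqOn hm (i3.sub i2) key, ?_⟩
  have hWs : HasCompactSupport fun x => π x • w x := HasCompactSupport.smul_left (f := π) hs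
  rw [setIntegral_congr_fun hm key, integral_sub i3 i2, hG.integral_surfDvg hW hWs, sub_self]

/-- The balance of power for an inextensible surface fluid. -/
theorem surface_power_balance {rho mu t : ℝ} {π : E3 → ℝ} {U : ℝ → E3 → E3} {b J : E3 → E3}
    (hU : ContDiff ℝ 2 (Function.uncurry U)) (hUs : HasCompactSupport (Function.uncurry U))
    (hπ : ContDiff ℝ 1 π)
    (hJ : IntegrableOn (fun x => inner ℝ (U t x) (J x)) (frontier G) μHE[2])
    (hmom : ∀ x ∈ frontier G, rho • matDeriv U t x = -surfGradS n π x
      + (2 * mu) • surfDvgT n (surfStrain n (U t)) x + J x + b x + (π x * curvature n x) • n x)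
    (hdiv : ∀ x ∈ frontier G, surfDvg n (U t) x = 0) :
    IntegrableOn (fun x => normSq (surfStrain n (U t) x)) (frontier G) μHE[2] ∧
    IntegrableOn (fun x => inner ℝ (U t x) (b x)) (frontier G) μHE[2] ∧
    ∫ x in frontier G, (deriv (fun s => 1 / 2 * rho * ‖U s x‖ ^ 2) t
        + fderiv ℝ (fun y => 1 / 2 * rho * ‖U t y‖ ^ 2) x (U t x)) ∂μHE[2] =
      -(2 * mu * ∫ x in frontier G, normSq (surfStrain n (U t) x) ∂μHE[2])
        + ∫ x in frontier G, inner ℝ (U t x) (J x) ∂μHE[2]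
        + ∫ x in frontier G, inner ℝ (U t x) (b x) ∂μHE[2] := by
  have hm : MeasurableSet (frontier G) := isClosed_frontier.measurableSet
  have hU1 : ContDiff ℝ 1 (Function.uncurry U) := hU.of_le (by norm_num)
  have hUt := contDiff_slice hU t
  have hUt1 := contDiff_slice hU1 t
  have hUts := hasCompactSupport_slice hUs t
  obtain ⟨i1, i2, e1⟩ := integral_inner_surfDvgT hG hUt hUts
  obtain ⟨i3, e3⟩ := integral_pressure hG hUt1 hUts hπ hdiv
  set a : E3 → ℝ := fun x => deriv (fun s => 1 / 2 * rho * ‖U s x‖ ^ 2) t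
        + fderiv ℝ (fun y => 1 / 2 * rho * ‖U t y‖ ^ 2) x (U t x)
  have hder : ∀ x, a x
      = rho * inner ℝ (U t x) (deriv (fun s => U s x) t + fderiv ℝ (U t) x (U t x)) := fun x => by
    simp only [a]
    rw [deriv_norm_sq_field (hasDerivAt_time hU1 t x).differentiableAt,
      fderiv_norm_sq_field (hUt1.differentiable one_ne_zero x), inner_add_right]
    ring
  have i6 : IntegrableOn a (frontier G) μHE[2] := by
    refine hG.integrableOn_frontier_of_continuousOn (Continuous.continuousOn ?_)
    rw [show a = _ from funext hder]
    exact continuous_const.mul (hUt.continuous.inner ((continuous_deriv_time_slice hU1 t).add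
      ((hUt1.continuous_fderiv one_ne_zero).clm_apply hUt.continuous)))
  -- As in the bulk, the momentum equation supplies the integrability of the power of the area
  -- force.
  have hforce : ∀ x ∈ frontier G, inner ℝ (U t x) (b x) = a x
        - inner ℝ (U t x) (-surfGradS n π x + (π x * curvature n x) • n x)
        - inner ℝ (U t x) (J x)
        - 2 * mu * inner ℝ (U t x) (surfDvgT n (surfStrain n (U t)) x) := fun x hx => by
    have h := congrArg (fun v => inner ℝ (U t x) v) (hmom x hx)
    simp only [matDeriv, inner_smul_right, inner_add_right] at h
    rw [hder]
    simp only [inner_add_right, inner_smul_right]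
    linarith
  refine ⟨i1, integrableOn_of_eqOn hm (((i6.sub i3).sub hJ).sub (i2.const_mul (2 * mu))) hforce, ?_⟩
  have e4 := integral_sub_sub_const_mul (i6.sub i3) hJ i2 (2 * mu)
  have e5 := integral_sub i6 i3
  simp only [Pi.sub_apply] at e4
  rw [setIntegral_congr_fun hm hforce, ← e4, e5, e1, e3]
  ring

end SurfacePower

/-! ### Fields on a fixed domain -/

/-- Differentiation under the integral over a fixed domain. -/
lemma IsLipschitzDomain.hasDerivAt_integral {G : Set E3} {ν : E3 → E3} (hG : IsLipschitzDomain G ν)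
    {f : ℝ → E3 → ℝ} (hf : ContDiff ℝ 1 (Function.uncurry f))
    (hs : HasCompactSupport (Function.uncurry f)) (t : ℝ) :
    HasDerivAt (fun s => ∫ x in G, f s x) (∫ x in G, deriv (fun r => f r x) t) t := by
  have hi := fun s => hG.integrableOn_of_continuous (contDiff_slice hf s).continuous
  have hi2 := hG.integrableOn_of_continuous (continuous_deriv_time_slice hf t)
  have := hasDerivAt_of_approx (A := fun _ => ∫ x in G, f t x) (Φ := fun s => ∫ x in G, f s x)
    (B := fun _ => ∫ x in G, deriv (fun r => f r x) t) (C := volume.real G)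
    (hasDerivAt_const t _) continuousAt_const fun ε hε => ?_
  · simpa using this
  filter_upwards [uniform_time_quotient hf hs t hε] with s h1
  rw [integral_sub_sub_const_mul (hi s) (hi t) hi2, ← Real.norm_eq_abs]
  exact norm_setIntegral_le_of_norm_le_const hG.volume_lt_top fun x _ => h1 x

/-- Agreement in a full space-time neighbourhood of `(t, x)` preserves time and space derivatives
there, and allows the fields to be exchanged on the moving sets at nearby times. -/
lemma exists_spacetime_extension {F : Type*} [NormedAddCommGroup F] [NormedSpace ℝ F] {K : Set E3}
    (hK : IsCompact K) {t : ℝ} {n : ℕ} {f : ℝ → E3 → F}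
    (hf : ∀ x ∈ K, ContDiffAt ℝ n (Function.uncurry f) (t, x)) :
    ∃ g : ℝ → E3 → F, ContDiff ℝ n (Function.uncurry g) ∧
      HasCompactSupport (Function.uncurry g) ∧
      ∀ x ∈ K, ∀ᶠ q : ℝ × E3 in 𝓝 (t, x), g q.1 q.2 = f q.1 q.2 := by
  obtain ⟨g, h1, h2, h3⟩ := exists_extension (isCompact_singleton.prod hK)
    (K := ({t} : Set ℝ) ×ˢ K) (f := Function.uncurry f) (n := n) (by
      rintro ⟨s, x⟩ ⟨hs, hx⟩
      have hs' : s = t := hs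
      subst hs'
      exact hf x hx)
  exact ⟨fun s x => g (s, x), h1, h2, fun x hx => eventually_nhdsSet_iff_forall.1 h3 (t, x) ⟨rfl, hx⟩⟩

lemma slice_eventuallyEq {F : Type*} {u v : ℝ → E3 → F} {t : ℝ} {x : E3}
    (h : ∀ᶠ q : ℝ × E3 in 𝓝 (t, x), u q.1 q.2 = v q.1 q.2) : u t =ᶠ[𝓝 x] v t :=
  ((by fun_prop : Continuous fun y : E3 => (t, y)).tendsto x).eventually h

end BulkSurface

/-! ### The container and the position of the outer phase -/

namespace TwoPhaseFlow

open BulkSurface TensorCalc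

variable {S : TwoPhaseFlow} {t : ℝ}

lemma IsContainer.isLipschitzDomain (hC : S.IsContainer) : IsLipschitzDomain S.Ω S.ν :=
  ⟨hC.isOpen.measurableSet, hC.bounded, hC.lipschitz, hC.normal⟩

/-- The two parts of the boundary make up the integrals over the boundary of the container. -/
lemma IsContainer.setIntegral_frontier (hC : S.IsContainer) {f : E3 → ℝ}
    (hf : IntegrableOn f (frontier S.Ω) μHE[2]) :
    ∫ x in frontier S.Ω, f x ∂μHE[2]
      = ∫ x in S.bdD, f x ∂μHE[2] + ∫ x in S.bdN, f x ∂μHE[2] := by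
  have hs := hC.subset
  rw [← setIntegral_union hC.disjoint hC.measN (hf.mono_set (subset_union_left.trans hs))
    (hf.mono_set (subset_union_right.trans hs))]
  refine setIntegral_congr_set ?_
  have h1 : (S.bdD ∪ S.bdN : Set E3) ≤ᵐ[μHE[2]] frontier S.Ω := LE.le.eventuallyLE hs
  exact (ae_le_set.2 hC.null).antisymm h1

namespace IsInterface

variable (hC : S.IsContainer) (hS : S.IsInterface) (ht : t ∈ Ioo 0 S.T)
include hS ht

lemma closure_subset : closure (S.Ωm t) ⊆ S.Ω := hS.internal t ⟨ht.1.le, ht.2.le⟩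

include hC

/-- Points of the container are interior to the inner phase or adherent to the outer phase. -/
lemma mem_or_mem_closure_Ωp {x : E3} (hx : x ∈ closure S.Ω) : x ∈ S.Ωm t ∨ x ∈ closure (S.Ωp t) := by
  by_cases hm : x ∈ closure (S.Ωm t)
  · by_cases hx' : x ∈ S.Ωm t
    · exact Or.inl hx'
    · right
      have hfr : x ∈ S.Γ t := ⟨hm, by rwa [(hS.isOpen_Ωm ht).interior_eq]⟩
      have hn := hS.normal t ht x hfr
      have hpos : 0 < inner ℝ (S.n t x) (S.n t x) := by
        rw [real_inner_self_eq_norm_sq, hn.1]; norm_num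
      -- A point of the interface is a limit of points of the outer phase along the ray in direction
      -- `n`.
      have hline : Tendsto (fun s : ℝ => x + s • S.n t x) (𝓝[>] 0) (𝓝 x) := by
        have hc : Continuous fun s : ℝ => x + s • S.n t x := by fun_prop
        simpa using (hc.tendsto 0).mono_left nhdsWithin_le_nhds
      refine mem_closure_of_tendsto hline ?_
      filter_upwards [hn.2.2 _ hpos, hline.eventually
        (hC.isOpen.mem_nhds (hS.closure_subset ht hm))] with s h1 h2 using ⟨h2, h1⟩
  · right
    rw [mem_closure_iff_frequently] at hx ⊢
    have := isClosed_closure.isOpen_compl.mem_nhds hm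
    exact (hx.and_eventually this).mono fun y hy => ⟨hy.1, hy.2⟩

end IsInterface

end TwoPhaseFlow

/-! ### Fluids that are smooth up to the boundary -/

namespace BulkSurface

open TensorCalc

lemma exists_fluid_extension {K : Set E3} (hK : IsCompact K) {t : ℝ} {u : ℝ → E3 → E3} {p : E3 → ℝ}
    (hu : ∀ x ∈ K, ContDiffAt ℝ 2 (Function.uncurry u) (t, x))
    (hp : ∀ x ∈ K, ContDiffAt ℝ 1 p x) :
    ∃ (v : ℝ → E3 → E3) (q : E3 → ℝ), ContDiff ℝ 2 (Function.uncurry v) ∧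
      HasCompactSupport (Function.uncurry v) ∧ ContDiff ℝ 1 q ∧
      (∀ x ∈ K, ∀ᶠ y : ℝ × E3 in 𝓝 (t, x), v y.1 y.2 = u y.1 y.2) ∧
      ∀ x ∈ K, q =ᶠ[𝓝 x] p := by
  obtain ⟨v, h1, h2, h3⟩ := exists_spacetime_extension (n := 2) hK hu
  obtain ⟨q, h4, -, h5⟩ := exists_extension (n := 1) hK hp
  exact ⟨v, q, h1, h2, h4, h3, eventually_nhdsSet_iff_forall.1 h5⟩

lemma continuousOn_stress {K : Set E3} (hK : IsCompact K) {t mu : ℝ} {u : ℝ → E3 → E3} {p : E3 → ℝ}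
    (hu : ∀ x ∈ K, ContDiffAt ℝ 2 (Function.uncurry u) (t, x))
    (hp : ∀ x ∈ K, ContDiffAt ℝ 1 p x) (i j : Fin 3) :
    ContinuousOn (fun x => stress mu p (u t) x i j) K := by
  obtain ⟨v, q, h1, -, h2, h3, h4⟩ := exists_fluid_extension hK hu hp
  refine (contDiff_stress (mu := mu) h2 (contDiff_slice h1 t) i j).continuous.continuousOn.congr
    fun x hx => ?_
  simp only
  rw [stress_congr (h4 x hx).self_of_nhds (slice_eventuallyEq (h3 x hx))]

lemma continuousOn_slice {K : Set E3} {t : ℝ} {u : ℝ → E3 → E3} {n : ℕ∞ω}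
    (hu : ∀ x ∈ K, ContDiffAt ℝ n (Function.uncurry u) (t, x)) : ContinuousOn (u t) K :=
  fun x hx => ((hu x hx).continuousAt.comp
    (f := fun y : E3 => (t, y)) (by fun_prop)).continuousWithinAt

/-- The balance of power for a fluid that is smooth up to the boundary, with globally defined energy
density `e` and energy flux `F`. -/
lemma fluid_power_balance {G : Set E3} (hGm : MeasurableSet G) (hGb : Bornology.IsBounded G)
    {rho mu t : ℝ} {p : E3 → ℝ} {u : ℝ → E3 → E3} {f : E3 → E3}
    (hu : ∀ x ∈ closure G, ContDiffAt ℝ 2 (Function.uncurry u) (t, x))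
    (hp : ∀ x ∈ closure G, ContDiffAt ℝ 1 p x)
    (hmom : ∀ x ∈ G, rho • matDeriv u t x = dvgT (stress mu p (u t)) x + f x)
    (hdiv : ∀ x ∈ G, dvg (u t) x = 0) :
    IntegrableOn (fun x => rho * ‖u t x‖ ^ 2) G ∧
    IntegrableOn (fun x => normSq (strain (u t) x)) G ∧
    IntegrableOn (fun x => inner ℝ (u t x) (f x)) G ∧
    ∃ (e : ℝ → E3 → ℝ) (F : E3 → E3), ContDiff ℝ 1 (Function.uncurry e) ∧
      HasCompactSupport (Function.uncurry e) ∧ ContDiff ℝ 1 F ∧ HasCompactSupport F ∧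
      (∀ x ∈ closure G, ∀ᶠ q : ℝ × E3 in 𝓝 (t, x), e q.1 q.2 = 1 / 2 * rho * ‖u q.1 q.2‖ ^ 2) ∧
      (∀ x ∈ closure G, F x = energyFlux rho mu p (u t) x) ∧
      ∫ x in G, deriv (fun s => e s x) t =
        (∫ x in G, dvg F x) - 2 * mu * (∫ x in G, normSq (strain (u t) x))
          + ∫ x in G, inner ℝ (u t x) (f x) := by
  have hK := hGb.isCompact_closure
  obtain ⟨v, q, h1, h2, h3, h4, h5⟩ := exists_fluid_extension hK hu hp
  have hv1 : ContDiff ℝ 1 (Function.uncurry v) := h1.of_le (by norm_num)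
  have hG := subset_closure (s := G)
  have h6 : ∀ x ∈ closure G, v t =ᶠ[𝓝 x] u t := fun x hx => slice_eventuallyEq (h4 x hx)
  have h7 : ∀ x ∈ closure G, v t x = u t x := fun x hx => (h6 x hx).self_of_nhds
  obtain ⟨i1, i2, hb⟩ := bulk_power_balance (f := f) (rho := rho) (mu := mu) hGm hGb h1 h3
    (fun x hx => by
      rw [matDeriv_congr (h4 x (hG hx)), dvgT_stress_congr (h5 x (hG hx)) (h6 x (hG hx)), hmom x hx])
    (fun x hx => by rw [dvg_eq_of_eventuallyEq (h6 x (hG hx)), hdiv x hx])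
  have e1 : ∀ x ∈ G, normSq (strain (u t) x) = normSq (strain (v t) x) := fun x hx => by
    rw [strain_congr (h6 x (hG hx))]
  have e2 : ∀ x ∈ G, inner ℝ (u t x) (f x) = inner ℝ (v t x) (f x) := fun x hx => by
    rw [h7 x (hG hx)]
  refine ⟨?_, integrableOn_of_eqOn hGm i1 e1, integrableOn_of_eqOn hGm i2 e2,
    fun s x => 1 / 2 * rho * ‖v s x‖ ^ 2, energyFlux rho mu q (v t), ?_, ?_,
    contDiff_energyFlux h3 (contDiff_slice h1 t),
    hasCompactSupport_energyFlux (hasCompactSupport_slice h2 t), fun x hx => ?_, fun x hx => ?_, ?_⟩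
  · exact ((continuousOn_const.mul ((continuousOn_slice hu).norm.pow 2)).integrableOn_compact
      hK).mono_set hG
  · exact contDiff_const.mul (hv1.norm_sq ℝ)
  · exact h2.comp_left (g := fun w : E3 => 1 / 2 * rho * ‖w‖ ^ 2) (by simp)
  · filter_upwards [h4 x hx] with y hy
    rw [hy]
  · rw [energyFlux, energyFlux, stress_congr (h5 x hx).self_of_nhds (h6 x hx), h7 x hx]
  · rw [hb, setIntegral_congr_fun hGm e1, setIntegral_congr_fun hGm e2]

end BulkSurface

/-! ### Energy balances of the two phases and of the interface -/

namespace TwoPhaseFlow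

open BulkSurface TensorCalc

variable {S : TwoPhaseFlow} {t : ℝ}

namespace IsInterface

variable (hC : S.IsContainer) (hS : S.IsInterface) (ht : t ∈ Ioo 0 S.T)
include hC hS ht

lemma Γ_subset_closure_Ωp : S.Γ t ⊆ closure (S.Ωp t) := fun _ hx =>
  (mem_or_mem_closure_Ωp hC hS ht (subset_closure (hS.closure_subset ht hx.1))).resolve_left
    fun h => hx.2 (by rwa [(hS.isOpen_Ωm ht).interior_eq])

lemma frontier_subset_closure_Ωp : frontier S.Ω ⊆ closure (S.Ωp t) := fun _ hx =>
  (mem_or_mem_closure_Ωp hC hS ht hx.1).resolve_left fun h =>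
    hx.2 (by
      rw [hC.isOpen.interior_eq]
      exact hS.closure_subset ht (subset_closure h))

/-- The outer phase stays close to its position at time `t`. -/
lemma eventually_forall_mem_Ωp {P : ℝ → E3 → Prop}
    (h : ∀ x ∈ closure (S.Ωp t), ∀ᶠ q : ℝ × E3 in 𝓝 (t, x), P q.1 q.2) :
    ∀ᶠ s in 𝓝 t, ∀ x ∈ S.Ωp s, P s x := by
  have key : ∀ᶠ s in 𝓝 t, ∀ x ∈ closure S.Ω, x ∈ S.Ωp s → P s x := by
    refine hC.bounded.isCompact_closure.eventually_forall_of_forall_eventually fun x hx => ?_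
    rcases mem_or_mem_closure_Ωp hC hS ht hx with h1 | h1
    · filter_upwards [hS.cont_mem t ht x h1] with q hq hq'
      exact absurd (subset_closure hq) hq'.2
    · filter_upwards [h x h1] with q hq _ using hq
  filter_upwards [key] with s hs x hx
  exact hs x (subset_closure hx.1) hx

/-- The interface has zero volume. Thanks to this formula the outer phase need not be treated as a
moving domain: its integrals are those over the fixed container minus those over the inner phase. -/
lemma setIntegral_Ωp {f : E3 → ℝ} (hf : Continuous f) :
    ∫ x in S.Ωp t, f x = (∫ x in S.Ω, f x) - ∫ x in S.Ωm t, f x := by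
  have hL := hS.isLipschitzDomain ht hC.bounded
  have h0 : volume (frontier (S.Ωm t)) = 0 := hL.volume_frontier
  have h1 : (closure (S.Ωm t) : Set E3) =ᵐ[volume] S.Ωm t := by
    rw [closure_eq_self_union_frontier]
    exact union_ae_eq_left_of_ae_eq_empty (ae_eq_empty.2 h0)
  rw [Ωp, setIntegral_sdiff isClosed_closure.measurableSet
    (hC.isLipschitzDomain.integrableOn_of_continuous hf) (hS.closure_subset ht),
    setIntegral_congr_set h1]

end IsInterface

namespace IsSmoothSolution

variable (hS : S.IsSmoothSolution) (ht : t ∈ Ioo 0 S.T)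
include hS ht

omit ht in
lemma isOpen_Ωp : IsOpen (S.Ωp t) :=
  hS.container.isOpen.sdiff isClosed_closure

lemma continuousOn_n : ContinuousOn (S.n t) (S.Γ t) :=
  continuousOn_slice (hS.interface.normal_C1 t ht)

/-- The fluxes of energy relative to the moving interface. -/
lemma integral_relative_flux {rho mu : ℝ} {p : E3 → ℝ} {u : ℝ → E3 → E3} {e : ℝ → E3 → ℝ}
    {F : E3 → E3} (he : Continuous (e t)) (hes : HasCompactSupport (e t)) (hF : Continuous F)
    (heu : ∀ x ∈ S.Γ t, e t x = 1 / 2 * rho * ‖u t x‖ ^ 2)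
    (hFu : ∀ x ∈ S.Γ t, F x = energyFlux rho mu p (u t) x)
    (hun : ∀ x ∈ S.Γ t, inner ℝ (u t x) (S.n t x) = S.UN t x) :
    (∫ x in S.Γ t, e t x * S.UN t x ∂μHE[2]) + ∫ x in S.Γ t, inner ℝ (F x) (S.n t x) ∂μHE[2]
      = ∫ x in S.Γ t, inner ℝ (u t x) (app (stress mu p (u t) x) (S.n t x)) ∂μHE[2] := by
  have hL := hS.interface.isLipschitzDomain ht hS.container.bounded
  have i1 := ((hS.interface.isMovingDomain ht).transport he hes).1
  have i2 := hL.integrableOn_inner_normal_of_continuousOn hF.continuousOn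
  refine (integral_add i1 i2).symm.trans ?_
  refine setIntegral_congr_fun isClosed_frontier.measurableSet fun x hx => ?_
  -- Because `u·n = U_N`, the energy swept by the moving interface cancels the convected energy, and
  -- only the power of the stress is left.
  rw [heu x hx, hFu x hx, energyFlux, inner_sub_left, real_inner_smul_left, hun x hx,
    inner_app_comm (transpose_stress _ _ _ _)]
  ring

/-- The balance of energy in the inner phase. -/
lemma inner_phase :
    IntegrableOn (fun x => S.rhom * ‖S.um t x‖ ^ 2) (S.Ωm t) ∧
    IntegrableOn (fun x => normSq (strain (S.um t) x)) (S.Ωm t) ∧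
    IntegrableOn (fun x => inner ℝ (S.um t x) (S.fm t x)) (S.Ωm t) ∧
    HasDerivAt (fun s => (1 / 2) * ∫ x in S.Ωm s, S.rhom * ‖S.um s x‖ ^ 2)
      ((∫ x in S.Γ t, inner ℝ (S.um t x) (app (S.σm t x) (S.n t x)) ∂μHE[2])
        - 2 * S.mum * (∫ x in S.Ωm t, normSq (strain (S.um t) x))
        + ∫ x in S.Ωm t, inner ℝ (S.um t x) (S.fm t x)) t := by
  have hI := hS.interface
  have hb := hS.container.bounded
  have hL := hI.isLipschitzDomain ht hb
  have hM := hI.isBoundedMovingDomain ht hb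
  obtain ⟨i1, i2, i3, e, F, he, hes, hF, hFs, heu, hFu, hbal⟩ := fluid_power_balance
    (f := S.fm t) (rho := S.rhom) (mu := S.mum)
    (hI.isOpen_Ωm ht).measurableSet hL.bounded (hS.regular.um_C2 t ht) (hS.regular.pm_C1 t ht)
    (hS.solves.momentum_m t ht) (hS.solves.incompressible_m t ht)
  refine ⟨i1, i2, i3, ?_⟩
  have hev := hM.eventually_forall_mem
    (P := fun s x => e s x = 1 / 2 * S.rhom * ‖S.um s x‖ ^ 2) heu
  have hE : (fun s => (1 / 2) * ∫ x in S.Ωm s, S.rhom * ‖S.um s x‖ ^ 2) =ᶠ[𝓝 t]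
      fun s => ∫ x in S.Ωm s, e s x := by
    filter_upwards [hev, Ioo_mem_nhds ht.1 ht.2] with s h1 h2
    rw [← integral_const_mul]
    refine setIntegral_congr_fun (hI.isOpen_Ωm h2).measurableSet fun x hx => ?_
    rw [h1 x hx]
    ring
  have hfr : S.Γ t ⊆ closure (S.Ωm t) := frontier_subset_closure
  refine ((hM.reynolds he hes).congr_of_eventuallyEq hE).congr_deriv ?_
  have hfl := hS.integral_relative_flux ht (rho := S.rhom) (mu := S.mum) (p := S.pm t)
    (contDiff_slice he t).continuous (hasCompactSupport_slice hes t) hF.continuous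
    (fun x hx => (heu x (hfr hx)).self_of_nhds) (fun x hx => hFu x (hfr hx))
    (hS.solves.noPenetration_m t ht)
  have hdt := hL.divergence hF hFs
  rw [hbal, hdt]
  simp only [σm]
  rw [← hfl]
  simp only [Γ]
  ring

/-- The work on the boundary of the container. -/
lemma boundary_work {F : E3 → E3} (hF : Continuous F)
    (hFu : ∀ x ∈ frontier S.Ω, F x = energyFlux S.rhop S.mup (S.pp t) (S.up t) x) :
    IntegrableOn (S.workD t) S.bdD μHE[2] ∧ IntegrableOn (S.workN t) S.bdN μHE[2] ∧
    ∫ x in frontier S.Ω, inner ℝ (F x) (S.ν x) ∂μHE[2] = S.boundaryWork t := by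
  have hC := hS.container
  have hL := hC.isLipschitzDomain
  have hint := hL.integrableOn_inner_normal_of_continuousOn hF.continuousOn
  have hsD : S.bdD ⊆ frontier S.Ω := subset_union_left.trans hC.subset
  have hsN : S.bdN ⊆ frontier S.Ω := subset_union_right.trans hC.subset
  have hFν : ∀ x ∈ frontier S.Ω, inner ℝ (F x) (S.ν x)
      = inner ℝ (S.up t x) (app (S.σp t x) (S.ν x))
        - (1 / 2) * S.rhop * ‖S.up t x‖ ^ 2 * inner ℝ (S.up t x) (S.ν x) := fun x hx => by
    rw [hFu x hx, energyFlux, inner_sub_left, real_inner_smul_left,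
      inner_app_comm (transpose_stress _ _ _ _)]
    rfl
  have hD : ∀ x ∈ S.bdD, inner ℝ (F x) (S.ν x) = S.workD t x := fun x hx => by
    rw [hFν x (hsD hx), hS.solves.bc_D t ht x hx, workD]
  -- The stress condition is imposed only at points where `ν` is the outward normal, that is, almost
  -- everywhere.
  have hN : ∀ᵐ x ∂((μHE[2] : Measure E3).restrict S.bdN), inner ℝ (F x) (S.ν x) = S.workN t x := by
    filter_upwards [ae_restrict_of_ae_restrict_of_subset hsN hC.normal,
      ae_restrict_mem hC.measN] with x h1 h2
    rw [hFν x (hsN h2), hS.solves.bc_N t ht x h2 h1, workN]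
  refine ⟨(hint.mono_set hsD).congr_fun hD hC.measD, (hint.mono_set hsN).congr hN, ?_⟩
  rw [hC.setIntegral_frontier hint, setIntegral_congr_fun hC.measD hD, integral_congr_ae hN,
    boundaryWork]

/-- The balance of energy in the outer phase. -/
lemma outer_phase :
    IntegrableOn (fun x => S.rhop * ‖S.up t x‖ ^ 2) (S.Ωp t) ∧
    IntegrableOn (fun x => normSq (strain (S.up t) x)) (S.Ωp t) ∧
    IntegrableOn (fun x => inner ℝ (S.up t x) (S.fp t x)) (S.Ωp t) ∧
    IntegrableOn (S.workD t) S.bdD μHE[2] ∧ IntegrableOn (S.workN t) S.bdN μHE[2] ∧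
    HasDerivAt (fun s => (1 / 2) * ∫ x in S.Ωp s, S.rhop * ‖S.up s x‖ ^ 2)
      (S.boundaryWork t
        - (∫ x in S.Γ t, inner ℝ (S.up t x) (app (S.σp t x) (S.n t x)) ∂μHE[2])
        - 2 * S.mup * (∫ x in S.Ωp t, normSq (strain (S.up t) x))
        + ∫ x in S.Ωp t, inner ℝ (S.up t x) (S.fp t x)) t := by
  have hI := hS.interface
  have hC := hS.container
  have hb := hC.bounded
  have hL := hI.isLipschitzDomain ht hb
  have hM := hI.isBoundedMovingDomain ht hb
  obtain ⟨i1, i2, i3, e, F, he, hes, hF, hFs, heu, hFu, hbal⟩ := fluid_power_balance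
    (f := S.fp t) (rho := S.rhop) (mu := S.mup)
    (hS.isOpen_Ωp).measurableSet (hb.subset sdiff_subset) (hS.regular.up_C2 t ht)
    (hS.regular.pp_C1 t ht) (hS.solves.momentum_p t ht) (hS.solves.incompressible_p t ht)
  obtain ⟨i4, i5, hB⟩ := hS.boundary_work ht hF.continuous
    fun x hx => hFu x (IsInterface.frontier_subset_closure_Ωp hC hI ht hx)
  refine ⟨i1, i2, i3, i4, i5, ?_⟩
  have hev := IsInterface.eventually_forall_mem_Ωp hC hI ht
    (P := fun s x => e s x = 1 / 2 * S.rhop * ‖S.up s x‖ ^ 2) heu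
  -- The extended density `e` is defined on the whole container, so the energy of the outer phase
  -- can be written as a difference.
  have hE : (fun s => (1 / 2) * ∫ x in S.Ωp s, S.rhop * ‖S.up s x‖ ^ 2) =ᶠ[𝓝 t]
      fun s => (∫ x in S.Ω, e s x) - ∫ x in S.Ωm s, e s x := by
    filter_upwards [hev, Ioo_mem_nhds ht.1 ht.2] with s h1 h2
    rw [← integral_const_mul, ← IsInterface.setIntegral_Ωp hC hI h2 (contDiff_slice he s).continuous]
    refine setIntegral_congr_fun (hS.isOpen_Ωp).measurableSet fun x hx => ?_
    rw [h1 x hx]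
    ring
  have hfr := IsInterface.Γ_subset_closure_Ωp hC hI ht
  refine (((hC.isLipschitzDomain.hasDerivAt_integral he hes t).sub
    (hM.reynolds he hes)).congr_of_eventuallyEq hE).congr_deriv ?_
  have hfl := hS.integral_relative_flux ht (rho := S.rhop) (mu := S.mup) (p := S.pp t)
    (contDiff_slice he t).continuous (hasCompactSupport_slice hes t) hF.continuous
    (fun x hx => (heu x (hfr hx)).self_of_nhds) (fun x hx => hFu x (hfr hx))
    (hS.solves.noPenetration_p t ht)
  have hdt := hL.divergence hF hFs
  have hdt' := hC.isLipschitzDomain.divergence hF hFs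
  have hs1 := IsInterface.setIntegral_Ωp hC hI ht (continuous_deriv_time_slice he t)
  have hs2 := IsInterface.setIntegral_Ωp hC hI ht (continuous_dvg hF)
  rw [hs2, hdt, hdt', hB, hs1] at hbal
  simp only [σp]
  rw [← hfl]
  simp only [Γ]
  linarith

/-- The balance of energy on the interface. -/
lemma surface_phase
    (hJ : IntegrableOn (fun x => inner ℝ (S.U t x)
      (app (S.σp t x) (S.n t x) - app (S.σm t x) (S.n t x))) (S.Γ t) μHE[2]) :
    IntegrableOn (fun x => S.rhoS * ‖S.U t x‖ ^ 2) (S.Γ t) μHE[2] ∧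
    IntegrableOn (fun x => normSq (surfStrain (S.n t) (S.U t) x)) (S.Γ t) μHE[2] ∧
    IntegrableOn (fun x => inner ℝ (S.U t x) (S.be t x)) (S.Γ t) μHE[2] ∧
    HasDerivAt S.surfaceEnergy
      (-(2 * S.muS * ∫ x in S.Γ t, normSq (surfStrain (S.n t) (S.U t) x) ∂μHE[2])
        + (∫ x in S.Γ t, inner ℝ (S.U t x)
            (app (S.σp t x) (S.n t x) - app (S.σm t x) (S.n t x)) ∂μHE[2])
        + ∫ x in S.Γ t, inner ℝ (S.U t x) (S.be t x) ∂μHE[2]) t := by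
  have hI := hS.interface
  have hb := hS.container.bounded
  have hm : MeasurableSet (S.Γ t) := isClosed_frontier.measurableSet
  have hK : IsCompact (S.Γ t) := IsInterface.isCompact_Γ hb (hI.closure_subset ht)
  obtain ⟨N, hN, hNs, hNn⟩ := hI.exists_normal_ext ht hb
  obtain ⟨V, hV, hVs, hVU⟩ := exists_spacetime_extension (n := 2) hK (hS.regular.U_C2 t ht)
  obtain ⟨q, hq, -, hqπ⟩ := exists_extension (n := 1) hK (hS.regular.π_C1 t ht)
  have hqπ' := eventually_nhdsSet_iff_forall.1 hqπ
  have hV2 : ContDiff ℝ 2 (Function.uncurry V) := hV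
  have hV1 : ContDiff ℝ 1 (Function.uncurry V) := hV2.of_le (by norm_num)
  have hSS := hI.isSmoothSurface ht hb hN hNn
  have gN : ∀ x ∈ S.Γ t, N t =ᶠ[𝓝 x] S.n t := fun x hx => slice_eventuallyEq (hNn x hx)
  have eN : ∀ x ∈ S.Γ t, N t x = S.n t x := fun x hx => (gN x hx).self_of_nhds
  have gV : ∀ x ∈ S.Γ t, V t =ᶠ[𝓝 x] S.U t := fun x hx => slice_eventuallyEq (hVU x hx)
  have eV : ∀ x ∈ S.Γ t, V t x = S.U t x := fun x hx => (gV x hx).self_of_nhds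
  have hdiv : ∀ x ∈ S.Γ t, surfDvg (N t) (V t) x = 0 := fun x hx => by
    rw [surfDvg_congr (eN x hx) (gV x hx), hS.solves.inextensible t ht x hx]
  have hJ' : IntegrableOn (fun x => inner ℝ (V t x)
      (app (S.σp t x) (S.n t x) - app (S.σm t x) (S.n t x))) (S.Γ t) μHE[2] :=
    integrableOn_of_eqOn hm hJ fun x hx => by rw [eV x hx]
  obtain ⟨i1, i2, hbal⟩ := surface_power_balance hSS (rho := S.rhoS) (mu := S.muS) (b := S.be t)
    hV2 hVs hq hJ' (fun x hx => by
      have hκ : curvature (N t) x = curvature (S.n t) x := surfDvg_congr (eN x hx) (gN x hx)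
      rw [matDeriv_congr (hVU x hx), hS.solves.momentum_S t ht x hx,
        surfGradS_congr (eN x hx) (hqπ' x hx), surfDvgT_surfStrain_congr (gN x hx) (gV x hx), hκ,
        (hqπ' x hx).self_of_nhds, eN x hx]) hdiv
  have e1 : ∀ x ∈ S.Γ t, normSq (surfStrain (S.n t) (S.U t) x)
      = normSq (surfStrain (N t) (V t) x) := fun x hx => by
    rw [surfStrain_congr (eN x hx) (gV x hx)]
  have e2 : ∀ x ∈ S.Γ t, inner ℝ (S.U t x) (S.be t x) = inner ℝ (V t x) (S.be t x) :=
    fun x hx => by rw [eV x hx]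
  have e3 : ∀ x ∈ S.Γ t, inner ℝ (S.U t x)
      (app (S.σp t x) (S.n t x) - app (S.σm t x) (S.n t x)) = inner ℝ (V t x)
      (app (S.σp t x) (S.n t x) - app (S.σm t x) (S.n t x)) :=
    fun x hx => by rw [eV x hx]
  refine ⟨?_, integrableOn_of_eqOn hm i1 e1, integrableOn_of_eqOn hm i2 e2, ?_⟩
  · exact hSS.integrableOn_frontier_of_continuousOn
      (continuousOn_const.mul ((continuousOn_slice (hS.regular.U_C2 t ht)).norm.pow 2))
  have hg : ContDiff ℝ 1 (Function.uncurry fun s x => 1 / 2 * S.rhoS * ‖V s x‖ ^ 2) :=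
    contDiff_const.mul (hV1.norm_sq ℝ)
  have hgs : HasCompactSupport (Function.uncurry fun s x => 1 / 2 * S.rhoS * ‖V s x‖ ^ 2) :=
    hVs.comp_left (g := fun w : E3 => 1 / 2 * S.rhoS * ‖w‖ ^ 2) (by simp)
  have hev := (hI.isBoundedMovingDomain ht hb).eventually_forall_mem_frontier
    (P := fun s x => V s x = S.U s x) hVU
  have hE : S.surfaceEnergy =ᶠ[𝓝 t]
      fun s => ∫ x in S.Γ s, 1 / 2 * S.rhoS * ‖V s x‖ ^ 2 ∂μHE[2] := by
    filter_upwards [hev] with s h1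
    rw [surfaceEnergy, ← integral_const_mul]
    refine setIntegral_congr_fun isClosed_frontier.measurableSet fun x hx => ?_
    rw [h1 x hx]
    ring
  -- The surface velocity is an admissible transporting field: its normal component is `U_N` and its
  -- surface divergence vanishes.
  refine ((hI.hasDerivAt_surface ht hb hN hNn hNs hg (contDiff_slice hV1 t) hgs
    (fun x hx => by rw [eV x hx, eN x hx, UN]) hdiv).congr_of_eventuallyEq hE).congr_deriv ?_
  rw [setIntegral_congr_fun hm e1, setIntegral_congr_fun hm e2, setIntegral_congr_fun hm e3]
  exact hbal

/-- The work of the bulk stresses at the interface is dissipated by friction. -/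
lemma friction_balance :
    IntegrableOn (fun x => S.frm t x * ‖S.slipm t x‖ ^ 2) (S.Γ t) μHE[2] ∧
    IntegrableOn (fun x => S.frp t x * ‖S.slipp t x‖ ^ 2) (S.Γ t) μHE[2] ∧
    IntegrableOn (fun x => inner ℝ (S.U t x)
      (app (S.σp t x) (S.n t x) - app (S.σm t x) (S.n t x))) (S.Γ t) μHE[2] ∧
    (∫ x in S.Γ t, inner ℝ (S.um t x) (app (S.σm t x) (S.n t x)) ∂μHE[2])
      - (∫ x in S.Γ t, inner ℝ (S.up t x) (app (S.σp t x) (S.n t x)) ∂μHE[2])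
      + (∫ x in S.Γ t, inner ℝ (S.U t x)
          (app (S.σp t x) (S.n t x) - app (S.σm t x) (S.n t x)) ∂μHE[2])
      = -S.frictionDissipation t := by
  have hI := hS.interface
  have hC := hS.container
  have hb := hC.bounded
  have hL := hI.isLipschitzDomain ht hb
  have hm : MeasurableSet (S.Γ t) := isClosed_frontier.measurableSet
  have hK : IsCompact (S.Γ t) := IsInterface.isCompact_Γ hb (hI.closure_subset ht)
  have hfm : S.Γ t ⊆ closure (S.Ωm t) := frontier_subset_closure
  have hfp := IsInterface.Γ_subset_closure_Ωp hC hI ht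
  have cn := hS.continuousOn_n ht
  have cU := continuousOn_slice (hS.regular.U_C2 t ht)
  have hum := fun x hx => hS.regular.um_C2 t ht x (hfm hx)
  have hup := fun x hx => hS.regular.up_C2 t ht x (hfp hx)
  have cum := continuousOn_slice hum
  have cup := continuousOn_slice hup
  have cσm : ContinuousOn (fun x => app (S.σm t x) (S.n t x)) (S.Γ t) :=
    continuousOn_app (continuousOn_stress hK hum fun x hx => hS.regular.pm_C1 t ht x (hfm hx)) cn
  have cσp : ContinuousOn (fun x => app (S.σp t x) (S.n t x)) (S.Γ t) :=
    continuousOn_app (continuousOn_stress hK hup fun x hx => hS.regular.pp_C1 t ht x (hfp hx)) cn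
  have i1 := hL.integrableOn_frontier_of_continuousOn (cum.inner cσm)
  have i2 := hL.integrableOn_frontier_of_continuousOn (cup.inner cσp)
  have i3 := hL.integrableOn_frontier_of_continuousOn (cU.inner cσm)
  have i4 := hL.integrableOn_frontier_of_continuousOn (cU.inner cσp)
  -- When `u` and `U` have the same normal component, the slip velocity is `u - U`, and it is
  -- tangential.
  have hslip : ∀ (u : E3) (x : E3), inner ℝ u (S.n t x) = S.UN t x →
      app (proj (S.n t) x) u - S.UT t x = u - S.U t x := fun u x h => by
    rw [app_proj, h, UT]
    abel
  have hnslip : ∀ (u : E3) (x : E3), inner ℝ u (S.n t x) = S.UN t x →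
      app (proj (S.n t) x) (u - S.U t x) = u - S.U t x := fun u x h => by
    rw [app_proj, inner_sub_left, h, UN, sub_self, zero_smul, sub_zero]
  -- Moving `P` from the tangential slip `u - U` to `σn` brings in the friction law. The friction
  -- coefficient may be irregular; the right-hand side is continuous on the interface, which gives
  -- integrability.
  have km : ∀ x ∈ S.Γ t, S.frm t x * ‖S.slipm t x‖ ^ 2
      = inner ℝ (S.U t x) (app (S.σm t x) (S.n t x))
        - inner ℝ (S.um t x) (app (S.σm t x) (S.n t x)) := fun x hx => by
    have h := hS.solves.noPenetration_m t ht x hx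
    rw [← inner_sub_left, ← neg_sub, inner_neg_left, ← hnslip _ x h,
      inner_app_comm (transpose_proj _ _), hS.solves.friction_m t ht x hx, slipm, hslip _ x h,
      inner_smul_right, real_inner_self_eq_norm_sq]
    ring
  have kp : ∀ x ∈ S.Γ t, S.frp t x * ‖S.slipp t x‖ ^ 2
      = inner ℝ (S.up t x) (app (S.σp t x) (S.n t x))
        - inner ℝ (S.U t x) (app (S.σp t x) (S.n t x)) := fun x hx => by
    have h := hS.solves.noPenetration_p t ht x hx
    rw [← inner_sub_left, ← hnslip _ x h,
      inner_app_comm (transpose_proj _ _), hS.solves.friction_p t ht x hx, slipp, hslip _ x h,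
      inner_smul_right, real_inner_self_eq_norm_sq]
  have hJ : ∀ x ∈ S.Γ t, inner ℝ (S.U t x) (app (S.σp t x) (S.n t x) - app (S.σm t x) (S.n t x))
      = inner ℝ (S.U t x) (app (S.σp t x) (S.n t x))
        - inner ℝ (S.U t x) (app (S.σm t x) (S.n t x)) := fun x _ => inner_sub_right _ _ _
  refine ⟨integrableOn_of_eqOn hm (i3.sub i1) km, integrableOn_of_eqOn hm (i2.sub i4) kp,
    integrableOn_of_eqOn hm (i4.sub i3) hJ, ?_⟩
  have j1 := integral_sub i3 i1
  have j2 := integral_sub i2 i4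
  have j3 := integral_sub i4 i3
  rw [frictionDissipation, setIntegral_congr_fun hm km, setIntegral_congr_fun hm kp,
    setIntegral_congr_fun hm hJ]
  simp only [Γ] at j1 j2 j3 ⊢
  rw [j1, j2, j3]
  ring

/-- In the sum of the three balances the stress powers on the interface form the left-hand side of
`friction_balance`, which also provides the integrability that `surface_phase` requires. -/
theorem energy_balance : S.IntegralsExist t ∧
    HasDerivAt S.totalEnergy
      (-S.bulkDissipation t - S.surfaceDissipation t - S.frictionDissipation t
        + S.forceWork t + S.boundaryWork t) t := by
  obtain ⟨m1, m2, m3, hm⟩ := hS.inner_phase ht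
  obtain ⟨p1, p2, p3, p4, p5, hp⟩ := hS.outer_phase ht
  obtain ⟨f1, f2, f3, hf⟩ := hS.friction_balance ht
  obtain ⟨s1, s2, s3, hs⟩ := hS.surface_phase ht f3
  refine ⟨⟨m1, p1, s1, m2, p2, s2, f1, f2, m3, p3, s3, p4, p5⟩, ?_⟩
  refine ((hm.add hp).add hs).congr_deriv ?_
  rw [bulkDissipation, surfaceDissipation, forceWork]
  linarith

omit hS ht in
lemma power_nonpos (hm : 0 ≤ S.mum) (hp : 0 ≤ S.mup) (hs : 0 ≤ S.muS)
    (hfr : ∀ x ∈ S.Γ t, 0 ≤ S.frm t x ∧ 0 ≤ S.frp t x) (hU : S.Unforced t)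
    (hB : S.boundaryWork t ≤ 0) :
    -S.bulkDissipation t - S.surfaceDissipation t - S.frictionDissipation t
      + S.forceWork t + S.boundaryWork t ≤ 0 := by
  have hsq : ∀ A : Mat3, 0 ≤ normSq A := fun A =>
    Finset.sum_nonneg fun i _ => Finset.sum_nonneg fun j _ => sq_nonneg _
  have hΓ : MeasurableSet (S.Γ t) := isClosed_frontier.measurableSet
  have h1 : 0 ≤ S.bulkDissipation t := by
    have a := integral_nonneg (μ := volume.restrict (S.Ωm t))
      (f := fun x => normSq (strain (S.um t) x)) fun x => hsq _
    have b := integral_nonneg (μ := volume.restrict (S.Ωp t))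
      (f := fun x => normSq (strain (S.up t) x)) fun x => hsq _
    unfold bulkDissipation
    positivity
  have h2 : 0 ≤ S.surfaceDissipation t := by
    have a := integral_nonneg (μ := (μHE[2] : Measure E3).restrict (S.Γ t))
      (f := fun x => normSq (surfStrain (S.n t) (S.U t) x)) fun x => hsq _
    unfold surfaceDissipation
    positivity
  have h3 : 0 ≤ S.frictionDissipation t := add_nonneg
    (setIntegral_nonneg hΓ fun x hx => mul_nonneg (hfr x hx).1 (sq_nonneg _))
    (setIntegral_nonneg hΓ fun x hx => mul_nonneg (hfr x hx).2 (sq_nonneg _))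
  have h4 : S.forceWork t = 0 := by
    rw [forceWork,
      setIntegral_eq_zero_of_forall_eq_zero fun x hx => by rw [hU.1 x hx, inner_zero_right],
      setIntegral_eq_zero_of_forall_eq_zero fun x hx => by rw [hU.2.1 x hx, inner_zero_right],
      setIntegral_eq_zero_of_forall_eq_zero fun x hx => by rw [hU.2.2 x hx, inner_zero_right]]
    simp
  linarith

end IsSmoothSolution

end TwoPhaseFlow

/-! ### The energy balance and dissipativity -/

theorem mainTheorem1 (S : TwoPhaseFlow) (hS : S.IsSmoothSolution) :
    -- energy balance
    (∀ t ∈ Ioo 0 S.T, S.IntegralsExist t ∧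
      HasDerivAt S.totalEnergy
        (-S.bulkDissipation t - S.surfaceDissipation t - S.frictionDissipation t
          + S.forceWork t + S.boundaryWork t) t) ∧
    -- dissipativity
    (0 ≤ S.mum → 0 ≤ S.mup → 0 ≤ S.muS →
      (∀ t ∈ Ioo 0 S.T, ∀ x ∈ S.Γ t, 0 ≤ S.frm t x ∧ 0 ≤ S.frp t x) →
      (∀ t ∈ Ioo 0 S.T, S.Unforced t → S.boundaryWork t ≤ 0 → deriv S.totalEnergy t ≤ 0) ∧
      ((∀ t ∈ Ioo 0 S.T, S.Unforced t ∧ S.boundaryWork t ≤ 0) →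
        AntitoneOn S.totalEnergy (Ioo 0 S.T))) := by
  have hder : ∀ t ∈ Ioo 0 S.T, _ := fun t ht => hS.energy_balance ht
  refine ⟨hder, fun hm hp hs hfr => ?_⟩
  have hle : ∀ t ∈ Ioo 0 S.T, S.Unforced t → S.boundaryWork t ≤ 0 → deriv S.totalEnergy t ≤ 0 :=
    fun t ht hU hB => by
      rw [(hder t ht).2.deriv]
      exact TwoPhaseFlow.IsSmoothSolution.power_nonpos hm hp hs (hfr t ht) hU hB
  refine ⟨hle, fun h => ?_⟩
  refine antitoneOn_of_deriv_nonpos (convex_Ioo 0 S.T)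
    (fun t ht => (hder t ht).2.continuousAt.continuousWithinAt) ?_ ?_
  · rw [interior_Ioo]
    exact fun t ht => (hder t ht).2.differentiableAt.differentiableWithinAt
  · rw [interior_Ioo]
    exact fun t ht => hle t ht (h t ht).1 (h t ht).2
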